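/- Notation. Let $d,r$ be non-negative integers. For $f\in L^2(\mathbb R^d)$ let $\hat f$ be the Fourier transform, normalized by $\hat f(\xi)=\int f(x)e^{-2\pi i x\cdot\xi}\,dx$ for $f\in L^1\cap L^2$. For $z\in\mathbb Z^d$ and an invertible real $d\times d$ matrix $A$ define operators on $L^2(\mathbb R^d)$ by $$(T_zf)(x)=f(x-z),\qquad (D_Af)(x)=\sqrt{|\det A|}\,f(Ax),\qquad (\widetilde D_Af)(x)=|\det A|\,f(Ax),$$ and let $\overline T_z,\overline D_A,\overline{\widetilde D}_A$ be the operators on the Hilbert direct sum $L^2(\mathbb R^d)^r=L^2(\mathbb R^d)\oplus\cdots\oplus L^2(\mathbb R^d)$ ($r$ summands) that act by $T_z,D_A,\widetilde D_A$, respectively, in each summand. $A^*$ is the transpose of $A$. The matrix $A$ is expansive if all its (complex) eigenvalues have modulus strictly greater than $1$, and integral if all its entries are integers. A family $(x_j)_{j\in J}$ in a Hilbert space $H$ is a Bessel sequence if there is a constant $C$ with $\sum_j|\langle v,x_j\rangle|^2\le C\|v\|^2$ for all $v\in H$, and a Parseval frame for $H$ if $\sum_j|\langle v,x_j\rangle|^2=\|v\|^2$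 for all $v\in H$. All systems below are regarded as families indexed by $(n,z)\in\mathbb Z\times\mathbb Z^d$. Theorem. Let $A$ be an expansive integral $d\times d$ matrix and let $\psi_1,\dots,\psi_r\in L^2(\mathbb R^d)$ be such that for each $i$ the affine system $\mathcal U_A(\psi_i)=\{D_A^nT_z\psi_i : n\in\mathbb Z,\ z\in\mathbb Z^d\}$ is a Bessel sequence in $L^2(\mathbb R^d)$. Put $\Psi=\psi_1\oplus\cdots\oplus\psi_r\in L^2(\mathbb R^d)^r$. The following are equivalent: 1. the affine system $\{\overline D_A^{\,n}\,\overline T_z\Psi : n\in\mathbb Z,\ z\in\mathbb Z^d\}$ is a Parseval frame for $L^2(\mathbb R^d)^r$; 2. the quasi-affine system $\{\overline D_A^{\,n}\,\overline T_z\Psi : n\ge 0,\ z\in\mathbb Z^d\}\cup\{\overline T_z\,\overline{\widetilde D}_A^{\,n}\Psi : n<0,\ z\in\mathbb Z^d\}$ is a Parseval frame for $L^2(\mathbb R^d)^r$; 3. both of the following hold (with the series convergent for a.e. $\xi$): (a) for all $i,j\in\{1,\dots,r\}$, $\displaystyle\sum_{n\in\mathbb Z}\hat\psi_i(A^{*n}\xi)\,\overline{\hat\psi_j(A^{*n}\xi)}=\delta_{i,j}$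 for a.e. $\xi\in\mathbb R^d$; (b) for all $i,j\in\{1,\dots,r\}$ and all $k\in\mathbb Z^d\setminus A^*\mathbb Z^d$, $\displaystyle\sum_{n=0}^{\infty}\hat\psi_i(A^{*n}\xi)\,\overline{\hat\psi_j(A^{*n}(\xi+k))}=0$ for a.e. $\xi\in\mathbb R^d$. -/

import Mathlib

open MeasureTheory
open scoped FourierTransform ComplexConjugate ENNReal

noncomputable section

namespace SuperWavelet

/-- Euclidean space `ℝ^d`. -/
abbrev E (d : ℕ) : Type := EuclideanSpace ℝ (Fin d)

/-- The complex Hilbert space `L²(ℝ^d)` (Lebesgue measure). -/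
abbrev L2 (d : ℕ) : Type := Lp (α := E d) ℂ 2 (volume : Measure (E d))

/-- The `r`-fold Hilbert direct sum `L²(ℝ^d)^r`. -/
abbrev L2Sum (d r : ℕ) : Type := PiLp 2 (fun _ : Fin r => L2 d)

/-- The integer vector `z ∈ ℤ^d`, viewed as a point of `ℝ^d`. -/
def latticePt {d : ℕ} (z : Fin d → ℤ) : E d := WithLp.toLp 2 (fun i => (z i : ℝ))

section Frames

variable {H : Type*} [NormedAddCommGroup H] [InnerProductSpace ℂ H] {J : Type*}

/-- `(x_j)` is a Bessel sequence: for some `C`, `∑_j |⟨v, x_j⟩|² ≤ C ‖v‖²` for all `v`. -/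
def IsBessel (x : J → H) : Prop :=
  ∃ C : ℝ, ∀ v : H, Summable (fun j => ‖inner ℂ (x j) v‖ ^ 2) ∧
    ∑' j, ‖inner ℂ (x j) v‖ ^ 2 ≤ C * ‖v‖ ^ 2

/-- `(x_j)` is a Parseval frame: `∑_j |⟨v, x_j⟩|² = ‖v‖²` for all `v`. -/
def IsParsevalFrame (x : J → H) : Prop :=
  ∀ v : H, HasSum (fun j => ‖inner ℂ (x j) v‖ ^ 2) (‖v‖ ^ 2)

end Frames

section Matrices

/-- `A` is expansive: every (complex) eigenvalue of `A` has modulus strictly greater than `1`. -/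
def IsExpansive {d : ℕ} (A : Matrix (Fin d) (Fin d) ℝ) : Prop :=
  ∀ μ : ℂ, Module.End.HasEigenvalue (Matrix.toLin' (A.map ((↑) : ℝ → ℂ))) μ → 1 < ‖μ‖

/-- `A` is integral: all its entries are integers. -/
def IsIntegralMatrix {d : ℕ} (A : Matrix (Fin d) (Fin d) ℝ) : Prop :=
  ∀ i j, ∃ m : ℤ, A i j = m

/-- An expansive matrix is invertible, so letting the dilation matrices range over
`GL (Fin d) ℝ` does not exclude any expansive matrix. -/
theorem IsExpansive.isUnit {d : ℕ} {A : Matrix (Fin d) (Fin d) ℝ} (hA : IsExpansive A) :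
    IsUnit A := by
  rw [Matrix.isUnit_iff_isUnit_det, isUnit_iff_ne_zero]
  intro h0
  have h1 : (A.map ((↑) : ℝ → ℂ)).det = 0 := by
    have := RingHom.map_det Complex.ofRealHom A
    rw [h0, map_zero] at this
    exact this.symm
  obtain ⟨v, hv, hv0⟩ := Matrix.exists_mulVec_eq_zero_iff.mpr h1
  have h2 : Module.End.HasEigenvalue (Matrix.toLin' (A.map ((↑) : ℝ → ℂ))) 0 := by
    refine Module.End.hasEigenvalue_of_hasEigenvector (x := v) ⟨?_, hv⟩
    rw [Module.End.mem_eigenspace_iff, zero_smul, Matrix.toLin'_apply, hv0]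
  have := hA 0 h2
  simp at this
  linarith

end Matrices

section Operators

variable {d : ℕ}

/-- The unitary translation operator `(T_α f)(x) = f(x - α)` on `L²(ℝ^d)`. -/
def translation (α : E d) : L2 d ≃ₗᵢ[ℂ] L2 d where
  toFun := Lp.compMeasurePreserving (fun x => x - α) (measurePreserving_sub_right volume α)
  invFun := Lp.compMeasurePreserving (fun x => x + α) (measurePreserving_add_right volume α)
  map_add' := map_add _
  map_smul' c f := by
    ext1
    filter_upwards [Lp.coeFn_compMeasurePreserving (c • f)
      (measurePreserving_sub_right volume α),
      Lp.coeFn_compMeasurePreserving f (measurePreserving_sub_right volume α),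
      Lp.coeFn_smul c (Lp.compMeasurePreserving (fun x => x - α)
        (measurePreserving_sub_right volume α) f),
      (measurePreserving_sub_right volume α).quasiMeasurePreserving.ae (Lp.coeFn_smul c f)]
      with x h1 h2 h3 h4
    simp only [RingHom.id_apply]
    rw [h1, h3, Pi.smul_apply, h2]
    exact h4
  left_inv f := by
    ext1
    filter_upwards [Lp.coeFn_compMeasurePreserving (Lp.compMeasurePreserving (fun x => x - α)
        (measurePreserving_sub_right volume α) f) (measurePreserving_add_right volume α),
      (measurePreserving_add_right volume α).quasiMeasurePreserving.ae
        (Lp.coeFn_compMeasurePreserving f (measurePreserving_sub_right volume α))]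
      with x h1 h2
    rw [h1, Function.comp_apply, h2]
    simp
  right_inv f := by
    ext1
    filter_upwards [Lp.coeFn_compMeasurePreserving (Lp.compMeasurePreserving (fun x => x + α)
        (measurePreserving_add_right volume α) f) (measurePreserving_sub_right volume α),
      (measurePreserving_sub_right volume α).quasiMeasurePreserving.ae
        (Lp.coeFn_compMeasurePreserving f (measurePreserving_add_right volume α))]
      with x h1 h2
    rw [h1, Function.comp_apply, h2]
    simp
  norm_map' f := Lp.norm_compMeasurePreserving f (measurePreserving_sub_right volume α)

theorem coeFn_translation (α : E d) (f : L2 d) :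
    translation α f =ᵐ[volume] fun x => f (x - α) :=
  Lp.coeFn_compMeasurePreserving f (measurePreserving_sub_right volume α)

theorem det_toEuclideanLin (M : Matrix (Fin d) (Fin d) ℝ) :
    LinearMap.det (Matrix.toEuclideanLin M) = M.det := by
  change LinearMap.det (Matrix.toLpLin 2 2 M) = M.det
  rw [Matrix.toLpLin_eq_toLin, LinearMap.det_toLin]

theorem det_toEuclideanLin_ne_zero (A : GL (Fin d) ℝ) :
    LinearMap.det (Matrix.toEuclideanLin (A : Matrix (Fin d) (Fin d) ℝ)) ≠ 0 := by
  rw [det_toEuclideanLin]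
  exact ((Matrix.isUnit_iff_isUnit_det _).mp A.isUnit).ne_zero

theorem quasiMeasurePreserving_matrix (A : GL (Fin d) ℝ) :
    Measure.QuasiMeasurePreserving
      (Matrix.toEuclideanLin (A : Matrix (Fin d) (Fin d) ℝ) : E d → E d) volume volume := by
  refine ⟨(LinearMap.continuous_of_finiteDimensional _).measurable, ?_⟩
  rw [Measure.map_linearMap_addHaar_eq_smul_addHaar _ (det_toEuclideanLin_ne_zero A)]
  exact Measure.smul_absolutelyContinuous

theorem eLpNorm_comp_matrix (A : GL (Fin d) ℝ) (f : L2 d) :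
    eLpNorm (fun x : E d => ((√|(A : Matrix (Fin d) (Fin d) ℝ).det| : ℝ) : ℂ) *
      f (Matrix.toEuclideanLin (A : Matrix (Fin d) (Fin d) ℝ) x)) 2 volume
      = eLpNorm f 2 volume := by
  have hdet := det_toEuclideanLin_ne_zero A
  set L := Matrix.toEuclideanLin (A : Matrix (Fin d) (Fin d) ℝ) with hL
  have hcont : Continuous L := L.continuous_of_finiteDimensional
  have hmap := Measure.map_linearMap_addHaar_eq_smul_addHaar (volume : Measure (E d)) hdet
  have hf : AEStronglyMeasurable f (Measure.map L volume) := by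
    rw [hmap]
    exact (Lp.aestronglyMeasurable f).smul_measure _
  have h1 : eLpNorm (fun x : E d => f (L x)) 2 volume
      = eLpNorm f 2 (Measure.map L volume) :=
    (eLpNorm_map_measure hf hcont.measurable.aemeasurable).symm
  have h2 : (fun x : E d => ((√|(A : Matrix (Fin d) (Fin d) ℝ).det| : ℝ) : ℂ) * f (L x))
      = ((√|(A : Matrix (Fin d) (Fin d) ℝ).det| : ℝ) : ℂ) • (fun x : E d => f (L x)) := rfl
  rw [h2, eLpNorm_const_smul, h1, hmap,
    eLpNorm_smul_measure_of_ne_top (by simp), smul_eq_mul, ← mul_assoc]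
  have hpos : 0 < |LinearMap.det L| := abs_pos.mpr hdet
  have h3 : ‖((√|(A : Matrix (Fin d) (Fin d) ℝ).det| : ℝ) : ℂ)‖ₑ
      * ENNReal.ofReal |(LinearMap.det L)⁻¹| ^ (1 / (2 : ℝ≥0∞)).toReal = 1 := by
    rw [← det_toEuclideanLin, ← hL]
    have : ‖((√|LinearMap.det L| : ℝ) : ℂ)‖ₑ = ENNReal.ofReal (√|LinearMap.det L|) := by
      rw [← ofReal_norm, Complex.norm_real, Real.norm_of_nonneg (Real.sqrt_nonneg _)]
    rw [this, ENNReal.ofReal_rpow_of_nonneg (abs_nonneg _) (by simp),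
      ← ENNReal.ofReal_mul (Real.sqrt_nonneg _)]
    have h4 : (1 / (2 : ℝ≥0∞)).toReal = 1 / 2 := by simp
    rw [h4, ← Real.sqrt_eq_rpow, abs_inv, Real.sqrt_inv, mul_inv_cancel₀, ENNReal.ofReal_one]
    exact (Real.sqrt_pos.mpr hpos).ne'
  rw [h3, one_mul]

theorem memLp_dilation (A : GL (Fin d) ℝ) (f : L2 d) :
    MemLp (fun x : E d => ((√|(A : Matrix (Fin d) (Fin d) ℝ).det| : ℝ) : ℂ) *
      f (Matrix.toEuclideanLin (A : Matrix (Fin d) (Fin d) ℝ) x)) 2 volume := by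
  refine ⟨?_, ?_⟩
  · exact ((Lp.aestronglyMeasurable f).comp_quasiMeasurePreserving
      (quasiMeasurePreserving_matrix A)).const_mul _
  · rw [eLpNorm_comp_matrix]
    exact Lp.eLpNorm_lt_top f

/-- The function underlying the dilation operator: `f ↦ √|det A| · f(A ·)`. -/
def dilationFun (A : GL (Fin d) ℝ) (f : L2 d) : L2 d := (memLp_dilation A f).toLp _

theorem coeFn_dilationFun (A : GL (Fin d) ℝ) (f : L2 d) :
    dilationFun A f =ᵐ[volume] fun x => ((√|(A : Matrix (Fin d) (Fin d) ℝ).det| : ℝ) : ℂ) *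
      f (Matrix.toEuclideanLin (A : Matrix (Fin d) (Fin d) ℝ) x) :=
  (memLp_dilation A f).coeFn_toLp

theorem ae_comp_matrix (A : GL (Fin d) ℝ) {p : E d → Prop} (hp : ∀ᵐ x, p x) :
    ∀ᵐ x, p (Matrix.toEuclideanLin (A : Matrix (Fin d) (Fin d) ℝ) x) :=
  (quasiMeasurePreserving_matrix A).ae hp

theorem dilationFun_inv (A B : GL (Fin d) ℝ) (hAB : A * B = 1) (f : L2 d) :
    dilationFun B (dilationFun A f) = f := by
  have hmul : (A : Matrix (Fin d) (Fin d) ℝ) * (B : Matrix (Fin d) (Fin d) ℝ) = 1 := by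
    rw [← Units.val_mul, hAB, Units.val_one]
  ext1
  filter_upwards [coeFn_dilationFun B (dilationFun A f),
    ae_comp_matrix B (coeFn_dilationFun A f)] with x h1 h2
  rw [h1, h2, ← mul_assoc, ← Complex.ofReal_mul, ← Real.sqrt_mul (abs_nonneg _), ← abs_mul,
    ← Matrix.det_mul, mul_eq_one_comm.mp hmul]
  simp [Matrix.toLpLin_apply, Matrix.mulVec_mulVec, hmul]

/-- The unitary dilation operator `(D_A f)(x) = √|det A| · f(A x)` on `L²(ℝ^d)`. -/
def dilation (A : GL (Fin d) ℝ) : L2 d ≃ₗᵢ[ℂ] L2 d where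
  toFun := dilationFun A
  invFun := dilationFun A⁻¹
  map_add' f g := by
    ext1
    filter_upwards [coeFn_dilationFun A (f + g), coeFn_dilationFun A f, coeFn_dilationFun A g,
      Lp.coeFn_add (dilationFun A f) (dilationFun A g),
      ae_comp_matrix A (Lp.coeFn_add f g)] with x h1 h2 h3 h4 h5
    rw [h1, h4, Pi.add_apply, h2, h3, h5, Pi.add_apply, mul_add]
  map_smul' c f := by
    ext1
    filter_upwards [coeFn_dilationFun A (c • f), coeFn_dilationFun A f,
      Lp.coeFn_smul c (dilationFun A f),
      ae_comp_matrix A (Lp.coeFn_smul c f)] with x h1 h2 h3 h4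
    simp only [RingHom.id_apply]
    rw [h1, h3, Pi.smul_apply, h2, h4, Pi.smul_apply, smul_eq_mul, smul_eq_mul]
    ring
  left_inv f := dilationFun_inv A A⁻¹ (mul_inv_cancel A) f
  right_inv f := dilationFun_inv A⁻¹ A (inv_mul_cancel A) f
  norm_map' f := by
    change ‖dilationFun A f‖ = ‖f‖
    rw [dilationFun, Lp.norm_toLp, eLpNorm_comp_matrix, Lp.norm_def]

theorem coeFn_dilation (A : GL (Fin d) ℝ) (f : L2 d) :
    dilation A f =ᵐ[volume] fun x => ((√|(A : Matrix (Fin d) (Fin d) ℝ).det| : ℝ) : ℂ) *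
      f (Matrix.toEuclideanLin (A : Matrix (Fin d) (Fin d) ℝ) x) :=
  coeFn_dilationFun A f

/-- The nonzero number `√|det A|`. -/
def sqrtDet (A : GL (Fin d) ℝ) : ℂˣ :=
  Units.mk0 ((√|(A : Matrix (Fin d) (Fin d) ℝ).det| : ℝ) : ℂ) (by
    rw [Complex.ofReal_ne_zero, Real.sqrt_ne_zero (abs_nonneg _), abs_ne_zero,
      ← det_toEuclideanLin]
    exact det_toEuclideanLin_ne_zero A)

/-- The renormalized dilation operator `(D̃_A f)(x) = |det A| · f(A x)` on `L²(ℝ^d)`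
(which is `√|det A|` times the unitary dilation). -/
def renormDilation (A : GL (Fin d) ℝ) : L2 d ≃L[ℂ] L2 d :=
  sqrtDet A • (dilation A).toContinuousLinearEquiv

theorem coeFn_renormDilation (A : GL (Fin d) ℝ) (f : L2 d) :
    renormDilation A f =ᵐ[volume] fun x => ((|(A : Matrix (Fin d) (Fin d) ℝ).det| : ℝ) : ℂ) *
      f (Matrix.toEuclideanLin (A : Matrix (Fin d) (Fin d) ℝ) x) := by
  filter_upwards [coeFn_dilation A f,
    Lp.coeFn_smul (((√|(A : Matrix (Fin d) (Fin d) ℝ).det| : ℝ) : ℂ)) (dilation A f)]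
    with x h1 h2
  change (((√|(A : Matrix (Fin d) (Fin d) ℝ).det| : ℝ) : ℂ) • dilation A f : L2 d) x = _
  rw [h2, Pi.smul_apply, h1, smul_eq_mul, ← mul_assoc, ← Complex.ofReal_mul,
    Real.mul_self_sqrt (abs_nonneg _)]

/-- `T̄_α = T_α ⊕ ⋯ ⊕ T_α` on `L²(ℝ^d)^r`. -/
def translationSum (r : ℕ) (α : E d) : L2Sum d r ≃ₗᵢ[ℂ] L2Sum d r :=
  LinearIsometryEquiv.piLpCongrRight 2 (fun _ => translation α)

/-- `D̄_A = D_A ⊕ ⋯ ⊕ D_A` on `L²(ℝ^d)^r`. -/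
def dilationSum (r : ℕ) (A : GL (Fin d) ℝ) : L2Sum d r ≃ₗᵢ[ℂ] L2Sum d r :=
  LinearIsometryEquiv.piLpCongrRight 2 (fun _ => dilation A)

/-- The direct sum `D̃_A ⊕ ⋯ ⊕ D̃_A` on `L²(ℝ^d)^r`
(which is `√|det A|` times `D_A ⊕ ⋯ ⊕ D_A`). -/
def renormDilationSum (r : ℕ) (A : GL (Fin d) ℝ) : L2Sum d r ≃L[ℂ] L2Sum d r :=
  sqrtDet A • (dilationSum r A).toContinuousLinearEquiv

theorem renormDilationSum_apply (r : ℕ) (A : GL (Fin d) ℝ) (F : L2Sum d r) (i : Fin r) :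
    renormDilationSum r A F i = renormDilation A (F i) := rfl

/-- The affine system `U_A(ψ) = {D_A^n T_z ψ : n ∈ ℤ, z ∈ ℤ^d}` in `L²(ℝ^d)`. -/
def affineSystem (A : GL (Fin d) ℝ) (ψ : L2 d) : ℤ × (Fin d → ℤ) → L2 d :=
  fun p => (dilation A ^ p.1) (translation (latticePt p.2) ψ)

/-- The system `{D̄_A^n T̄_z Ψ : n ∈ ℤ, z ∈ ℤ^d}` in `L²(ℝ^d)^r`. -/
def superAffineSystem {r : ℕ} (A : GL (Fin d) ℝ) (Ψ : L2Sum d r) :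
    ℤ × (Fin d → ℤ) → L2Sum d r :=
  fun p => (dilationSum r A ^ p.1) (translationSum r (latticePt p.2) Ψ)

/-- The quasi-affine system in `L²(ℝ^d)^r`: `D̄_A^n T̄_z Ψ` for `n ≥ 0`, and `T̄_z D̃_A^n Ψ`
(with `D̃_A` acting in each component) for `n < 0`, where `z ∈ ℤ^d`. -/
def superQuasiAffineSystem {r : ℕ} (A : GL (Fin d) ℝ) (Ψ : L2Sum d r) :
    ℤ × (Fin d → ℤ) → L2Sum d r :=
  fun p => if 0 ≤ p.1 then (dilationSum r A ^ p.1) (translationSum r (latticePt p.2) Ψ)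
    else translationSum r (latticePt p.2) ((renormDilationSum r A ^ p.1) Ψ)

end Operators

/-- The point `A^{*n} ξ`, where `A^*` is the transpose of `A` and `n ∈ ℤ`. -/
def adjPow {d : ℕ} (A : GL (Fin d) ℝ) (n : ℤ) (ξ : E d) : E d :=
  Matrix.toEuclideanLin ((A : Matrix (Fin d) (Fin d) ℝ).transpose ^ n) ξ

/-- For all `i, j`: `∑_{n ∈ ℤ} ψ̂_i(A^{*n} ξ) conj (ψ̂_j(A^{*n} ξ)) = δ_{i,j}` for a.e. `ξ`. -/
def DiagonalEquation {d r : ℕ} (A : GL (Fin d) ℝ) (ψ : Fin r → L2 d) : Prop :=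
  ∀ i j : Fin r, ∀ᵐ ξ : E d,
    HasSum (fun n : ℤ => (𝓕 (ψ i)) (adjPow A n ξ) * conj ((𝓕 (ψ j)) (adjPow A n ξ)))
      (if i = j then 1 else 0)

/-- For all `i, j` and all `k ∈ ℤ^d \ A^* ℤ^d`:
`∑_{n ≥ 0} ψ̂_i(A^{*n} ξ) conj (ψ̂_j(A^{*n} (ξ + k))) = 0` for a.e. `ξ`. -/
def OffDiagonalEquation {d r : ℕ} (A : GL (Fin d) ℝ) (ψ : Fin r → L2 d) : Prop :=
  ∀ i j : Fin r, ∀ k : Fin d → ℤ,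
    (¬ ∃ m : Fin d → ℤ, latticePt k = adjPow A 1 (latticePt m)) →
    ∀ᵐ ξ : E d,
      HasSum (fun n : ℕ => (𝓕 (ψ i)) (adjPow A n ξ) *
        conj ((𝓕 (ψ j)) (adjPow A n (ξ + latticePt k)))) 0

end SuperWavelet

end

/-!
On the frequency side `D_A` becomes, up to a constant, composition with a power of `B = A^*` and
`T_z` becomes multiplication by a character, so Parseval's identity for Fourier series on the torus
turns the pairing `∑_z ⟪ψ_{n,z}, f⟫ conj ⟪φ_{n,z}, g⟫` at a fixed level `n` into a sum over
`l ∈ ℤ^d` of integrals of `conj ψ̂(Bᵐ ξ) φ̂(Bᵐ (ξ + α)) f̂(ξ) conj ĝ(ξ + α)`, where `m = -n` and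
`α = B⁻ᵐ l`. For `f̂` and `ĝ` bounded and supported in an annulus, the sum over all levels converges
absolutely as soon as `ψ̂` and `φ̂` are square summable along the orbits of `B`, which is a
consequence of each of the three conditions. The affine and the quasi-affine system then give the
same integrals, except that all shifts `α ∈ ⋃ₘ Bᵐ ℤ^d` occur for the former and only those in `ℤ^d`
for the latter.

Modulating `f̂` and `ĝ` multiplies the contribution of the shift `α` by a character in `α`, so the
contributions of different shifts can be separated. Hence the system reproduces inner products of
band-limited functions if and only if the shift `0` contributes `δ_{i,j} ⟪g, f⟫`, which is the
diagonal equation, and every other shift contributes `0`. After an application of a power of `B` a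
nonzero shift lies in `ℤ^d \ B ℤ^d`, and the latter is the off-diagonal equation.
-/

open MeasureTheory
open scoped FourierTransform ComplexConjugate ENNReal

noncomputable section

namespace SuperWavelet

section ChangeOfVariables

variable {V : Type*} [NormedAddCommGroup V] [NormedSpace ℝ V]

/-- The factor `|det e|` by which an invertible linear map `e` scales Lebesgue measure. -/
def absDet (e : V ≃L[ℝ] V) : ℝ := |LinearMap.det (e.toLinearEquiv : V →ₗ[ℝ] V)|

theorem absDet_pos (e : V ≃L[ℝ] V) : 0 < absDet e :=
  abs_pos.mpr e.toLinearEquiv.isUnit_det'.ne_zero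

variable [FiniteDimensional ℝ V] [MeasurableSpace V] [BorelSpace V]
  (μ : Measure V) [μ.IsAddHaarMeasure]

theorem map_continuousLinearEquiv_addHaar (e : V ≃L[ℝ] V) :
    μ.map e = ENNReal.ofReal (absDet e)⁻¹ • μ := by
  rw [absDet, ← abs_inv]
  exact Measure.map_linearMap_addHaar_eq_smul_addHaar μ e.toLinearEquiv.isUnit_det'.ne_zero

theorem lintegral_comp_continuousLinearEquiv (e : V ≃L[ℝ] V) (f : V → ℝ≥0∞) :
    ENNReal.ofReal (absDet e) * ∫⁻ x, f (e x) ∂μ = ∫⁻ x, f x ∂μ := by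
  have h : ∫⁻ x, f x ∂(μ.map e) = ∫⁻ x, f (e x) ∂μ :=
    lintegral_map_equiv f e.toHomeomorph.toMeasurableEquiv
  rw [← h, map_continuousLinearEquiv_addHaar, lintegral_smul_measure, smul_eq_mul, ← mul_assoc,
    ← ENNReal.ofReal_mul (absDet_pos e).le, mul_inv_cancel₀ (absDet_pos e).ne', ENNReal.ofReal_one,
    one_mul]

theorem integral_comp_continuousLinearEquiv {F : Type*} [NormedAddCommGroup F] [NormedSpace ℝ F]
    (e : V ≃L[ℝ] V) (f : V → F) :
    absDet e • ∫ x, f (e x) ∂μ = ∫ x, f x ∂μ := by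
  have h : ∫ x, f x ∂(μ.map e) = ∫ x, f (e x) ∂μ :=
    e.toHomeomorph.measurableEmbedding.integral_map f
  rw [← h, map_continuousLinearEquiv_addHaar, integral_smul_measure,
    ENNReal.toReal_ofReal (inv_nonneg.mpr (absDet_pos e).le), smul_inv_smul₀ (absDet_pos e).ne']

theorem measure_preimage_continuousLinearEquiv (e : V ≃L[ℝ] V) {s : Set V}
    (hs : MeasurableSet s) : ENNReal.ofReal (absDet e) * μ (e ⁻¹' s) = μ s := by
  rw [← lintegral_indicator_one hs, ← lintegral_comp_continuousLinearEquiv μ e,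
    ← lintegral_indicator_one (e.continuous.measurable hs)]
  rfl

theorem quasiMeasurePreserving_continuousLinearEquiv (e : V ≃L[ℝ] V) :
    Measure.QuasiMeasurePreserving e μ μ :=
  ⟨e.continuous.measurable, by
    rw [map_continuousLinearEquiv_addHaar]; exact Measure.smul_absolutelyContinuous⟩

theorem memLp_comp_continuousLinearEquiv {F : Type*} [NormedAddCommGroup F]
    {μ : Measure V} [μ.IsAddHaarMeasure] {p : ℝ≥0∞} (e : V ≃L[ℝ] V) {f : V → F}
    (hf : MemLp f p μ) : MemLp (fun x => f (e x)) p μ := by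
  refine MemLp.comp_of_map ?_ e.continuous.aemeasurable
  rw [map_continuousLinearEquiv_addHaar]
  exact hf.smul_measure ENNReal.ofReal_ne_top

end ChangeOfVariables

section PlaneWave

variable {V : Type*} [NormedAddCommGroup V] [InnerProductSpace ℝ V]

/-- The character `ξ ↦ e^{2πi⟨x, ξ⟩}` with frequency `x`. -/
def planeWave (x ξ : V) : ℂ := 𝐞 (inner ℝ x ξ)

theorem norm_planeWave (x ξ : V) : ‖planeWave x ξ‖ = 1 := Circle.norm_coe _

theorem planeWave_neg_left (x ξ : V) : planeWave (-x) ξ = conj (planeWave x ξ) := by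
  simp [planeWave, inner_neg_left, AddChar.map_neg_eq_inv]

theorem planeWave_add_right (x ξ η : V) :
    planeWave x (ξ + η) = planeWave x ξ * planeWave x η := by
  simp [planeWave, inner_add_right, AddChar.map_add_eq_mul]

theorem conj_planeWave_mul_self (x ξ : V) : conj (planeWave x ξ) * planeWave x ξ = 1 := by
  rw [Complex.conj_mul', norm_planeWave, Complex.ofReal_one, one_pow]

theorem continuous_planeWave (x : V) : Continuous (planeWave x) :=
  continuous_subtype_val.comp
    (Real.continuous_fourierChar.comp (continuous_const.inner continuous_id))

variable [MeasurableSpace V] [BorelSpace V] {μ : Measure V} {f : V → ℂ}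

theorem memLp_planeWave_mul (x : V) {p : ℝ≥0∞} (hf : MemLp f p μ) :
    MemLp (fun ξ => planeWave x ξ * f ξ) p μ :=
  hf.of_le ((continuous_planeWave x).aestronglyMeasurable.mul hf.1)
    (.of_forall fun ξ => by rw [norm_mul, norm_planeWave, one_mul])

theorem integrable_planeWave_mul (x : V) (hf : Integrable f μ) :
    Integrable (fun ξ => planeWave x ξ * f ξ) μ :=
  memLp_one_iff_integrable.mp (memLp_planeWave_mul x (memLp_one_iff_integrable.mpr hf))

end PlaneWave

section FourierOfComposition

open ContinuousLinearMap in
theorem fourier_comp_continuousLinearEquiv {V F : Type*} [NormedAddCommGroup V]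
    [InnerProductSpace ℝ V] [FiniteDimensional ℝ V] [MeasurableSpace V] [BorelSpace V]
    [NormedAddCommGroup F] [NormedSpace ℂ F] (e : V ≃L[ℝ] V) (f : V → F) (ξ : V) :
    absDet e • 𝓕 (fun x => f (e x)) (adjoint (e : V →L[ℝ] V) ξ) = 𝓕 f ξ := by
  rw [Real.fourier_eq, Real.fourier_eq,
    ← integral_comp_continuousLinearEquiv volume e fun x => 𝐞 (-inner ℝ x ξ) • f x]
  simp only [adjoint_inner_right, ContinuousLinearEquiv.coe_coe]

theorem fourier_comp_sub {V F : Type*} [NormedAddCommGroup V] [InnerProductSpace ℝ V]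
    [FiniteDimensional ℝ V] [MeasurableSpace V] [BorelSpace V] [NormedAddCommGroup F]
    [NormedSpace ℂ F] (f : V → F) (α ξ : V) :
    𝓕 (fun x => f (x - α)) ξ = planeWave (-α) ξ • 𝓕 f ξ := by
  have h := congrFun (VectorFourier.fourierIntegral_comp_add_right 𝐞 volume
    (innerₗ V) f (-α)) ξ
  simp only [sub_eq_add_neg]
  exact h

end FourierOfComposition

section FourierOnL2

variable {d : ℕ}

theorem eq_of_forall_toLp_schwartz {X : Type*} [TopologicalSpace X] [T2Space X] {u v : L2 d → X}
    (hu : Continuous u) (hv : Continuous v)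
    (h : ∀ s : SchwartzMap (E d) ℂ, u (s.toLp 2) = v (s.toLp 2)) : u = v :=
  (SchwartzMap.denseRange_toLpCLM (E := E d) (F := ℂ) (p := 2) ENNReal.ofNat_ne_top).equalizer
    hu hv (funext h)

theorem continuous_fourier_L2 : Continuous fun f : L2 d => 𝓕 f :=
  (Lp.fourierTransformₗᵢ (E d) ℂ).continuous

theorem exists_fourier_ae_eq {F : E d → ℂ} (hF : MemLp F 2) :
    ∃ f : L2 d, (𝓕 f : L2 d) =ᵐ[volume] F := by
  refine ⟨(Lp.fourierTransformₗᵢ (E d) ℂ).symm hF.toLp, ?_⟩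
  have h : 𝓕 ((Lp.fourierTransformₗᵢ (E d) ℂ).symm hF.toLp) = hF.toLp :=
    LinearIsometryEquiv.apply_symm_apply _ _
  rw [h]
  exact hF.coeFn_toLp

theorem inner_eq_integral_fourier (f g : L2 d) :
    inner ℂ f g = ∫ ξ, conj ((𝓕 f) ξ) * (𝓕 g) ξ := by
  rw [← Lp.inner_fourier_eq, L2.inner_def]
  simp only [RCLike.inner_apply']

/-- The operator of multiplication by the character of frequency `x`: the Fourier conjugate of a
translation. -/
def modulation (x : E d) (f : L2 d) : L2 d := (memLp_planeWave_mul x (Lp.memLp f)).toLp _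

theorem coeFn_modulation (x : E d) (f : L2 d) :
    modulation x f =ᵐ[volume] fun ξ => planeWave x ξ * f ξ :=
  (memLp_planeWave_mul x (Lp.memLp f)).coeFn_toLp

theorem isometry_modulation (x : E d) : Isometry (modulation x) := by
  refine Isometry.of_dist_eq fun f g => ?_
  rw [dist_eq_norm, dist_eq_norm, Lp.norm_def, Lp.norm_def]
  congr 1
  refine eLpNorm_congr_norm_ae ?_
  filter_upwards [Lp.coeFn_sub (modulation x f) (modulation x g), Lp.coeFn_sub f g,
    coeFn_modulation x f, coeFn_modulation x g] with ξ hsub hsub' hf hg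
  rw [hsub, hsub', Pi.sub_apply, Pi.sub_apply, hf, hg, ← mul_sub, norm_mul, norm_planeWave,
    one_mul]

theorem translation_toLp (α : E d) (s : SchwartzMap (E d) ℂ) :
    translation α (s.toLp 2) = (s.compSubConstCLM ℂ α).toLp 2 := by
  ext1
  filter_upwards [coeFn_translation α (s.toLp 2), (s.compSubConstCLM ℂ α).coeFn_toLp 2,
    (measurePreserving_sub_right volume α).quasiMeasurePreserving.ae (s.coeFn_toLp 2 volume)]
    with x htranslation hcomp hs
  rw [htranslation, hcomp, hs]
  rfl

theorem fourier_translation (α : E d) (f : L2 d) :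
    𝓕 (translation α f) = modulation (-α) (𝓕 f) := by
  refine congrFun (eq_of_forall_toLp_schwartz
    (continuous_fourier_L2.comp (translation α).continuous)
    ((isometry_modulation (-α)).continuous.comp continuous_fourier_L2) fun s => ?_) f
  rw [Function.comp_apply, Function.comp_apply, translation_toLp, SchwartzMap.toLp_fourier_eq,
    SchwartzMap.toLp_fourier_eq]
  ext1
  filter_upwards [(𝓕 (s.compSubConstCLM ℂ α)).coeFn_toLp 2, (𝓕 s).coeFn_toLp 2,
    coeFn_modulation (-α) ((𝓕 s).toLp 2)] with ξ hcomp hs hmodulation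
  rw [hcomp, hmodulation, hs, SchwartzMap.fourier_coe, SchwartzMap.fourier_coe]
  exact fourier_comp_sub s α ξ

/-- An invertible matrix as an invertible linear map of `ℝ^d`. -/
def euclideanEquiv : GL (Fin d) ℝ →* (E d ≃L[ℝ] E d) :=
  (ContinuousLinearEquiv.unitsEquiv ℝ (E d)).toMonoidHom.comp
    (Units.map (Matrix.toEuclideanCLM (n := Fin d) (𝕜 := ℝ) : Matrix (Fin d) (Fin d) ℝ →* _))

theorem euclideanEquiv_apply (M : GL (Fin d) ℝ) (x : E d) :
    euclideanEquiv M x = Matrix.toEuclideanLin (M : Matrix (Fin d) (Fin d) ℝ) x := rfl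

theorem absDet_euclideanEquiv (M : GL (Fin d) ℝ) :
    absDet (euclideanEquiv M) = |(M : Matrix (Fin d) (Fin d) ℝ).det| :=
  congrArg abs (det_toEuclideanLin _)

theorem absDet_euclideanEquiv_star (M : GL (Fin d) ℝ) :
    absDet (euclideanEquiv (star M)) = absDet (euclideanEquiv M) := by
  rw [absDet_euclideanEquiv, absDet_euclideanEquiv]
  exact congrArg abs (Matrix.det_transpose _)

theorem adjoint_euclideanEquiv (M : GL (Fin d) ℝ) :
    ContinuousLinearMap.adjoint (euclideanEquiv M : E d →L[ℝ] E d) = euclideanEquiv (star M) :=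
  (map_star (Matrix.toEuclideanCLM (n := Fin d) (𝕜 := ℝ))
    (M : Matrix (Fin d) (Fin d) ℝ)).symm

theorem adjPow_eq_euclideanEquiv (A : GL (Fin d) ℝ) (n : ℤ) (ξ : E d) :
    adjPow A n ξ = (euclideanEquiv (star A) ^ n) ξ := by
  rw [← map_zpow, euclideanEquiv_apply, adjPow, Matrix.coe_units_zpow]
  rfl

theorem coeFn_dilation_euclideanEquiv (M : GL (Fin d) ℝ) (f : L2 d) :
    dilation M f =ᵐ[volume]
      fun x => ((√(absDet (euclideanEquiv M)) : ℝ) : ℂ) * f (euclideanEquiv M x) := by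
  rw [absDet_euclideanEquiv]
  exact coeFn_dilation M f

theorem dilation_mul (M N : GL (Fin d) ℝ) : dilation (M * N) = dilation N * dilation M := by
  ext1 f
  change dilation (M * N) f = dilation N (dilation M f)
  ext1
  filter_upwards [coeFn_dilation (M * N) f, coeFn_dilation N (dilation M f),
    ae_comp_matrix N (coeFn_dilation M f)] with x hMN hN hM
  rw [hMN, hN, hM, ← mul_assoc, ← Complex.ofReal_mul, ← Real.sqrt_mul (abs_nonneg _), ← abs_mul,
    Matrix.GeneralLinearGroup.coe_mul, ← Matrix.det_mul, Matrix.det_mul_comm]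
  simp [Matrix.toLpLin_apply, Matrix.mulVec_mulVec]

theorem map_zpow_of_map_mul_rev {G H : Type*} [Group G] [Group H] {φ : G → H}
    (hφ : ∀ a b, φ (a * b) = φ b * φ a) (a : G) (n : ℤ) : φ (a ^ n) = φ a ^ n :=
  MulOpposite.op_injective <| map_zpow
    (MonoidHom.mk' (fun a => MulOpposite.op (φ a)) fun a b => congrArg _ (hφ a b)) a n

theorem dilation_zpow (M : GL (Fin d) ℝ) (n : ℤ) : dilation (M ^ n) = dilation M ^ n :=
  map_zpow_of_map_mul_rev dilation_mul M n

theorem dilation_inv (M : GL (Fin d) ℝ) : dilation M⁻¹ = (dilation M)⁻¹ := by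
  simpa only [zpow_neg_one] using dilation_zpow M (-1)

theorem dilation_toLp (M : GL (Fin d) ℝ) (s : SchwartzMap (E d) ℂ) :
    dilation M (s.toLp 2) = (((√(absDet (euclideanEquiv M)) : ℝ) : ℂ) •
      s.compCLMOfContinuousLinearEquiv ℂ (euclideanEquiv M)).toLp 2 := by
  ext1
  filter_upwards [coeFn_dilation_euclideanEquiv M (s.toLp 2),
    (((√(absDet (euclideanEquiv M)) : ℝ) : ℂ) •
      s.compCLMOfContinuousLinearEquiv ℂ (euclideanEquiv M)).coeFn_toLp 2,
    ae_comp_matrix M (s.coeFn_toLp 2 volume)] with x hdilation hcomp hs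
  rw [hdilation, hcomp, euclideanEquiv_apply, hs]
  rfl

theorem dilation_star_fourier_dilation (M : GL (Fin d) ℝ) (f : L2 d) :
    dilation (star M) (𝓕 (dilation M f)) = 𝓕 f := by
  refine congrFun (eq_of_forall_toLp_schwartz ((dilation (star M)).continuous.comp
    (continuous_fourier_L2.comp (dilation M).continuous)) continuous_fourier_L2 fun s => ?_) f
  set s' : SchwartzMap (E d) ℂ := ((√(absDet (euclideanEquiv M)) : ℝ) : ℂ) •
    s.compCLMOfContinuousLinearEquiv ℂ (euclideanEquiv M) with hs'
  rw [Function.comp_apply, Function.comp_apply, dilation_toLp, SchwartzMap.toLp_fourier_eq,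
    SchwartzMap.toLp_fourier_eq]
  ext1
  filter_upwards [coeFn_dilation_euclideanEquiv (star M) ((𝓕 s').toLp 2),
    ae_comp_matrix (star M) ((𝓕 s').coeFn_toLp 2 volume), (𝓕 s).coeFn_toLp 2]
    with ξ hdilation hcomp hs
  have hfourier := fourier_comp_continuousLinearEquiv (euclideanEquiv M) s ξ
  rw [adjoint_euclideanEquiv, Complex.real_smul,
    ← Real.mul_self_sqrt (absDet_pos (euclideanEquiv M)).le, Complex.ofReal_mul, mul_assoc]
    at hfourier
  rw [hdilation, absDet_euclideanEquiv_star, euclideanEquiv_apply, hcomp, hs, hs',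
    FourierTransform.fourier_smul, smul_apply, SchwartzMap.fourier_coe,
    SchwartzMap.fourier_coe, ← hfourier]
  rfl

theorem fourier_dilation (M : GL (Fin d) ℝ) (f : L2 d) :
    𝓕 (dilation M f) = dilation (star M)⁻¹ (𝓕 f) := by
  rw [← dilation_star_fourier_dilation M f, dilation_inv]
  exact ((dilation (star M)).symm_apply_apply _).symm

end FourierOnL2

section IntegerLattice

variable {d : ℕ}

theorem latticePt_injective : Function.Injective (latticePt (d := d)) := by
  intro z w h
  funext i
  have hi : latticePt z i = latticePt w i := by rw [h]
  simpa [latticePt] using hi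

theorem latticePt_zero : latticePt (0 : Fin d → ℤ) = 0 := by
  ext i; simp [latticePt]

theorem latticePt_add (z w : Fin d → ℤ) : latticePt (z + w) = latticePt z + latticePt w := by
  ext i; simp [latticePt]

theorem latticePt_neg (z : Fin d → ℤ) : latticePt (-z) = -latticePt z := by
  ext i; simp [latticePt]

theorem one_le_norm_latticePt {z : Fin d → ℤ} (hz : z ≠ 0) : 1 ≤ ‖latticePt z‖ := by
  obtain ⟨i, hi⟩ := Function.ne_iff.mp hz
  refine le_trans ?_ (PiLp.norm_apply_le (latticePt z) i)
  have habs : (1 : ℝ) ≤ |(z i : ℝ)| := by exact_mod_cast Int.one_le_abs hi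
  simpa [latticePt] using habs

theorem finite_norm_latticePt_le (R : ℝ) : {l : Fin d → ℤ | ‖latticePt l‖ ≤ R}.Finite := by
  refine (Set.finite_Icc (fun _ => -⌈R⌉) (fun _ => ⌈R⌉)).subset fun l hl => ?_
  have habs (i : Fin d) : |(l i : ℝ)| ≤ ⌈R⌉ := by
    simpa [latticePt] using (PiLp.norm_apply_le (latticePt l) i).trans (hl.trans (Int.le_ceil R))
  exact ⟨fun i => by exact_mod_cast (abs_le.mp (habs i)).1,
    fun i => by exact_mod_cast (abs_le.mp (habs i)).2⟩

theorem planeWave_latticePt_latticePt (z l : Fin d → ℤ) :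
    planeWave (latticePt z) (latticePt l) = 1 := by
  have hinner : inner ℝ (latticePt z) (latticePt l) = ((∑ i, l i * z i : ℤ) : ℝ) := by
    simp [PiLp.inner_apply, latticePt]
  rw [planeWave, hinner, Real.fourierChar_apply, mul_assoc, mul_comm, Complex.exp_eq_one_iff]
  exact ⟨∑ i, l i * z i, by push_cast; ring⟩

theorem planeWave_latticePt_add (z : Fin d → ℤ) (ξ : E d) (l : Fin d → ℤ) :
    planeWave (latticePt z) (ξ + latticePt l) = planeWave (latticePt z) ξ := by
  rw [planeWave_add_right, planeWave_latticePt_latticePt, mul_one]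

end IntegerLattice

section UnitCube

variable {d : ℕ}

/-- The half-open unit cube `(0, 1]^d`, half-open on the same side as the standard fundamental
interval of `AddCircle`. -/
def unitCube (d : ℕ) : Set (E d) := {ξ | ∀ i, ξ i ∈ Set.Ioc (0 : ℝ) 1}

theorem preimage_toLp_unitCube :
    (WithLp.toLp 2) ⁻¹' unitCube d = Set.univ.pi fun _ => Set.Ioc (0 : ℝ) 1 := by
  ext; simp [unitCube]

theorem measurableSet_unitCube : MeasurableSet (unitCube d) := by
  have h : unitCube d = ⋂ i, (fun ξ : E d => ξ i) ⁻¹' Set.Ioc (0 : ℝ) 1 := by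
    ext; simp [unitCube]
  rw [h]
  exact MeasurableSet.iInter fun i => measurableSet_Ioc.preimage (by fun_prop)

theorem norm_le_of_mem_unitCube {ξ : E d} (h : ξ ∈ unitCube d) : ‖ξ‖ ≤ √d := by
  rw [EuclideanSpace.norm_eq]
  refine Real.sqrt_le_sqrt ?_
  calc ∑ i, ‖ξ i‖ ^ 2 ≤ ∑ _i : Fin d, (1 : ℝ) := by
        refine Finset.sum_le_sum fun i _ => pow_le_one₀ (norm_nonneg _) ?_
        rw [Real.norm_of_nonneg (h i).1.le]
        exact (h i).2
    _ = d := by simp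

theorem volume_unitCube : volume (unitCube d) = 1 := by
  rw [← (PiLp.volume_preserving_toLp (Fin d)).measure_preimage
    measurableSet_unitCube.nullMeasurableSet, preimage_toLp_unitCube, Real.volume_pi_Ioc]
  simp

/-- The translate of the unit cube by the lattice point `l`. -/
def cubeAt (l : Fin d → ℤ) : Set (E d) := (fun ξ => ξ - latticePt l) ⁻¹' unitCube d

theorem measurableSet_cubeAt (l : Fin d → ℤ) : MeasurableSet (cubeAt l) :=
  measurableSet_unitCube.preimage (by fun_prop)

theorem mem_cubeAt_iff {l : Fin d → ℤ} {ξ : E d} :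
    ξ ∈ cubeAt l ↔ l = fun i => ⌈ξ i⌉ - 1 := by
  simp only [cubeAt, unitCube, Set.mem_preimage, Set.mem_ofPred_eq, funext_iff]
  refine forall_congr' fun i => ?_
  simp only [latticePt, PiLp.sub_apply, Set.mem_Ioc]
  rw [eq_sub_iff_add_eq, eq_comm, Int.ceil_eq_iff]
  push_cast
  constructor <;> rintro ⟨hlt, hle⟩ <;> constructor <;> linarith

theorem pairwise_disjoint_cubeAt : Pairwise (Function.onFun Disjoint (cubeAt (d := d))) :=
  fun _ _ hne => Set.disjoint_left.mpr fun _ hl hl' =>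
    hne ((mem_cubeAt_iff.mp hl).trans (mem_cubeAt_iff.mp hl').symm)

theorem iUnion_cubeAt : ⋃ l, cubeAt (d := d) l = Set.univ :=
  Set.eq_univ_of_forall fun _ => Set.mem_iUnion.mpr ⟨_, mem_cubeAt_iff.mpr rfl⟩

theorem setIntegral_cubeAt {F : Type*} [NormedAddCommGroup F] [NormedSpace ℝ F] (u : E d → F)
    (l : Fin d → ℤ) : ∫ ξ in cubeAt l, u ξ = ∫ ξ in unitCube d, u (ξ + latticePt l) := by
  simpa only [cubeAt, sub_add_cancel] using
    (measurePreserving_sub_right volume (latticePt l)).setIntegral_preimage_emb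
      (MeasurableEquiv.subRight (latticePt l)).measurableEmbedding
      (fun ξ => u (ξ + latticePt l)) (unitCube d)

theorem hasSum_integral_unitCube {F : Type*} [NormedAddCommGroup F] [NormedSpace ℝ F]
    {u : E d → F} (hu : Integrable u) :
    HasSum (fun l => ∫ ξ in unitCube d, u (ξ + latticePt l)) (∫ ξ, u ξ) := by
  have h := hasSum_integral_iUnion (μ := volume) (f := u) measurableSet_cubeAt
    pairwise_disjoint_cubeAt (by rw [iUnion_cubeAt]; exact hu.integrableOn)
  simpa only [iUnion_cubeAt, setIntegral_univ, setIntegral_cubeAt] using h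

end UnitCube

section TorusFourierSeries

variable {d : ℕ}

/-- The circle `ℝ / ℤ` with its Haar measure of total mass one, the measure with respect to which
Mathlib's multivariate Fourier series are developed. -/
local instance unitAddCircleMeasureSpace : MeasureSpace UnitAddCircle :=
  ⟨AddCircle.haarAddCircle⟩

/-- The section of `ℝ^d → (ℝ/ℤ)^d` with values in the unit cube. -/
def torusSection (t : UnitAddTorus (Fin d)) : E d :=
  WithLp.toLp 2 (UnitAddTorus.measurableEquivPiIoc (fun _ => 0) t).1

theorem measurePreserving_torusSection :
    MeasurePreserving (torusSection (d := d)) volume (volume.restrict (unitCube d)) := by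
  set S : Set (Fin d → ℝ) := {x | ∀ i, x i ∈ Set.Ioc (0 : ℝ) (0 + 1)} with hS
  have hSmeas : MeasurableSet S := MeasurableSet.univ_pi' fun _ => measurableSet_Ioc
  have hpreimage : (WithLp.toLp 2) ⁻¹' unitCube d = S := by ext; simp [unitCube, hS]
  have hcoe : MeasurePreserving (Subtype.val : S → _) (Measure.comap Subtype.val volume)
      (volume.restrict S) := ⟨measurable_subtype_coe, map_comap_subtype_coe hSmeas volume⟩
  have htoLp := (PiLp.volume_preserving_toLp (Fin d)).restrict_preimage
    (measurableSet_unitCube (d := d))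
  rw [hpreimage] at htoLp
  exact htoLp.comp (hcoe.comp (UnitAddTorus.measurePreserving_equivPiIoc (fun _ => 0)))

theorem setIntegral_unitCube_eq_integral_torus {g : E d → ℂ}
    (hg : AEStronglyMeasurable g (volume.restrict (unitCube d))) :
    ∫ ξ in unitCube d, g ξ = ∫ t, g (torusSection t) := by
  rw [← measurePreserving_torusSection.map_eq] at hg ⊢
  rw [integral_map measurePreserving_torusSection.measurable.aemeasurable hg]

theorem mFourier_eq_planeWave_torusSection (z : Fin d → ℤ) (t : UnitAddTorus (Fin d)) :
    UnitAddTorus.mFourier z t = planeWave (latticePt z) (torusSection t) := by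
  have ht (i : Fin d) : t i = ((torusSection t i : ℝ) : UnitAddCircle) :=
    congrFun ((UnitAddTorus.measurableEquivPiIoc (fun _ => (0 : ℝ))).symm_apply_apply t).symm i
  simp only [UnitAddTorus.mFourier, ContinuousMap.coe_mk, planeWave, Real.fourierChar_apply]
  simp_rw [ht, fourier_coe_apply]
  rw [← Complex.exp_sum, PiLp.inner_apply]
  congr 1
  push_cast
  simp only [latticePt, RCLike.inner_apply, conj_trivial, Finset.mul_sum, Finset.sum_mul]
  refine Finset.sum_congr rfl fun i _ => ?_
  push_cast
  ring

theorem mFourierCoeff_neg_comp_torusSection {w : E d → ℂ}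
    (hw : MemLp w 2 (volume.restrict (unitCube d))) (z : Fin d → ℤ) :
    UnitAddTorus.mFourierCoeff
        (hw.comp_measurePreserving measurePreserving_torusSection).toLp (-z)
      = ∫ ξ in unitCube d, planeWave (latticePt z) ξ * w ξ := by
  rw [setIntegral_unitCube_eq_integral_torus (g := fun ξ => planeWave (latticePt z) ξ * w ξ)
    ((continuous_planeWave _).aestronglyMeasurable.mul hw.1), UnitAddTorus.mFourierCoeff]
  refine integral_congr_ae ?_
  filter_upwards [(hw.comp_measurePreserving measurePreserving_torusSection).coeFn_toLp]
    with t ht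
  rw [ht, neg_neg, mFourier_eq_planeWave_torusSection]
  rfl

theorem hasSum_setIntegral_unitCube_planeWave_mul_conj {u v : E d → ℂ}
    (hu : MemLp u 2 (volume.restrict (unitCube d)))
    (hv : MemLp v 2 (volume.restrict (unitCube d))) :
    HasSum (fun z : Fin d → ℤ => (∫ ξ in unitCube d, planeWave (latticePt z) ξ * u ξ) *
      conj (∫ ξ in unitCube d, planeWave (latticePt z) ξ * v ξ))
      (∫ ξ in unitCube d, u ξ * conj (v ξ)) := by
  have hu' := hu.comp_measurePreserving measurePreserving_torusSection
  have hv' := hv.comp_measurePreserving measurePreserving_torusSection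
  have hcoeff := UnitAddTorus.hasSum_prod_mFourierCoeff hv'.toLp hu'.toLp
  rw [← (Equiv.neg (Fin d → ℤ)).hasSum_iff] at hcoeff
  convert hcoeff using 1
  · funext z
    simp only [Function.comp_apply, Equiv.neg_apply]
    rw [mFourierCoeff_neg_comp_torusSection hu, mFourierCoeff_neg_comp_torusSection hv, mul_comm]
  · rw [setIntegral_unitCube_eq_integral_torus (g := fun ξ => u ξ * conj (v ξ))
      (hu.1.mul (Complex.continuous_conj.comp_aestronglyMeasurable hv.1))]
    refine integral_congr_ae ?_
    filter_upwards [hu'.coeFn_toLp, hv'.coeFn_toLp] with t hut hvt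
    rw [hut, hvt, mul_comm]
    rfl

end TorusFourierSeries

section Periodization

variable {d : ℕ}

/-- The `ℤ^d`-periodization `∑_l w(ξ + l)` of a function on `ℝ^d`. -/
def periodization (w : E d → ℂ) (ξ : E d) : ℂ := ∑' l : Fin d → ℤ, w (ξ + latticePt l)

theorem periodization_add_latticePt (w : E d → ℂ) (ξ : E d) (m : Fin d → ℤ) :
    periodization w (ξ + latticePt m) = periodization w ξ := by
  rw [periodization, periodization,
    ← (Equiv.addLeft m).tsum_eq fun l => w (ξ + latticePt l)]
  simp only [Equiv.coe_addLeft, latticePt_add, add_assoc]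

theorem periodization_mul_of_periodic {u : E d → ℂ}
    (hu : ∀ (ξ : E d) (l : Fin d → ℤ), u (ξ + latticePt l) = u ξ) (w : E d → ℂ) (ξ : E d) :
    periodization (fun η => u η * w η) ξ = u ξ * periodization w ξ := by
  simp only [periodization, hu, tsum_mul_left]

theorem setIntegral_unitCube_periodization {w : E d → ℂ} (hw : Integrable w) :
    ∫ ξ in unitCube d, periodization w ξ = ∫ ξ, w ξ :=
  (hasSum_integral_of_summable_integral_norm
    (fun l => (hw.comp_add_right (latticePt l)).integrableOn)
    (hasSum_integral_unitCube hw.norm).summable).unique (hasSum_integral_unitCube hw)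

theorem periodization_eq_sum {w : E d → ℂ} {R S : ℝ} (hw : ∀ ξ, R < ‖ξ‖ → w ξ = 0) {ξ : E d}
    (hξ : ‖ξ‖ ≤ S) :
    periodization w ξ = ∑ l ∈ (finite_norm_latticePt_le (d := d) (R + S)).toFinset,
      w (ξ + latticePt l) := by
  refine tsum_eq_sum fun l hl => hw _ ?_
  have hl' : R + S < ‖latticePt l‖ := by simpa using hl
  have htriangle : ‖latticePt l‖ ≤ ‖ξ + latticePt l‖ + ‖ξ‖ := by
    simpa using norm_sub_le (ξ + latticePt l) ξ
  linarith

theorem memLp_periodization_unitCube {w : E d → ℂ} {p : ℝ≥0∞} (hw : MemLp w p) {R : ℝ}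
    (hwR : ∀ ξ, R < ‖ξ‖ → w ξ = 0) :
    MemLp (periodization w) p (volume.restrict (unitCube d)) := by
  have hsum : MemLp (fun ξ => ∑ l ∈ (finite_norm_latticePt_le (d := d) (R + √d)).toFinset,
      w (ξ + latticePt l)) p (volume.restrict (unitCube d)) :=
    (memLp_finsetSum _ fun l _ =>
      hw.comp_measurePreserving (measurePreserving_add_right volume (latticePt l))).restrict _
  refine hsum.ae_eq ?_
  filter_upwards [ae_restrict_mem measurableSet_unitCube] with ξ hξ
  exact (periodization_eq_sum hwR (norm_le_of_mem_unitCube hξ)).symm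

theorem integrable_of_memLp_of_eq_zero {V F : Type*} [NormedAddCommGroup V] [MeasurableSpace V]
    [ProperSpace V] [NormedAddCommGroup F] {μ : Measure V} [IsFiniteMeasureOnCompacts μ]
    {w : V → F} {p : ℝ≥0∞} (hp : 1 ≤ p) (hw : MemLp w p μ) {R : ℝ}
    (hwR : ∀ ξ, R < ‖ξ‖ → w ξ = 0) : Integrable w μ :=
  memLp_one_iff_integrable.mp <| hw.mono_exponent_of_measure_support_ne_top
    (s := Metric.closedBall 0 R) (fun ξ hξ => hwR ξ (by simpa using hξ))
    measure_closedBall_lt_top.ne hp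

theorem setIntegral_unitCube_planeWave_mul_periodization {w : E d → ℂ} (hw : Integrable w)
    (z : Fin d → ℤ) :
    ∫ ξ in unitCube d, planeWave (latticePt z) ξ * periodization w ξ
      = ∫ ξ, planeWave (latticePt z) ξ * w ξ := by
  rw [← setIntegral_unitCube_periodization (integrable_planeWave_mul (latticePt z) hw)]
  simp only [periodization_mul_of_periodic (planeWave_latticePt_add z)]

variable {h k : E d → ℂ} {R : ℝ}

theorem mul_conj_periodization_eq_sum (hhR : ∀ ξ, R < ‖ξ‖ → h ξ = 0)
    (hkR : ∀ ξ, R < ‖ξ‖ → k ξ = 0) (ξ : E d) :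
    h ξ * conj (periodization k ξ)
      = ∑ l ∈ (finite_norm_latticePt_le (d := d) (R + R)).toFinset,
        h ξ * conj (k (ξ + latticePt l)) := by
  rcases lt_or_ge R ‖ξ‖ with hξ | hξ
  · simp [hhR ξ hξ]
  · rw [periodization_eq_sum hkR hξ, map_sum, Finset.mul_sum]

theorem integrable_mul_conj_comp_add (hh : MemLp h 2) (hk : MemLp k 2) (x : E d) :
    Integrable (fun ξ => h ξ * conj (k (ξ + x))) :=
  hh.integrable_mul (hk.comp_measurePreserving (measurePreserving_add_right volume x)).star

theorem tsum_integral_mul_conj_comp_add_latticePt (hh : MemLp h 2) (hk : MemLp k 2)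
    (hhR : ∀ ξ, R < ‖ξ‖ → h ξ = 0) (hkR : ∀ ξ, R < ‖ξ‖ → k ξ = 0) :
    ∑' l : Fin d → ℤ, ∫ ξ, h ξ * conj (k (ξ + latticePt l))
      = ∫ ξ, h ξ * conj (periodization k ξ) := by
  simp only [mul_conj_periodization_eq_sum hhR hkR]
  rw [integral_finsetSum _ fun l _ => integrable_mul_conj_comp_add hh hk (latticePt l)]
  refine tsum_eq_sum fun l hl => integral_eq_zero_of_ae (.of_forall fun ξ => ?_)
  have hl' : R + R < ‖latticePt l‖ := by simpa using hl
  rcases lt_or_ge R ‖ξ‖ with hξ | hξ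
  · simp [hhR ξ hξ]
  · have htriangle : ‖latticePt l‖ ≤ ‖ξ + latticePt l‖ + ‖ξ‖ := by
      simpa using norm_sub_le (ξ + latticePt l) ξ
    simp [hkR (ξ + latticePt l) (by linarith)]

theorem setIntegral_unitCube_periodization_mul_conj (hh : MemLp h 2) (hk : MemLp k 2)
    (hhR : ∀ ξ, R < ‖ξ‖ → h ξ = 0) (hkR : ∀ ξ, R < ‖ξ‖ → k ξ = 0) :
    ∫ ξ in unitCube d, periodization h ξ * conj (periodization k ξ)
      = ∑' l : Fin d → ℤ, ∫ ξ, h ξ * conj (k (ξ + latticePt l)) := by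
  have hint : Integrable (fun ξ => conj (periodization k ξ) * h ξ) := by
    simp only [mul_comm _ (h _), mul_conj_periodization_eq_sum hhR hkR]
    exact integrable_finsetSum _ fun l _ => integrable_mul_conj_comp_add hh hk (latticePt l)
  have hperiodic (ξ : E d) (l : Fin d → ℤ) :
      conj (periodization k (ξ + latticePt l)) = conj (periodization k ξ) := by
    rw [periodization_add_latticePt]
  rw [tsum_integral_mul_conj_comp_add_latticePt hh hk hhR hkR]
  have hunfold := setIntegral_unitCube_periodization hint
  simp only [periodization_mul_of_periodic (u := fun ξ => conj (periodization k ξ)) hperiodic]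
    at hunfold
  simpa only [mul_comm] using hunfold

theorem hasSum_integral_planeWave_mul_conj (hh : MemLp h 2) (hk : MemLp k 2)
    (hhR : ∀ ξ, R < ‖ξ‖ → h ξ = 0) (hkR : ∀ ξ, R < ‖ξ‖ → k ξ = 0) :
    HasSum (fun z : Fin d → ℤ => (∫ ξ, planeWave (latticePt z) ξ * h ξ) *
      conj (∫ ξ, planeWave (latticePt z) ξ * k ξ))
      (∑' l : Fin d → ℤ, ∫ ξ, h ξ * conj (k (ξ + latticePt l))) := by
  have hparseval := hasSum_setIntegral_unitCube_planeWave_mul_conj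
    (memLp_periodization_unitCube hh hhR) (memLp_periodization_unitCube hk hkR)
  rw [setIntegral_unitCube_periodization_mul_conj hh hk hhR hkR] at hparseval
  simpa only [setIntegral_unitCube_planeWave_mul_periodization
      (integrable_of_memLp_of_eq_zero one_le_two hh hhR),
    setIntegral_unitCube_planeWave_mul_periodization
      (integrable_of_memLp_of_eq_zero one_le_two hk hkR)] using hparseval

end Periodization

section ExpandingMaps

open Filter Topology

section SpectralRadius

variable {R : Type*} [NormedRing R] [NormedAlgebra ℂ R] [CompleteSpace R]

theorem tendsto_pow_of_spectralRadius_lt_one {a : R} (ha : spectralRadius ℂ a < 1) :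
    Tendsto (fun n : ℕ => a ^ n) atTop (𝓝 0) := by
  obtain ⟨r, har, hr⟩ := ENNReal.lt_iff_exists_nnreal_btwn.mp ha
  rw [tendsto_zero_iff_norm_tendsto_zero]
  refine squeeze_zero' (.of_forall fun _ => norm_nonneg _) ?_
    (tendsto_pow_atTop_nhds_zero_of_lt_one r.2 (by exact_mod_cast hr))
  filter_upwards [(spectrum.pow_nnnorm_pow_one_div_tendsto_nhds_spectralRadius a
    ).eventually_lt_const har, eventually_gt_atTop 0] with n hroot hn
  have hpow := ENNReal.rpow_le_rpow hroot.le (z := (n : ℝ)) (by positivity)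
  rw [← ENNReal.rpow_mul, one_div_mul_cancel (by positivity), ENNReal.rpow_one,
    ENNReal.rpow_natCast] at hpow
  exact_mod_cast hpow

theorem spectralRadius_inv_lt_one [Nontrivial R] {a : Rˣ}
    (ha : ∀ z ∈ spectrum ℂ (a : R), 1 < ‖z‖) : spectralRadius ℂ ((a⁻¹ : Rˣ) : R) < 1 := by
  refine spectrum.spectralRadius_lt_of_forall_lt _ (r := 1) fun z hz => ?_
  have hz0 : z ≠ 0 := spectrum.ne_zero_of_mem_of_unit hz
  have hinv : z⁻¹ ∈ spectrum ℂ (a : R) := by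
    simpa using (spectrum.inv_mem_iff (r := Units.mk0 z hz0) (a := a⁻¹)).mp hz
  have hnorm := ha _ hinv
  rw [norm_inv] at hnorm
  exact_mod_cast (one_lt_inv₀ (norm_pos_iff.mpr hz0)).mp hnorm

end SpectralRadius

open scoped Matrix.Norms.L2Operator in
theorem IsExpansive.tendsto_inv_pow {d : ℕ} {A : GL (Fin d) ℝ}
    (hA : IsExpansive (A : Matrix (Fin d) (Fin d) ℝ)) :
    Tendsto (fun n : ℕ => (((A⁻¹ : GL (Fin d) ℝ) : Matrix (Fin d) (Fin d) ℝ) ^ n))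
      atTop (𝓝 0) := by
  cases isEmpty_or_nonempty (Fin d)
  · simp only [Subsingleton.elim _ (0 : Matrix (Fin d) (Fin d) ℝ), tendsto_const_nhds]
  let complexify : Matrix (Fin d) (Fin d) ℝ →+* Matrix (Fin d) (Fin d) ℂ :=
    Complex.ofRealHom.mapMatrix
  let AC : (Matrix (Fin d) (Fin d) ℂ)ˣ := Units.map complexify.toMonoidHom A
  have hspectrum : ∀ z ∈ spectrum ℂ (AC : Matrix (Fin d) (Fin d) ℂ), 1 < ‖z‖ := fun z hz =>
    hA z (by rwa [Module.End.hasEigenvalue_iff_mem_spectrum, Matrix.spectrum_toLin'])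
  have hlim := tendsto_pow_of_spectralRadius_lt_one (spectralRadius_inv_lt_one hspectrum)
  have hinv : ((AC⁻¹ : (Matrix (Fin d) (Fin d) ℂ)ˣ) : Matrix (Fin d) (Fin d) ℂ)
      = complexify ((A⁻¹ : GL (Fin d) ℝ) : Matrix (Fin d) (Fin d) ℝ) := by
    rw [← map_inv]; rfl
  simp_rw [hinv, ← map_pow] at hlim
  refine tendsto_pi_nhds.mpr fun i => tendsto_pi_nhds.mpr fun j => ?_
  simpa [complexify, Function.comp_def] using (Complex.continuous_re.tendsto _).comp
    (tendsto_pi_nhds.mp (tendsto_pi_nhds.mp hlim i) j)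

section IsExpanding

variable {V : Type*} [NormedAddCommGroup V] [NormedSpace ℝ V]

/-- An invertible linear map is expanding if its inverse powers tend to zero in operator norm. -/
def IsExpanding (B : V ≃L[ℝ] V) : Prop :=
  Tendsto (fun m : ℕ => ‖((B ^ (-(m : ℤ)) : V ≃L[ℝ] V) : V →L[ℝ] V)‖) atTop (𝓝 0)

theorem zpow_add_apply (B : V ≃L[ℝ] V) (m n : ℤ) (x : V) :
    (B ^ (m + n)) x = (B ^ m) ((B ^ n) x) := by
  rw [zpow_add]; rfl

theorem zpow_neg_zpow_apply (B : V ≃L[ℝ] V) (m : ℤ) (x : V) : (B ^ (-m)) ((B ^ m) x) = x := by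
  rw [← zpow_add_apply, neg_add_cancel]; rfl

theorem zpow_zpow_neg_apply (B : V ≃L[ℝ] V) (m : ℤ) (x : V) : (B ^ m) ((B ^ (-m)) x) = x := by
  rw [← zpow_add_apply, add_neg_cancel]; rfl

variable {B : V ≃L[ℝ] V}

theorem IsExpanding.exists_norm_zpow_neg_le (hB : IsExpanding B) {c : ℝ} (hc : 0 < c) :
    ∃ m₀ : ℕ, ∀ j : ℤ, m₀ ≤ j → ∀ x, ‖(B ^ (-j)) x‖ ≤ c * ‖x‖ := by
  obtain ⟨m₀, hm₀⟩ := eventually_atTop.mp (hB.eventually_lt_const hc)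
  refine ⟨m₀, fun j hj x => ?_⟩
  lift j to ℕ using by omega
  refine (ContinuousLinearMap.le_opNorm
    ((B ^ (-(j : ℤ)) : V ≃L[ℝ] V) : V →L[ℝ] V) x).trans ?_
  gcongr
  exact (hm₀ j (by exact_mod_cast hj)).le

theorem IsExpanding.exists_norm_zpow_neg_le_of_ge (hB : IsExpanding B) (m₀ : ℤ) :
    ∃ C : ℝ, 0 ≤ C ∧ ∀ m : ℤ, m₀ ≤ m → ∀ x, ‖(B ^ (-m)) x‖ ≤ C * ‖x‖ := by
  obtain ⟨C, hC⟩ := hB.bddAbove_range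
  have hC0 : 0 ≤ C := (norm_nonneg _).trans (hC ⟨0, rfl⟩)
  refine ⟨‖((B ^ (-m₀) : V ≃L[ℝ] V) : V →L[ℝ] V)‖ * C, by positivity, fun m hm x => ?_⟩
  obtain ⟨j, hj⟩ := Int.eq_ofNat_of_zero_le (sub_nonneg.mpr hm)
  rw [show -m = -m₀ + -(j : ℤ) by omega, zpow_add_apply, mul_assoc]
  refine (ContinuousLinearMap.le_opNorm ((B ^ (-m₀) : V ≃L[ℝ] V) : V →L[ℝ] V) _).trans ?_
  gcongr
  refine (ContinuousLinearMap.le_opNorm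
    ((B ^ (-(j : ℤ)) : V ≃L[ℝ] V) : V →L[ℝ] V) _).trans ?_
  gcongr
  exact hC ⟨j, rfl⟩

end IsExpanding

open scoped Matrix.Norms.L2Operator in
theorem IsExpansive.isExpanding_euclideanEquiv_star {d : ℕ} {A : GL (Fin d) ℝ}
    (hA : IsExpansive (A : Matrix (Fin d) (Fin d) ℝ)) :
    IsExpanding (euclideanEquiv (star A)) := by
  have hlim := hA.tendsto_inv_pow.norm
  rw [norm_zero] at hlim
  refine hlim.congr fun n => ?_
  rw [← norm_star, ← map_zpow, zpow_neg, zpow_natCast, ← inv_pow, ← star_inv, ← star_pow]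
  rfl

end ExpandingMaps

section IntegralMaps

variable {d : ℕ}

/-- A map of `ℝ^d` is integral if it maps the integer lattice into itself. -/
def IsIntegralMap (B : E d → E d) : Prop :=
  ∀ l : Fin d → ℤ, ∃ l' : Fin d → ℤ, B (latticePt l) = latticePt l'

theorem IsIntegralMatrix.isIntegralMap_euclideanEquiv_star {A : GL (Fin d) ℝ}
    (hA : IsIntegralMatrix (A : Matrix (Fin d) (Fin d) ℝ)) :
    IsIntegralMap (euclideanEquiv (star A)) := fun l => by
  choose m hm using hA
  refine ⟨fun i => ∑ j, m j i * l j, ?_⟩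
  ext i
  rw [euclideanEquiv_apply]
  simp [Matrix.toLpLin_apply, Matrix.mulVec, dotProduct, latticePt, hm, Matrix.star_apply]

theorem IsIntegralMap.pow {B : E d ≃L[ℝ] E d} (hB : IsIntegralMap B) (n : ℕ) :
    IsIntegralMap (B ^ n : E d ≃L[ℝ] E d) := by
  induction n with
  | zero => exact fun l => ⟨l, rfl⟩
  | succ n ih =>
    intro l
    obtain ⟨l', hl'⟩ := ih l
    obtain ⟨l'', hl''⟩ := hB l'
    refine ⟨l'', ?_⟩
    rw [pow_succ']
    change B ((B ^ n) (latticePt l)) = _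
    rw [hl', hl'']

end IntegralMaps

section Annuli

section NormedSpace

variable {V : Type*} [NormedAddCommGroup V]

/-- The closed annulus `a ≤ ‖ξ‖ ≤ b`. -/
def annulus (a b : ℝ) : Set V := {ξ | a ≤ ‖ξ‖ ∧ ‖ξ‖ ≤ b}

/-- The indicator function of an annulus, with values in `[0, ∞]`. -/
def annulusInd (a b : ℝ) : V → ℝ≥0∞ := (annulus a b).indicator 1

variable {a b : ℝ}

theorem annulusInd_of_mem {ξ : V} (h : ξ ∈ annulus a b) : annulusInd a b ξ = 1 :=
  Set.indicator_of_mem h _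

theorem annulusInd_of_notMem {ξ : V} (h : ξ ∉ annulus a b) : annulusInd a b ξ = 0 :=
  Set.indicator_of_notMem h _

theorem annulusInd_le_one (ξ : V) : annulusInd a b ξ ≤ 1 :=
  Set.indicator_le_self' (fun _ _ => zero_le) ξ

theorem annulusInd_mono {a' b' : ℝ} (ha : a' ≤ a) (hb : b ≤ b') (ξ : V) :
    annulusInd a b ξ ≤ annulusInd a' b' ξ :=
  Set.indicator_le_indicator_of_subset
    (show annulus a b ⊆ annulus a' b' from fun _ h => ⟨ha.trans h.1, h.2.trans hb⟩)
    (fun _ => zero_le) ξ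

theorem norm_le_of_add_mem_annulus {ξ x : V} (hξ : ξ ∈ annulus a b) (hx : ξ + x ∈ annulus a b) :
    ‖x‖ ≤ b + b := by
  have h := norm_sub_le (ξ + x) ξ
  rw [add_sub_cancel_left] at h
  linarith [hx.2, hξ.2]

section Measure

variable [MeasurableSpace V] [BorelSpace V]

theorem measurableSet_annulus : MeasurableSet (annulus a b : Set V) :=
  (measurableSet_le measurable_const measurable_norm).inter
    (measurableSet_le measurable_norm measurable_const)

theorem measurable_annulusInd : Measurable (annulusInd a b : V → ℝ≥0∞) :=
  measurable_one.indicator measurableSet_annulus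

theorem lintegral_annulusInd_lt_top [ProperSpace V] (μ : Measure V)
    [IsFiniteMeasureOnCompacts μ] : ∫⁻ ξ, annulusInd a b ξ ∂μ < ∞ := by
  rw [annulusInd, lintegral_indicator_one measurableSet_annulus]
  exact (measure_mono fun ξ h => by simpa using h.2).trans_lt
    (measure_closedBall_lt_top (x := (0 : V)) (r := b))

end Measure

variable [NormedSpace ℝ V] {B : V ≃L[ℝ] V}

theorem IsExpanding.exists_sub_lt_of_mem_annulus (hB : IsExpanding B) (ha : 0 < a) (b : ℝ) :
    ∃ m₀ : ℕ, ∀ (η : V) (m n : ℤ), (B ^ m) η ∈ annulus a b → (B ^ n) η ∈ annulus a b →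
      n - m < m₀ := by
  obtain ⟨m₀, hm₀⟩ := hB.exists_norm_zpow_neg_le (c := a / (|b| + 1)) (by positivity)
  refine ⟨m₀, fun η m n hm hn => ?_⟩
  by_contra! hlt
  have hcontract := hm₀ (n - m) hlt ((B ^ n) η)
  rw [← zpow_add_apply, show -(n - m) + n = m by ring] at hcontract
  have hnorm : ‖(B ^ n) η‖ < |b| + 1 := (hn.2.trans (le_abs_self b)).trans_lt (lt_add_one _)
  have hlt_a : a / (|b| + 1) * ‖(B ^ n) η‖ < a := by
    rw [div_mul_eq_mul_div, div_lt_iff₀ (by positivity)]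
    gcongr
  linarith [hm.1]

theorem IsExpanding.exists_tsum_annulusInd_le (hB : IsExpanding B) (ha : 0 < a) (b : ℝ) :
    ∃ M : ℕ, ∀ η, ∑' m : ℤ, annulusInd a b ((B ^ m) η) ≤ M := by
  obtain ⟨m₀, hm₀⟩ := hB.exists_sub_lt_of_mem_annulus ha b
  refine ⟨2 * m₀, fun η => ?_⟩
  by_cases hne : ∃ m₁ : ℤ, (B ^ m₁) η ∈ annulus a b
  · obtain ⟨m₁, hm₁⟩ := hne
    have hoff : ∀ m ∉ Finset.Ioo (m₁ - m₀) (m₁ + m₀), annulusInd a b ((B ^ m) η) = 0 :=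
      fun m hm => annulusInd_of_notMem fun h => hm <| Finset.mem_Ioo.mpr
        ⟨by linarith [hm₀ η m m₁ h hm₁], by linarith [hm₀ η m₁ m hm₁ h]⟩
    rw [tsum_eq_sum hoff]
    calc _ ≤ ∑ _m ∈ Finset.Ioo (m₁ - m₀) (m₁ + m₀), (1 : ℝ≥0∞) :=
          Finset.sum_le_sum fun m _ => annulusInd_le_one _
      _ ≤ _ := by
          rw [Finset.sum_const, Int.card_Ioo, nsmul_one]
          exact_mod_cast (by omega : (m₁ + m₀ - (m₁ - m₀) - 1).toNat ≤ 2 * m₀)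
  · push Not at hne
    simp [annulusInd_of_notMem (hne _)]

end NormedSpace

section LatticePointCounting

variable {d : ℕ}

theorem volume_cubeAt (l : Fin d → ℤ) : volume (cubeAt l) = 1 := by
  rw [cubeAt, (measurePreserving_sub_right volume (latticePt l)).measure_preimage
    measurableSet_unitCube.nullMeasurableSet, volume_unitCube]

theorem preimage_cubeAt_subset_closedBall {e : E d ≃L[ℝ] E d} {C ρ : ℝ} (hC : 0 ≤ C)
    (he : ∀ x, ‖e⁻¹ x‖ ≤ C * ‖x‖) {l : Fin d → ℤ} (hl : ‖e⁻¹ (latticePt l)‖ ≤ ρ) :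
    e ⁻¹' cubeAt l ⊆ Metric.closedBall 0 (C * √d + ρ) := fun y hy => by
  have hcube := norm_le_of_mem_unitCube (show _ ∈ unitCube d from hy)
  have hcontract := he (e y - latticePt l)
  rw [map_sub, show e⁻¹ (e y) = y from e.symm_apply_apply y] at hcontract
  have htriangle := norm_le_norm_sub_add y (e⁻¹ (latticePt l))
  have hscaled := mul_le_mul_of_nonneg_left hcube hC
  rw [mem_closedBall_zero_iff]
  linarith

/-- A packing bound: the cells `e⁻¹(l + (0, 1]^d)` are disjoint, have volume `1 / |det e|`, and
those whose vertex `e⁻¹ l` lies in a given ball are contained in a slightly larger ball. -/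
theorem tsum_indicator_closedBall_latticePt_le {e : E d ≃L[ℝ] E d} {C : ℝ} (hC : 0 ≤ C)
    (he : ∀ x, ‖e⁻¹ x‖ ≤ C * ‖x‖) (ρ : ℝ) :
    ∑' l : Fin d → ℤ, (Metric.closedBall (0 : E d) ρ).indicator (1 : E d → ℝ≥0∞)
        (e⁻¹ (latticePt l))
      ≤ ENNReal.ofReal (absDet e) * volume (Metric.closedBall (0 : E d) (C * √d + ρ)) := by
  calc _ ≤ ∑' l : Fin d → ℤ, ENNReal.ofReal (absDet e) *
        volume (e ⁻¹' cubeAt l ∩ Metric.closedBall (0 : E d) (C * √d + ρ)) := by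
        refine ENNReal.tsum_le_tsum fun l => Set.indicator_apply_le' (fun hl => ?_)
          fun _ => zero_le
        rw [Set.inter_eq_left.mpr
            (preimage_cubeAt_subset_closedBall hC he (mem_closedBall_zero_iff.mp hl)),
          measure_preimage_continuousLinearEquiv _ _ (measurableSet_cubeAt l), volume_cubeAt]
        rfl
    _ ≤ _ := by
        rw [ENNReal.tsum_mul_left]
        gcongr
        rw [← measure_iUnion]
        · exact measure_mono (Set.iUnion_subset fun l => Set.inter_subset_right)
        · exact fun l l' hne => ((pairwise_disjoint_cubeAt hne).preimage _).mono
            Set.inter_subset_left Set.inter_subset_left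
        · exact fun l => (e.continuous.measurable (measurableSet_cubeAt l)).inter
            Metric.isClosed_closedBall.measurableSet

theorem IsExpanding.exists_zpow_latticePt_notMem_closedBall {B : E d ≃L[ℝ] E d}
    (hB : IsExpanding B) {ρ : ℝ} (hρ : 0 ≤ ρ) :
    ∃ m₀ : ℕ, ∀ j : ℤ, m₀ ≤ j → ∀ l : Fin d → ℤ, l ≠ 0 →
      (B ^ j) (latticePt l) ∉ Metric.closedBall 0 ρ := by
  obtain ⟨m₀, hm₀⟩ := hB.exists_norm_zpow_neg_le (c := 1 / (ρ + 1)) (by positivity)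
  refine ⟨m₀, fun j hj l hl hmem => ?_⟩
  have hcontract := hm₀ j hj ((B ^ j) (latticePt l))
  rw [zpow_neg_zpow_apply] at hcontract
  have hlt_one : 1 / (ρ + 1) * ‖(B ^ j) (latticePt l)‖ < 1 := by
    rw [div_mul_eq_mul_div, div_lt_iff₀ (by positivity)]
    linarith [mem_closedBall_zero_iff.mp hmem]
  linarith [one_le_norm_latticePt hl]

theorem IsExpanding.exists_tsum_annulusInd_add_le {B : E d ≃L[ℝ] E d} (hB : IsExpanding B)
    (a b : ℝ) :
    ∃ C : ℝ≥0∞, C ≠ ∞ ∧ ∀ (m : ℤ) (ξ : E d), ∑' l : Fin d → ℤ, (if l = 0 then 0 else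
      annulusInd a b ξ * annulusInd a b (ξ + (B ^ (-m)) (latticePt l)))
        ≤ C * ENNReal.ofReal (absDet (B ^ m)) * annulusInd a b ξ := by
  obtain ⟨m₀, hm₀⟩ := hB.exists_zpow_latticePt_notMem_closedBall (ρ := |b| + |b|) (by positivity)
  obtain ⟨C₀, hC₀, hC⟩ := hB.exists_norm_zpow_neg_le_of_ge (-m₀)
  refine ⟨volume (Metric.closedBall (0 : E d) (C₀ * √d + (|b| + |b|))),
    measure_closedBall_lt_top.ne, fun m ξ => ?_⟩
  by_cases hξ : ξ ∈ annulus a b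
  swap
  · simp [annulusInd_of_notMem hξ]
  simp only [annulusInd_of_mem hξ, one_mul, mul_one]
  have hle (x : E d) : annulusInd a b (ξ + x)
      ≤ (Metric.closedBall (0 : E d) (|b| + |b|)).indicator 1 x := by
    refine Set.indicator_apply_le' (fun hx => ?_) fun _ => zero_le
    rw [Set.indicator_of_mem (mem_closedBall_zero_iff.mpr _)]
    · rfl
    · linarith [norm_le_of_add_mem_annulus hξ hx, le_abs_self b]
  by_cases hm : -(m₀ : ℤ) ≤ m
  · rw [mul_comm]
    refine le_trans (ENNReal.tsum_le_tsum fun l => ?_)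
      (tsum_indicator_closedBall_latticePt_le hC₀ (by simpa only [zpow_neg] using hC m hm) _)
    rw [← zpow_neg]
    split_ifs
    · exact zero_le
    · exact hle _
  · rw [ENNReal.tsum_eq_zero.mpr fun l => ?_]
    · exact zero_le
    · split_ifs with hl
      · rfl
      · exact le_zero_iff.mp ((hle _).trans_eq
          (Set.indicator_of_notMem (hm₀ (-m) (by omega) l hl) _))

end LatticePointCounting

end Annuli

section BandLimited

variable {V : Type*} [NormedAddCommGroup V] [MeasurableSpace V] {F G : V → ℂ}

/-- A bounded measurable function supported in an annulus around the origin. -/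
structure IsBandLimited (F : V → ℂ) : Prop where
  measurable : Measurable F
  exists_le : ∃ a b : ℝ, 0 < a ∧ ∃ M : NNReal, ∀ ξ, ‖F ξ‖ₑ ≤ M * annulusInd a b ξ

theorem IsBandLimited.exists_common (hF : IsBandLimited F) (hG : IsBandLimited G) :
    ∃ a b : ℝ, 0 < a ∧ ∃ M : NNReal, (∀ ξ, ‖F ξ‖ₑ ≤ M * annulusInd a b ξ) ∧
      ∀ ξ, ‖G ξ‖ₑ ≤ M * annulusInd a b ξ := by
  obtain ⟨a, b, ha, M, hFM⟩ := hF.exists_le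
  obtain ⟨a', b', ha', M', hGM⟩ := hG.exists_le
  refine ⟨min a a', max b b', lt_min ha ha', max M M', fun ξ => (hFM ξ).trans ?_,
    fun ξ => (hGM ξ).trans ?_⟩
  · gcongr
    · exact le_max_left _ _
    · exact annulusInd_mono (min_le_left _ _) (le_max_left _ _) ξ
  · gcongr
    · exact le_max_right _ _
    · exact annulusInd_mono (min_le_right _ _) (le_max_right _ _) ξ

theorem IsBandLimited.exists_norm_le (hF : IsBandLimited F) : ∃ M : ℝ, ∀ ξ, ‖F ξ‖ ≤ M := by
  obtain ⟨a, b, -, M, hM⟩ := hF.exists_le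
  refine ⟨M, fun ξ => ?_⟩
  have hbound : ‖F ξ‖ₑ ≤ M := (hM ξ).trans (mul_le_of_le_one_right' (annulusInd_le_one ξ))
  rw [enorm_le_coe] at hbound
  exact_mod_cast hbound

theorem IsBandLimited.exists_common_eq_zero (hF : IsBandLimited F) (hG : IsBandLimited G) :
    ∃ R : ℝ, ∀ ξ, R < ‖ξ‖ → F ξ = 0 ∧ G ξ = 0 := by
  obtain ⟨a, b, -, M, hFM, hGM⟩ := hF.exists_common hG
  refine ⟨b, fun ξ hξ => ?_⟩
  have hnotMem : ξ ∉ annulus a b := fun hmem => hξ.not_ge hmem.2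
  exact ⟨by simpa [annulusInd_of_notMem hnotMem] using hFM ξ,
    by simpa [annulusInd_of_notMem hnotMem] using hGM ξ⟩

theorem IsBandLimited.memLp [BorelSpace V] [ProperSpace V] (hF : IsBandLimited F) (μ : Measure V)
    [IsFiniteMeasureOnCompacts μ] : MemLp F 2 μ := by
  obtain ⟨a, b, -, M, hM⟩ := hF.exists_le
  refine ⟨hF.measurable.aestronglyMeasurable, ?_⟩
  rw [eLpNorm_lt_top_iff_lintegral_rpow_enorm_lt_top (by simp) (by simp)]
  simp only [ENNReal.toReal_ofNat, ENNReal.rpow_ofNat]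
  calc ∫⁻ ξ, ‖F ξ‖ₑ ^ 2 ∂μ ≤ ∫⁻ ξ, (M : ℝ≥0∞) ^ 2 * annulusInd a b ξ ∂μ := by
        refine lintegral_mono fun ξ => ?_
        calc ‖F ξ‖ₑ ^ 2 ≤ (M * annulusInd a b ξ) ^ 2 := by gcongr; exact hM ξ
          _ = M ^ 2 * (annulusInd a b ξ * annulusInd a b ξ) := by ring
          _ ≤ M ^ 2 * annulusInd a b ξ := by
            gcongr
            exact mul_le_of_le_one_right' (annulusInd_le_one ξ)
    _ < ∞ := by
        rw [lintegral_const_mul _ measurable_annulusInd]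
        exact ENNReal.mul_lt_top (by simp) (lintegral_annulusInd_lt_top μ)

end BandLimited

section Summability

variable {d : ℕ} {B : E d ≃L[ℝ] E d}

theorem measurable_zpow (B : E d ≃L[ℝ] E d) (m : ℤ) : Measurable (B ^ m : E d ≃L[ℝ] E d) :=
  (B ^ m).continuous.measurable

/-- The shift `B⁻ᵐ l` of the frequency attached to the index `(m, l)`. -/
def latticeShift (B : E d ≃L[ℝ] E d) (x : ℤ × (Fin d → ℤ)) : E d := (B ^ (-x.1)) (latticePt x.2)

theorem measurable_annulusInd_mul_annulusInd_add {a b : ℝ} (α : E d) :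
    Measurable fun ξ => annulusInd a b ξ * annulusInd a b (ξ + α) :=
  measurable_annulusInd.mul (measurable_annulusInd.comp (measurable_add_const α))

theorem IsExpanding.exists_tsum_lintegral_offDiagonal_le (hB : IsExpanding B) {a : ℝ} (ha : 0 < a)
    (b : ℝ) :
    ∃ C : ℝ≥0∞, C ≠ ∞ ∧ ∀ w : E d → ℝ≥0∞, Measurable w →
      ∑' m : ℤ, ∫⁻ ξ, (∑' l : Fin d → ℤ, if l = 0 then 0 else
        annulusInd a b ξ * annulusInd a b (ξ + latticeShift B (m, l))) * w ((B ^ m) ξ)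
          ≤ C * ∫⁻ ξ, w ξ := by
  obtain ⟨C, hC, hcount⟩ := hB.exists_tsum_annulusInd_add_le a b
  obtain ⟨M, hM⟩ := hB.exists_tsum_annulusInd_le ha b
  refine ⟨C * M, ENNReal.mul_ne_top hC (ENNReal.natCast_ne_top M), fun w hw => ?_⟩
  calc _ ≤ ∑' m : ℤ, C * ∫⁻ η, annulusInd a b ((B ^ (-m)) η) * w η := by
        refine ENNReal.tsum_le_tsum fun m => ?_
        rw [← lintegral_comp_continuousLinearEquiv volume (B ^ m)
          (fun η => annulusInd a b ((B ^ (-m)) η) * w η), ← mul_assoc]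
        simp only [zpow_neg_zpow_apply]
        have hwm : Measurable fun ξ => annulusInd a b ξ * w ((B ^ m) ξ) :=
          measurable_annulusInd.mul (hw.comp (measurable_zpow B m))
        rw [← lintegral_const_mul _ hwm]
        refine lintegral_mono fun ξ => ?_
        rw [← mul_assoc]
        gcongr
        exact hcount m ξ
    _ = C * ∫⁻ η, (∑' m : ℤ, annulusInd a b ((B ^ (-m)) η)) * w η := by
        have hwm (m : ℤ) : Measurable fun η => annulusInd a b ((B ^ (-m)) η) * w η :=
          (measurable_annulusInd.comp (measurable_zpow B (-m))).mul hw
        rw [ENNReal.tsum_mul_left, ← lintegral_tsum fun m => (hwm m).aemeasurable]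
        simp_rw [ENNReal.tsum_mul_right]
    _ ≤ C * ∫⁻ η, M * w η := by
        gcongr with η
        exact ((Equiv.neg ℤ).tsum_eq fun m => annulusInd a b ((B ^ m) η)).trans_le (hM η)
    _ = C * M * ∫⁻ η, w η := by rw [lintegral_const_mul _ hw, mul_assoc]

theorem IsExpanding.exists_tsum_lintegral_le (hB : IsExpanding B) {a : ℝ} (ha : 0 < a) (b : ℝ) :
    ∃ C : ℝ≥0∞, C ≠ ∞ ∧ ∀ w : E d → ℝ≥0∞, Measurable w →
      ∑' x : ℤ × (Fin d → ℤ), ∫⁻ ξ, annulusInd a b ξ * annulusInd a b (ξ + latticeShift B x) *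
        w ((B ^ x.1) ξ)
          ≤ (∫⁻ ξ, annulusInd a b ξ * ∑' m : ℤ, w ((B ^ m) ξ)) + C * ∫⁻ ξ, w ξ := by
  obtain ⟨C, hC, hoff⟩ := hB.exists_tsum_lintegral_offDiagonal_le ha b
  refine ⟨C, hC, fun w hw => ?_⟩
  have hwm (m : ℤ) : Measurable fun ξ => w ((B ^ m) ξ) := hw.comp (measurable_zpow B m)
  have hdiag : ∑' m : ℤ, ∫⁻ ξ, annulusInd a b ξ * w ((B ^ m) ξ)
      = ∫⁻ ξ, annulusInd a b ξ * ∑' m : ℤ, w ((B ^ m) ξ) := by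
    simp_rw [← ENNReal.tsum_mul_left]
    exact (lintegral_tsum fun m => (measurable_annulusInd.mul (hwm m)).aemeasurable).symm
  refine le_trans ?_ (add_le_add hdiag.le (hoff w hw))
  rw [ENNReal.tsum_prod', ← ENNReal.tsum_add]
  refine ENNReal.tsum_le_tsum fun m => ?_
  simp_rw [← ENNReal.tsum_mul_right]
  rw [lintegral_tsum fun l => ?_, ENNReal.tsum_eq_add_tsum_ite (0 : Fin d → ℤ)]
  · refine add_le_add (lintegral_mono fun ξ => ?_) (ENNReal.tsum_le_tsum fun l => ?_)
    · gcongr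
      exact mul_le_of_le_one_right' (annulusInd_le_one _)
    · split_ifs <;> simp
  · split_ifs
    · simp
    · exact ((measurable_annulusInd_mul_annulusInd_add _).mul (hwm m)).aemeasurable

/-- A square integrable function whose dilates are locally square summable away from the origin. -/
structure IsSquareSummable (B : E d ≃L[ℝ] E d) (p : E d → ℂ) : Prop where
  measurable : Measurable p
  lintegral_ne_top : ∫⁻ ξ, ‖p ξ‖ₑ ^ 2 ≠ ∞
  annulus_ne_top : ∀ a b : ℝ, 0 < a →
    ∫⁻ ξ, annulusInd a b ξ * ∑' m : ℤ, ‖p ((B ^ m) ξ)‖ₑ ^ 2 ≠ ∞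

/-- The integrand of the `(m, α)` term in the frequency side expansion of the pairing
`∑ₓ ⟪Uₓ ψ, f⟫ * conj ⟪Uₓ φ, g⟫` over an affine system, where `F`, `G`, `p`, `q` are the Fourier
transforms of `f`, `g`, `ψ`, `φ`. -/
def crossTerm (B : E d ≃L[ℝ] E d) (F G p q : E d → ℂ) (m : ℤ) (α ξ : E d) : ℂ :=
  F ξ * conj (G (ξ + α)) * (conj (p ((B ^ m) ξ)) * q ((B ^ m) (ξ + α)))

variable {F G p q : E d → ℂ}

theorem measurable_crossTerm (hF : Measurable F) (hG : Measurable G) (hp : Measurable p)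
    (hq : Measurable q) (m : ℤ) (α : E d) : Measurable (crossTerm B F G p q m α) := by
  have hshift : Measurable fun ξ : E d => ξ + α := measurable_add_const α
  exact (hF.mul (Complex.continuous_conj.measurable.comp (hG.comp hshift))).mul
    ((Complex.continuous_conj.measurable.comp (hp.comp (measurable_zpow B m))).mul
      (hq.comp ((measurable_zpow B m).comp hshift)))

theorem IsSquareSummable.tsum_lintegral_ne_top (hB : IsExpanding B) (hp : IsSquareSummable B p)
    {a : ℝ} (ha : 0 < a) (b : ℝ) :
    ∑' x : ℤ × (Fin d → ℤ), ∫⁻ ξ, annulusInd a b ξ * annulusInd a b (ξ + latticeShift B x) *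
      ‖p ((B ^ x.1) ξ)‖ₑ ^ 2 ≠ ∞ := by
  obtain ⟨C, hC, hle⟩ := hB.exists_tsum_lintegral_le ha b
  exact ne_top_of_le_ne_top (ENNReal.add_ne_top.mpr ⟨hp.annulus_ne_top a b ha,
    ENNReal.mul_ne_top hC hp.lintegral_ne_top⟩) (hle _ (hp.measurable.enorm.pow_const 2))

theorem lintegral_annulusInd_add_neg (a b : ℝ) (w : E d → ℝ≥0∞) (α : E d) :
    ∫⁻ ξ, annulusInd a b ξ * annulusInd a b (ξ + -α) * w ξ
      = ∫⁻ ξ, annulusInd a b ξ * annulusInd a b (ξ + α) * w (ξ + α) := by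
  rw [← lintegral_add_right_eq_self _ α]
  simp only [add_neg_cancel_right]
  exact lintegral_congr fun ξ => by ring

theorem IsSquareSummable.tsum_lintegral_comp_add_ne_top (hB : IsExpanding B)
    (hp : IsSquareSummable B p) {a : ℝ} (ha : 0 < a) (b : ℝ) :
    ∑' x : ℤ × (Fin d → ℤ), ∫⁻ ξ, annulusInd a b ξ * annulusInd a b (ξ + latticeShift B x) *
      ‖p ((B ^ x.1) (ξ + latticeShift B x))‖ₑ ^ 2 ≠ ∞ := by
  have h := hp.tsum_lintegral_ne_top hB ha b
  rw [← ((Equiv.refl ℤ).prodCongr (Equiv.neg (Fin d → ℤ))).tsum_eq] at h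
  convert h using 3 with x
  simp only [Equiv.prodCongr_apply, Prod.map_fst, Prod.map_snd, Equiv.refl_apply, Equiv.neg_apply,
    latticeShift, latticePt_neg, map_neg]
  exact (lintegral_annulusInd_add_neg a b (fun ξ => ‖p ((B ^ x.1) ξ)‖ₑ ^ 2) _).symm

theorem mul_le_sq_add_sq (x y : ℝ≥0∞) : x * y ≤ x ^ 2 + y ^ 2 := by
  rcases le_total x y with h | h
  · calc x * y ≤ y * y := by gcongr
      _ ≤ _ := by rw [sq y]; exact le_add_self
  · calc x * y ≤ x * x := by gcongr
      _ ≤ _ := by rw [sq x]; exact le_self_add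

theorem enorm_crossTerm_le {a b : ℝ} {M : ℝ≥0∞} (hF : ∀ ξ, ‖F ξ‖ₑ ≤ M * annulusInd a b ξ)
    (hG : ∀ ξ, ‖G ξ‖ₑ ≤ M * annulusInd a b ξ) (m : ℤ) (α ξ : E d) :
    ‖crossTerm B F G p q m α ξ‖ₑ ≤
      M ^ 2 * (annulusInd a b ξ * annulusInd a b (ξ + α) * ‖p ((B ^ m) ξ)‖ₑ ^ 2 +
        annulusInd a b ξ * annulusInd a b (ξ + α) * ‖q ((B ^ m) (ξ + α))‖ₑ ^ 2) := by
  simp only [crossTerm, enorm_mul, RCLike.enorm_conj]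
  calc _ ≤ (M * annulusInd a b ξ) * (M * annulusInd a b (ξ + α)) *
        (‖p ((B ^ m) ξ)‖ₑ ^ 2 + ‖q ((B ^ m) (ξ + α))‖ₑ ^ 2) := by
        gcongr
        · exact hF ξ
        · exact hG _
        · exact mul_le_sq_add_sq _ _
    _ = _ := by ring

theorem tsum_lintegral_crossTerm_ne_top (hB : IsExpanding B) (hF : IsBandLimited F)
    (hG : IsBandLimited G) (hp : IsSquareSummable B p) (hq : IsSquareSummable B q) :
    ∑' x : ℤ × (Fin d → ℤ), ∫⁻ ξ, ‖crossTerm B F G p q x.1 (latticeShift B x) ξ‖ₑ ≠ ∞ := by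
  obtain ⟨a, b, ha, M, hFM, hGM⟩ := hF.exists_common hG
  refine ne_top_of_le_ne_top (ENNReal.mul_ne_top (a := (M : ℝ≥0∞) ^ 2) (by simp)
    (ENNReal.add_ne_top.mpr ⟨hp.tsum_lintegral_ne_top hB ha b,
      hq.tsum_lintegral_comp_add_ne_top hB ha b⟩)) ?_
  rw [← ENNReal.tsum_add, ← ENNReal.tsum_mul_left]
  refine ENNReal.tsum_le_tsum fun x => ?_
  have hpx : Measurable fun ξ => annulusInd a b ξ * annulusInd a b (ξ + latticeShift B x) *
      ‖p ((B ^ x.1) ξ)‖ₑ ^ 2 := (measurable_annulusInd_mul_annulusInd_add _).mul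
    ((hp.measurable.comp (measurable_zpow B x.1)).enorm.pow_const 2)
  rw [← lintegral_add_left hpx, ← lintegral_const_mul' _ _ (by simp)]
  exact lintegral_mono fun ξ => enorm_crossTerm_le hFM hGM x.1 _ ξ

theorem integrable_crossTerm (hB : IsExpanding B) (hF : IsBandLimited F)
    (hG : IsBandLimited G) (hp : IsSquareSummable B p) (hq : IsSquareSummable B q)
    (x : ℤ × (Fin d → ℤ)) : Integrable (crossTerm B F G p q x.1 (latticeShift B x)) :=
  ⟨(measurable_crossTerm hF.measurable hG.measurable hp.measurable hq.measurable _ _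
    ).aestronglyMeasurable, (ENNReal.ne_top_of_tsum_ne_top
      (tsum_lintegral_crossTerm_ne_top hB hF hG hp hq) x).lt_top⟩

theorem summable_integral_crossTerm (hB : IsExpanding B) (hF : IsBandLimited F)
    (hG : IsBandLimited G) (hp : IsSquareSummable B p) (hq : IsSquareSummable B q) :
    Summable fun x : ℤ × (Fin d → ℤ) => ∫ ξ, crossTerm B F G p q x.1 (latticeShift B x) ξ := by
  refine Summable.of_norm_bounded
    (ENNReal.summable_toReal (tsum_lintegral_crossTerm_ne_top hB hF hG hp hq)) fun x => ?_
  rw [← integral_norm_eq_lintegral_enorm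
    (integrable_crossTerm hB hF hG hp hq x).aestronglyMeasurable]
  exact norm_integral_le_integral_norm _

end Summability

section Levels

variable {d : ℕ}

theorem sqrtDet_mul (M N : GL (Fin d) ℝ) : sqrtDet (M * N) = sqrtDet M * sqrtDet N := by
  ext1
  change ((√|((M * N : GL (Fin d) ℝ) : Matrix (Fin d) (Fin d) ℝ).det| : ℝ) : ℂ)
    = ((√|(M : Matrix (Fin d) (Fin d) ℝ).det| : ℝ) : ℂ) *
      ((√|(N : Matrix (Fin d) (Fin d) ℝ).det| : ℝ) : ℂ)
  rw [Matrix.GeneralLinearGroup.coe_mul, Matrix.det_mul, abs_mul, Real.sqrt_mul (abs_nonneg _),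
    Complex.ofReal_mul]

theorem renormDilation_apply (M : GL (Fin d) ℝ) (f : L2 d) :
    renormDilation M f = (sqrtDet M : ℂ) • dilation M f := rfl

theorem renormDilation_mul (M N : GL (Fin d) ℝ) :
    renormDilation (M * N) = renormDilation N * renormDilation M := by
  refine DFunLike.ext _ _ fun f => ?_
  change renormDilation (M * N) f = renormDilation N (renormDilation M f)
  rw [renormDilation_apply, renormDilation_apply, renormDilation_apply, map_smul, smul_smul,
    dilation_mul, sqrtDet_mul, mul_comm (sqrtDet M), Units.val_mul]
  rfl

theorem renormDilation_zpow (M : GL (Fin d) ℝ) (n : ℤ) :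
    renormDilation (M ^ n) = renormDilation M ^ n :=
  map_zpow_of_map_mul_rev renormDilation_mul M n

theorem coeFn_fourier_dilation_inv (M : GL (Fin d) ℝ) (f : L2 d) :
    (𝓕 (dilation M⁻¹ f) : L2 d) =ᵐ[volume] fun ξ =>
      ((√(absDet (euclideanEquiv (star M))) : ℝ) : ℂ) * 𝓕 f (euclideanEquiv (star M) ξ) := by
  rw [fourier_dilation, star_inv, inv_inv]
  exact coeFn_dilation_euclideanEquiv _ _

theorem sqrtDet_mul_sqrt_absDet_inv (M : GL (Fin d) ℝ) :
    (sqrtDet M : ℂ) * ((√(absDet (euclideanEquiv (star M⁻¹))) : ℝ) : ℂ) = 1 := by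
  rw [absDet_euclideanEquiv_star, absDet_euclideanEquiv]
  change ((sqrtDet M * sqrtDet M⁻¹ : ℂˣ) : ℂ) = 1
  rw [← sqrtDet_mul, mul_inv_cancel, Units.val_eq_one]
  ext1
  simp [sqrtDet]

theorem coeFn_fourier_renormDilation (M : GL (Fin d) ℝ) (f : L2 d) :
    (𝓕 (renormDilation M f) : L2 d) =ᵐ[volume] fun ξ => 𝓕 f (euclideanEquiv (star M⁻¹) ξ) := by
  have hsmul : 𝓕 (renormDilation M f) = (sqrtDet M : ℂ) • 𝓕 (dilation M f) :=
    (Lp.fourierTransformₗᵢ (E d) ℂ).map_smul _ _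
  have hdilation := coeFn_fourier_dilation_inv M⁻¹ f
  rw [inv_inv] at hdilation
  filter_upwards [Lp.coeFn_smul (sqrtDet M : ℂ) (𝓕 (dilation M f)), hdilation] with ξ hξ hξ'
  rw [hsmul, hξ, Pi.smul_apply, hξ', smul_eq_mul, ← mul_assoc, sqrtDet_mul_sqrt_absDet_inv,
    one_mul]

theorem inner_translation_eq_integral_fourier (α : E d) (f g : L2 d) :
    inner ℂ (translation α f) g
      = ∫ ξ, planeWave α ξ * (𝓕 g ξ * conj (𝓕 f ξ)) := by
  rw [inner_eq_integral_fourier, fourier_translation]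
  refine integral_congr_ae ?_
  filter_upwards [coeFn_modulation (-α) (𝓕 f)] with ξ hξ
  rw [hξ, map_mul, planeWave_neg_left, RCLike.conj_conj]
  ring

variable {f g : L2 d} {F G : E d → ℂ}

theorem inner_dilation_translation (M : GL (Fin d) ℝ) (ψ : L2 d) (hf : (𝓕 f : L2 d) =ᵐ[volume] F)
    (α : E d) :
    inner ℂ (dilation M (translation α ψ)) f = ∫ ξ, planeWave α ξ *
      (((√(absDet (euclideanEquiv (star M))) : ℝ) : ℂ) * F (euclideanEquiv (star M) ξ) *
        conj (𝓕 ψ ξ)) := by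
  have hadjoint : inner ℂ (dilation M (translation α ψ)) f
      = inner ℂ (translation α ψ) (dilation M⁻¹ f) := by
    rw [dilation_inv]
    exact ((dilation M).inner_map_eq_flip _ _)
  rw [hadjoint, inner_translation_eq_integral_fourier]
  refine integral_congr_ae ?_
  filter_upwards [coeFn_fourier_dilation_inv M f, ae_comp_matrix (star M) hf] with ξ hξ hFξ
  rw [hξ, euclideanEquiv_apply, hFξ]

theorem inner_translation_renormDilation (M : GL (Fin d) ℝ) (ψ : L2 d)
    (hf : (𝓕 f : L2 d) =ᵐ[volume] F) (α : E d) :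
    inner ℂ (translation α (renormDilation M ψ)) f
      = ∫ ξ, planeWave α ξ * (F ξ * conj (𝓕 ψ (euclideanEquiv (star M⁻¹) ξ))) := by
  rw [inner_translation_eq_integral_fourier]
  refine integral_congr_ae ?_
  filter_upwards [coeFn_fourier_renormDilation M ψ, hf] with ξ hξ hFξ
  rw [hξ, hFξ]

theorem memLp_mul_of_norm_le {u v : E d → ℂ} (hu : AEStronglyMeasurable u) {c : ℝ}
    (hc : ∀ ξ, ‖u ξ‖ ≤ c) {p : ℝ≥0∞} (hv : MemLp v p) : MemLp (fun ξ => u ξ * v ξ) p :=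
  hv.of_le_mul (hu.mul hv.1) (.of_forall fun ξ => by
    rw [norm_mul]
    gcongr
    exact hc ξ)

theorem lt_norm_apply_of_norm_symm_mul_lt (e : E d ≃L[ℝ] E d) {R : ℝ} {ξ : E d}
    (hξ : ‖(e.symm : E d →L[ℝ] E d)‖ * R < ‖ξ‖) : R < ‖e ξ‖ := by
  by_contra! hle
  have hnorm := (e.symm : E d →L[ℝ] E d).le_opNorm (e ξ)
  rw [ContinuousLinearEquiv.coe_coe, e.symm_apply_apply] at hnorm
  exact hξ.not_ge (hnorm.trans (by gcongr))

variable {A : GL (Fin d) ℝ} {ψ φ : L2 d}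

/-- The quasi-affine system `D_A^n T_z ψ` for `n ≥ 0` and `T_z D̃_A^n ψ` for `n < 0`, the case of
a single function of `superQuasiAffineSystem`. -/
def quasiAffineSystem (A : GL (Fin d) ℝ) (ψ : L2 d) : ℤ × (Fin d → ℤ) → L2 d :=
  fun x => if 0 ≤ x.1 then affineSystem A ψ x
    else translation (latticePt x.2) ((renormDilation A ^ x.1) ψ)

theorem hasSum_affineSystem_level (hF : IsBandLimited F) (hG : IsBandLimited G)
    (hf : (𝓕 f : L2 d) =ᵐ[volume] F) (hg : (𝓕 g : L2 d) =ᵐ[volume] G) (n : ℤ) :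
    HasSum (fun z => inner ℂ (affineSystem A ψ (n, z)) f *
      conj (inner ℂ (affineSystem A φ (n, z)) g))
      (∑' l : Fin d → ℤ, ∫ ξ, crossTerm (euclideanEquiv (star A)) F G (𝓕 ψ : L2 d)
        (𝓕 φ : L2 d) (-n) ((euclideanEquiv (star A) ^ n) (latticePt l)) ξ) := by
  simp only [affineSystem, ← dilation_zpow, inner_dilation_translation _ _ hf,
    inner_dilation_translation _ _ hg, star_zpow, map_zpow]
  set B := euclideanEquiv (star A)
  have hmem {F : E d → ℂ} (hF : IsBandLimited F) (ψ : L2 d) : MemLp (fun ξ =>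
      ((√(absDet (B ^ n)) : ℝ) : ℂ) * F ((B ^ n) ξ) * conj (𝓕 ψ ξ)) 2 := by
    obtain ⟨M, hM⟩ := hF.exists_norm_le
    refine memLp_mul_of_norm_le (c := √(absDet (B ^ n)) * M) ((hF.measurable.comp
      (measurable_zpow B n)).const_mul _).aestronglyMeasurable (fun ξ => ?_) (Lp.memLp (𝓕 ψ)).star
    rw [norm_mul, Complex.norm_real, Real.norm_of_nonneg (Real.sqrt_nonneg _)]
    gcongr
    exact hM _
  obtain ⟨R, hR⟩ := hF.exists_common_eq_zero hG
  have hsupp (ξ : E d) (hξ : _ < ‖ξ‖) := hR _ (lt_norm_apply_of_norm_symm_mul_lt (B ^ n) hξ)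
  have hparseval := hasSum_integral_planeWave_mul_conj (hmem hF ψ) (hmem hG φ)
    (fun ξ hξ => by rw [(hsupp ξ hξ).1]; simp) (fun ξ hξ => by rw [(hsupp ξ hξ).2]; simp)
  convert hparseval using 1
  refine tsum_congr fun l => ?_
  rw [← integral_comp_continuousLinearEquiv volume (B ^ n), ← integral_smul]
  refine integral_congr_ae (.of_forall fun ξ => ?_)
  have hsqrt : (absDet (B ^ n) : ℂ)
      = ((√(absDet (B ^ n)) : ℝ) : ℂ) * ((√(absDet (B ^ n)) : ℝ) : ℂ) := by
    rw [← Complex.ofReal_mul, Real.mul_self_sqrt (absDet_pos _).le]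
  simp only [crossTerm, ← map_add (B ^ n), zpow_neg_zpow_apply, map_mul, RCLike.conj_conj,
    Complex.conj_ofReal, Complex.real_smul, hsqrt]
  ring

theorem hasSum_quasiAffineSystem_level_of_neg (hF : IsBandLimited F) (hG : IsBandLimited G)
    (hf : (𝓕 f : L2 d) =ᵐ[volume] F) (hg : (𝓕 g : L2 d) =ᵐ[volume] G) {n : ℤ} (hn : n < 0) :
    HasSum (fun z => inner ℂ (quasiAffineSystem A ψ (n, z)) f *
      conj (inner ℂ (quasiAffineSystem A φ (n, z)) g))
      (∑' l : Fin d → ℤ, ∫ ξ, crossTerm (euclideanEquiv (star A)) F G (𝓕 ψ : L2 d)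
        (𝓕 φ : L2 d) (-n) (latticePt l) ξ) := by
  simp only [quasiAffineSystem, if_neg (not_le.mpr hn), ← renormDilation_zpow,
    inner_translation_renormDilation _ _ hf, inner_translation_renormDilation _ _ hg,
    ← zpow_neg, star_zpow, map_zpow]
  set B := euclideanEquiv (star A)
  have hmem {F : E d → ℂ} (hF : IsBandLimited F) (ψ : L2 d) : MemLp (fun ξ =>
      F ξ * conj (𝓕 ψ ((B ^ (-n)) ξ))) 2 := by
    obtain ⟨M, hM⟩ := hF.exists_norm_le
    exact memLp_mul_of_norm_le hF.measurable.aestronglyMeasurable hM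
      (memLp_comp_continuousLinearEquiv _ (Lp.memLp (𝓕 ψ))).star
  obtain ⟨R, hR⟩ := hF.exists_common_eq_zero hG
  have hparseval := hasSum_integral_planeWave_mul_conj (hmem hF ψ) (hmem hG φ)
    (fun ξ hξ => by rw [(hR ξ hξ).1, zero_mul]) (fun ξ hξ => by rw [(hR ξ hξ).2, zero_mul])
  convert hparseval using 1
  refine tsum_congr fun l => integral_congr_ae (.of_forall fun ξ => ?_)
  simp only [crossTerm, map_mul, RCLike.conj_conj]
  ring

end Levels

section TrigonometricSeries

open Filter Topology

theorem tendsto_exp_neg_mul_sq_norm {V : Type*} [NormedAddCommGroup V] (w : V) :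
    Tendsto (fun c : ℝ => ((Real.exp (-(c * ‖w‖ ^ 2)) : ℝ) : ℂ)) atTop
      (𝓝 (({0} : Set V).indicator 1 w)) := by
  rcases eq_or_ne w 0 with rfl | hw
  · simp
  · rw [Set.indicator_of_notMem (by simpa using hw), ← Complex.ofReal_zero]
    exact (Complex.continuous_ofReal.tendsto _).comp <| Real.tendsto_exp_neg_atTop_nhds_zero.comp <|
      tendsto_id.atTop_mul_const (by positivity)

variable {V : Type*} [NormedAddCommGroup V] [InnerProductSpace ℝ V] [FiniteDimensional ℝ V]
  [MeasurableSpace V] [BorelSpace V]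

theorem integrable_gaussian {b : ℝ} (hb : 0 < b) :
    Integrable fun x : V => Complex.exp (-b * ‖x‖ ^ 2) := by
  simpa using GaussianFourier.integrable_cexp_neg_mul_sq_norm_add (V := V) (b := (b : ℂ))
    (by simpa using hb) 0 0

theorem integrable_gaussian_mul_planeWave {b : ℝ} (hb : 0 < b) (w : V) :
    Integrable fun x : V => Complex.exp (-b * ‖x‖ ^ 2) * planeWave x w := by
  simpa only [planeWave, real_inner_comm w, mul_comm] using
    integrable_planeWave_mul w (integrable_gaussian hb)

theorem integral_gaussian_mul_planeWave {b : ℝ} (hb : 0 < b) (w : V) :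
    ∫ x : V, Complex.exp (-b * ‖x‖ ^ 2) * planeWave x w
      = (Real.pi / b : ℂ) ^ ((Module.finrank ℝ V : ℂ) / 2) *
        (Real.exp (-(Real.pi ^ 2 / b * ‖w‖ ^ 2)) : ℝ) := by
  convert GaussianFourier.integral_cexp_neg_mul_sq_norm_add (V := V) (b := (b : ℂ))
    (by simpa using hb) (2 * Real.pi * Complex.I) w using 1
  · refine integral_congr_ae (.of_forall fun x => ?_)
    simp only [planeWave, Real.fourierChar_apply]
    rw [← Complex.exp_add, real_inner_comm]
    congr 1
    push_cast
    ring
  · have hb' : (b : ℂ) ≠ 0 := by exact_mod_cast hb.ne'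
    rw [Complex.ofReal_exp]
    congr 2
    push_cast
    rw [mul_pow, Complex.I_sq]
    field_simp
    ring

variable {ι : Type*} [Countable ι] {t : ι → ℂ} {α : ι → V} {s : ℂ}

theorem tsum_mul_exp_neg_mul_sq_norm_sub (ht : Summable t)
    (hs : ∀ x, ∑' i, t i * planeWave x (α i) = s) (β : V) {c : ℝ} (hc : 0 < c) :
    ∑' i, t i * (Real.exp (-(c * ‖α i - β‖ ^ 2)) : ℝ)
      = s * (Real.exp (-(c * ‖β‖ ^ 2)) : ℝ) := by
  obtain ⟨b, hb, rfl⟩ : ∃ b, 0 < b ∧ c = Real.pi ^ 2 / b :=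
    ⟨Real.pi ^ 2 / c, by positivity, by field_simp⟩
  have hconst : (Real.pi / b : ℂ) ^ ((Module.finrank ℝ V : ℂ) / 2) ≠ 0 := by
    rw [Complex.cpow_ne_zero_iff]
    left
    exact_mod_cast (div_pos Real.pi_pos hb).ne'
  have hsum (x : V) : ∑' i, t i * (Complex.exp (-b * ‖x‖ ^ 2) * planeWave x (α i - β))
      = s * (Complex.exp (-b * ‖x‖ ^ 2) * planeWave x (-β)) := by
    rw [← hs x, ← tsum_mul_right]
    refine tsum_congr fun i => ?_
    rw [sub_eq_add_neg, planeWave_add_right]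
    ring
  have hintegral := hasSum_integral_of_summable_integral_norm (μ := (volume : Measure V))
    (F := fun i x => t i * (Complex.exp (-b * ‖x‖ ^ 2) * planeWave x (α i - β)))
    (fun i => (integrable_gaussian_mul_planeWave hb _).const_mul _) (by
      simp only [norm_mul, norm_planeWave, mul_one, integral_const_mul]
      exact ht.norm.mul_right _)
  simp_rw [hsum, integral_const_mul, integral_gaussian_mul_planeWave hb, norm_neg] at hintegral
  refine mul_left_cancel₀ hconst ?_
  rw [mul_left_comm, ← hintegral.tsum_eq, ← tsum_mul_left]
  exact tsum_congr fun i => mul_left_comm _ _ _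

theorem tsum_fiber_eq_of_tsum_mul_planeWave_eq (ht : Summable t)
    (hs : ∀ x, ∑' i, t i * planeWave x (α i) = s) (β : V) :
    ∑' i : α ⁻¹' {β}, t i = s * ({0} : Set V).indicator 1 β := by
  have hlim : Tendsto (fun c : ℝ => ∑' i, t i * ((Real.exp (-(c * ‖α i - β‖ ^ 2)) : ℝ) : ℂ)) atTop
      (𝓝 (∑' i, t i * ({0} : Set V).indicator 1 (α i - β))) := by
    refine tendsto_tsum_of_dominated_convergence ht.norm
      (fun i => (tendsto_exp_neg_mul_sq_norm (α i - β)).const_mul (t i)) ?_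
    filter_upwards [eventually_ge_atTop 0] with c hc i
    rw [norm_mul, Complex.norm_real, Real.norm_of_nonneg (Real.exp_nonneg _)]
    exact mul_le_of_le_one_right (norm_nonneg _)
      (Real.exp_le_one_iff.mpr (neg_nonpos.mpr (by positivity)))
  have hlim' := (tendsto_exp_neg_mul_sq_norm β).const_mul s
  rw [← tendsto_nhds_unique (hlim.congr' ((eventually_gt_atTop 0).mono fun c hc =>
    tsum_mul_exp_neg_mul_sq_norm_sub ht hs β hc)) hlim', tsum_subtype]
  refine tsum_congr fun i => ?_
  by_cases hi : α i = β <;> simp [hi, sub_eq_zero]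

end TrigonometricSeries

section Fibers

variable {d : ℕ} {B : E d ≃L[ℝ] E d}

theorem latticeShift_eq_zero_iff {x : ℤ × (Fin d → ℤ)} : latticeShift B x = 0 ↔ x.2 = 0 := by
  rw [latticeShift, map_eq_zero_iff _ (B ^ (-x.1)).injective, ← latticePt_zero,
    latticePt_injective.eq_iff]

theorem latticeShift_preimage_zero :
    latticeShift B ⁻¹' {0} = Set.range fun m : ℤ => (m, (0 : Fin d → ℤ)) := by
  ext ⟨m, l⟩
  rw [Set.mem_preimage, Set.mem_singleton_iff, latticeShift_eq_zero_iff]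
  simp [eq_comm]

theorem latticeShift_eq_zpow_apply_iff {m n : ℤ} {l : Fin d → ℤ} {x : E d} :
    latticeShift B (m, l) = (B ^ n) x ↔ latticePt l = (B ^ (m + n)) x := by
  rw [zpow_add_apply]
  constructor
  · intro h
    rw [← h, latticeShift, zpow_zpow_neg_apply]
  · intro h
    rw [latticeShift, h, zpow_neg_zpow_apply]

theorem nonneg_of_latticePt_eq_zpow_apply (hB : IsIntegralMap B) {k l : Fin d → ℤ}
    (hk : ¬ ∃ l, latticePt k = B (latticePt l)) {n : ℤ}
    (h : latticePt l = (B ^ n) (latticePt k)) : 0 ≤ n := by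
  by_contra! hn
  obtain ⟨j, rfl⟩ : ∃ j : ℕ, n = -(1 + j) := ⟨(-n - 1).toNat, by omega⟩
  obtain ⟨l', hl'⟩ := hB.pow j l
  have hcancel := zpow_zpow_neg_apply B (1 + j) (latticePt k)
  rw [← h, zpow_add_apply, zpow_one, zpow_natCast, hl'] at hcancel
  exact hk ⟨l', hcancel.symm⟩

theorem exists_latticeShift_preimage_eq_range (hB : IsIntegralMap B) (n : ℤ) {k : Fin d → ℤ}
    (hk : ¬ ∃ l, latticePt k = B (latticePt l)) :
    ∃ e : ℕ → ℤ × (Fin d → ℤ), (∀ j, (e j).1 = j - n) ∧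
      latticeShift B ⁻¹' {(B ^ n) (latticePt k)} = Set.range e := by
  choose κ hκ using fun j : ℕ => hB.pow j k
  refine ⟨fun j => (j - n, κ j), fun j => rfl, ?_⟩
  ext ⟨m, l⟩
  rw [Set.mem_preimage, Set.mem_singleton_iff, latticeShift_eq_zpow_apply_iff]
  constructor
  · intro hl
    obtain ⟨j, hj⟩ := Int.eq_ofNat_of_zero_le (nonneg_of_latticePt_eq_zpow_apply hB hk hl)
    refine ⟨j, Prod.ext (by simp only; omega) (latticePt_injective ?_)⟩
    rw [← hκ, hl, hj, zpow_natCast]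
  · rintro ⟨j, hj⟩
    obtain ⟨rfl, rfl⟩ := Prod.ext_iff.mp hj
    rw [← hκ, sub_add_cancel, zpow_natCast]

theorem IsExpanding.exists_latticePt_eq_pow_apply (hB : IsExpanding B) {l : Fin d → ℤ}
    (hl : l ≠ 0) : ∃ (j : ℕ) (k : Fin d → ℤ), (¬ ∃ l', latticePt k = B (latticePt l')) ∧
      latticePt l = (B ^ j) (latticePt k) := by
  obtain ⟨m₀, hm₀⟩ := hB.exists_zpow_latticePt_notMem_closedBall (norm_nonneg (latticePt l))
  let s : Set ℕ := {j | ∃ k, latticePt l = (B ^ j) (latticePt k)}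
  have hbdd : BddAbove s := by
    refine ⟨m₀, fun j ⟨k, hk⟩ => ?_⟩
    by_contra! hlt
    have hk0 : k ≠ 0 := by
      rintro rfl
      rw [latticePt_zero, map_zero, ← latticePt_zero] at hk
      exact hl (latticePt_injective hk)
    refine hm₀ j (by exact_mod_cast hlt.le) k hk0 ?_
    rw [zpow_natCast, ← hk, mem_closedBall_zero_iff]
  obtain ⟨k, hk⟩ : sSup s ∈ s := Nat.sSup_mem ⟨0, l, rfl⟩ hbdd
  refine ⟨sSup s, k, fun ⟨l', hl'⟩ => ?_, hk⟩
  have hsucc : sSup s + 1 ∈ s := ⟨l', by rw [hk, hl', pow_succ]; rfl⟩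
  exact absurd (le_csSup hbdd hsucc) (Nat.not_succ_le_self _)

theorem IsExpanding.exists_latticeShift_eq (hB : IsExpanding B) {x : ℤ × (Fin d → ℤ)}
    (hx : latticeShift B x ≠ 0) :
    ∃ (n : ℤ) (k : Fin d → ℤ), (¬ ∃ l, latticePt k = B (latticePt l)) ∧
      latticeShift B x = (B ^ n) (latticePt k) := by
  obtain ⟨j, k, hk, hxk⟩ := hB.exists_latticePt_eq_pow_apply
    (latticeShift_eq_zero_iff.not.mp hx)
  refine ⟨-x.1 + j, k, hk, ?_⟩
  rw [latticeShift, hxk, zpow_add_apply, zpow_natCast]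

end Fibers

section TermwiseIntegrals

variable {X ι : Type*} [MeasurableSpace X] {μ : Measure X} [Countable ι] {f : ι → X → ℂ}

theorem ae_summable_of_tsum_lintegral_ne_top (hf : ∀ i, Measurable (f i))
    (h : ∑' i, ∫⁻ x, ‖f i x‖ₑ ∂μ ≠ ∞) : ∀ᵐ x ∂μ, Summable fun i => f i x := by
  rw [← lintegral_tsum fun i => (hf i).enorm.aemeasurable] at h
  filter_upwards [ae_lt_top' (AEMeasurable.tsum fun i => (hf i).enorm.aemeasurable) h]
    with x hx
  exact Summable.of_norm ((ENNReal.summable_toReal hx.ne).congr fun i => by simp)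

theorem integrable_tsum_of_tsum_lintegral_ne_top (hf : ∀ i, Measurable (f i))
    (h : ∑' i, ∫⁻ x, ‖f i x‖ₑ ∂μ ≠ ∞) : Integrable (fun x => ∑' i, f i x) μ := by
  refine ⟨(Measurable.tsum hf).aestronglyMeasurable,
    (lintegral_mono fun x => enorm_tsum_le_tsum_enorm).trans_lt ?_⟩
  rw [lintegral_tsum fun i => (hf i).enorm.aemeasurable]
  exact h.lt_top

end TermwiseIntegrals

section TestFunctions

variable {V : Type*} [NormedAddCommGroup V]

theorem exists_mem_annulus_of_ne_zero {x y : V} (hx : x ≠ 0) (hy : y ≠ 0) :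
    ∃ n : ℕ, x ∈ annulus (1 / ((n : ℝ) + 1)) n ∧ y ∈ annulus (1 / ((n : ℝ) + 1)) n := by
  have heventually {x : V} (hx : x ≠ 0) :
      ∀ᶠ n : ℕ in Filter.atTop, x ∈ annulus (1 / ((n : ℝ) + 1)) n :=
    ((tendsto_one_div_add_atTop_nhds_zero_nat (𝕜 := ℝ)).eventually_le_const
      (norm_pos_iff.mpr hx)).and
      ((tendsto_natCast_atTop_atTop (R := ℝ)).eventually_ge_atTop ‖x‖)
  exact ((heventually hx).and (heventually hy)).exists

variable [MeasurableSpace V]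

theorem IsBandLimited.indicator {F : V → ℂ} (hF : IsBandLimited F) {s : Set V}
    (hs : MeasurableSet s) : IsBandLimited (s.indicator F) where
  measurable := hF.measurable.indicator hs
  exists_le := by
    obtain ⟨a, b, ha, M, hM⟩ := hF.exists_le
    exact ⟨a, b, ha, M, fun ξ => (enorm_indicator_le_enorm_self F ξ).trans (hM ξ)⟩

theorem ae_of_forall_ae_of_mem_annulus {μ : Measure V} [NullSingletonClass μ] (β : V) {P : V → Prop}
    (h : ∀ a b : ℝ, 0 < a → ∀ᵐ ξ ∂μ, ξ ∈ annulus a b → ξ + β ∈ annulus a b → P ξ) :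
    ∀ᵐ ξ ∂μ, P ξ := by
  have hne (x : V) : ∀ᵐ ξ ∂μ, ξ ≠ x := by simp [ae_iff, measure_singleton]
  filter_upwards [ae_all_iff.mpr fun n : ℕ => h (1 / ((n : ℝ) + 1)) n (by positivity), hne 0,
    hne (-β)] with ξ hξ hξ0 hξβ
  obtain ⟨n, hn, hnβ⟩ := exists_mem_annulus_of_ne_zero hξ0
    (mt eq_neg_of_add_eq_zero_left hξβ)
  exact hξ n hn hnβ

variable [BorelSpace V]

theorem isBandLimited_indicator_annulus {a : ℝ} (ha : 0 < a) (b : ℝ) :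
    IsBandLimited ((annulus a b : Set V).indicator (1 : V → ℂ)) where
  measurable := measurable_one.indicator measurableSet_annulus
  exists_le := by
    refine ⟨a, b, ha, 1, fun ξ => ?_⟩
    by_cases hξ : ξ ∈ annulus a b
    · simp [hξ, annulusInd_of_mem hξ]
    · simp [hξ]

variable [NormedSpace ℝ V] [FiniteDimensional ℝ V] {μ : Measure V} [μ.IsAddHaarMeasure]

theorem IsBandLimited.integrable_mul_conj_comp_add {F G : V → ℂ} (hF : IsBandLimited F)
    (hG : IsBandLimited G) (β : V) : Integrable (fun ξ => F ξ * conj (G (ξ + β))) μ := by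
  have : ProperSpace V := FiniteDimensional.proper ℝ V
  exact (hF.memLp μ).integrable_mul
    ((hG.memLp μ).comp_measurePreserving (measurePreserving_add_right μ β)).star

theorem ae_eq_of_forall_integral_bandLimited_eq [NullSingletonClass μ] {T : V → ℂ} {c : ℂ} {β : V}
    (hT : ∀ F G : V → ℂ, IsBandLimited F → IsBandLimited G →
      Integrable (fun ξ => F ξ * conj (G (ξ + β)) * T ξ) μ)
    (h : ∀ F G : V → ℂ, IsBandLimited F → IsBandLimited G →
      ∫ ξ, F ξ * conj (G (ξ + β)) * T ξ ∂μ = c * ∫ ξ, F ξ * conj (G (ξ + β)) ∂μ) :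
    ∀ᵐ ξ ∂μ, T ξ = c := by
  refine ae_of_forall_ae_of_mem_annulus β fun a b ha => ?_
  set W : V → ℂ := (annulus a b).indicator 1 with hW
  have hWlim : IsBandLimited W := isBandLimited_indicator_annulus ha b
  have heq := (hT W W hWlim hWlim).ae_eq_of_forall_setIntegral_eq _ _
    ((hWlim.integrable_mul_conj_comp_add (μ := μ) hWlim β).mul_const c) fun s hs _ => by
      have hmul (g : V → ℂ) : ∫ ξ, s.indicator W ξ * g ξ ∂μ = ∫ ξ in s, W ξ * g ξ ∂μ := by
        simp_rw [← integral_indicator hs, Set.indicator_mul_left]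
      rw [integral_mul_const, mul_comm]
      simpa only [mul_assoc, hmul] using h (s.indicator W) W (hWlim.indicator hs) hWlim
  filter_upwards [heq] with ξ hξ hmem hmem_add
  simpa [hW, hmem, hmem_add] using hξ

end TestFunctions

section FiberSums

variable {d : ℕ} {B : E d ≃L[ℝ] E d} {F G p q : E d → ℂ} {c : ℂ}
  {N : Type*} {e : N → ℤ × (Fin d → ℤ)} {β : E d}

theorem tsum_lintegral_crossTerm_fiber_ne_top (hB : IsExpanding B) (hF : IsBandLimited F)
    (hG : IsBandLimited G) (hp : IsSquareSummable B p) (hq : IsSquareSummable B q)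
    (he : Function.Injective e) (hβ : ∀ j, latticeShift B (e j) = β) :
    ∑' j, ∫⁻ ξ, ‖crossTerm B F G p q (e j).1 β ξ‖ₑ ≠ ∞ := by
  refine ne_top_of_le_ne_top (tsum_lintegral_crossTerm_ne_top hB hF hG hp hq)
    ((tsum_congr fun j => ?_).trans_le (ENNReal.tsum_comp_le_tsum_of_injective he _))
  rw [← hβ j]

theorem tsum_crossTerm (m : N → ℤ) (β ξ : E d) : ∑' j, crossTerm B F G p q (m j) β ξ
    = F ξ * conj (G (ξ + β)) * ∑' j, conj (p ((B ^ m j) ξ)) * q ((B ^ m j) (ξ + β)) :=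
  tsum_mul_left

variable [Countable N]

theorem ae_summable_fiber [NeZero d] (hB : IsExpanding B) (hp : IsSquareSummable B p)
    (hq : IsSquareSummable B q) (he : Function.Injective e)
    (hβ : ∀ j, latticeShift B (e j) = β) :
    ∀ᵐ ξ, Summable fun j => conj (p ((B ^ (e j).1) ξ)) * q ((B ^ (e j).1) (ξ + β)) := by
  refine ae_of_forall_ae_of_mem_annulus β fun a b ha => ?_
  have hW := isBandLimited_indicator_annulus (V := E d) ha b
  filter_upwards [ae_summable_of_tsum_lintegral_ne_top (fun j => measurable_crossTerm
    hW.measurable hW.measurable hp.measurable hq.measurable (e j).1 β)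
    (tsum_lintegral_crossTerm_fiber_ne_top hB hW hW hp hq he hβ)] with ξ hξ hmem hmem_add
  simpa [crossTerm, hmem, hmem_add] using hξ

theorem ae_hasSum_fiber_of_forall_integral_eq [NeZero d] (hB : IsExpanding B)
    (hp : IsSquareSummable B p) (hq : IsSquareSummable B q) (he : Function.Injective e)
    (hβ : ∀ j, latticeShift B (e j) = β)
    (h : ∀ F G : E d → ℂ, IsBandLimited F → IsBandLimited G → ∫ ξ, F ξ * conj (G (ξ + β)) *
        ∑' j, conj (p ((B ^ (e j).1) ξ)) * q ((B ^ (e j).1) (ξ + β))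
        = c * ∫ ξ, F ξ * conj (G (ξ + β))) :
    ∀ᵐ ξ, HasSum (fun j => conj (p ((B ^ (e j).1) ξ)) * q ((B ^ (e j).1) (ξ + β))) c := by
  have htsum := ae_eq_of_forall_integral_bandLimited_eq (fun F G hF hG => by
    simpa only [tsum_crossTerm] using integrable_tsum_of_tsum_lintegral_ne_top (μ := volume)
      (fun j => measurable_crossTerm hF.measurable hG.measurable hp.measurable hq.measurable
        (e j).1 β) (tsum_lintegral_crossTerm_fiber_ne_top hB hF hG hp hq he hβ)) h
  filter_upwards [ae_summable_fiber hB hp hq he hβ, htsum] with ξ hsummable heq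
  exact heq ▸ hsummable.hasSum

end FiberSums

section DualEquations

variable {d : ℕ} {B : E d ≃L[ℝ] E d} {F G p q : E d → ℂ} {c : ℂ} {S : Set (E d)}

/-- The contribution of the index `x` to the frequency side expansion of a pairing, if only lattice
shifts in `S` occur: all of them for affine systems, those in `ℤ^d` for quasi-affine ones. -/
def frameTerm (B : E d ≃L[ℝ] E d) (S : Set (E d)) (F G p q : E d → ℂ)
    (x : ℤ × (Fin d → ℤ)) : ℂ :=
  S.indicator (fun α => ∫ ξ, crossTerm B F G p q x.1 α ξ) (latticeShift B x)

theorem summable_frameTerm (hB : IsExpanding B) (S : Set (E d)) (hF : IsBandLimited F)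
    (hG : IsBandLimited G) (hp : IsSquareSummable B p) (hq : IsSquareSummable B q) :
    Summable (frameTerm B S F G p q) :=
  Summable.of_norm_bounded (summable_integral_crossTerm hB hF hG hp hq).norm fun _ =>
    norm_indicator_le_norm_self (fun α => ∫ ξ, crossTerm B F G p q _ α ξ) _

theorem tsum_frameTerm_fiber {N : Type*} [Countable N] {e : N → ℤ × (Fin d → ℤ)} {β : E d}
    (hB : IsExpanding B) (hF : IsBandLimited F) (hG : IsBandLimited G)
    (hp : IsSquareSummable B p) (hq : IsSquareSummable B q) (he : Function.Injective e)
    (hrange : latticeShift B ⁻¹' {β} = Set.range e) (hβ : β ∈ S) :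
    ∑' x : latticeShift B ⁻¹' {β}, frameTerm B S F G p q x
      = ∫ ξ, F ξ * conj (G (ξ + β)) *
        ∑' j, conj (p ((B ^ (e j).1) ξ)) * q ((B ^ (e j).1) (ξ + β)) := by
  have he_fiber (j : N) : latticeShift B (e j) = β :=
    hrange.ge (Set.mem_range_self j)
  rw [hrange, tsum_range _ he]
  simp_rw [← tsum_crossTerm]
  rw [integral_tsum (fun j => (measurable_crossTerm hF.measurable hG.measurable hp.measurable
    hq.measurable _ _).aestronglyMeasurable)
    (tsum_lintegral_crossTerm_fiber_ne_top hB hF hG hp hq he he_fiber)]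
  exact tsum_congr fun j => by rw [frameTerm, he_fiber, Set.indicator_of_mem hβ]

theorem IsBandLimited.planeWave_mul (hF : IsBandLimited F) (x : E d) :
    IsBandLimited fun ξ => planeWave x ξ * F ξ where
  measurable := (continuous_planeWave x).measurable.mul hF.measurable
  exists_le := by
    obtain ⟨a, b, ha, M, hM⟩ := hF.exists_le
    refine ⟨a, b, ha, M, fun ξ => ?_⟩
    rw [enorm_mul, ← ofReal_norm (planeWave x ξ), norm_planeWave, ENNReal.ofReal_one, one_mul]
    exact hM ξ

theorem planeWave_mul_mul_conj_planeWave_mul (x ξ α : E d) (u v : ℂ) :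
    planeWave (-x) ξ * u * conj (planeWave (-x) (ξ + α) * v)
      = u * conj v * planeWave x α := by
  simp only [planeWave_neg_left, map_mul, RCLike.conj_conj, planeWave_add_right]
  linear_combination u * conj v * planeWave x α * conj_planeWave_mul_self x ξ

theorem frameTerm_planeWave_mul (F G : E d → ℂ) (x : E d) (y : ℤ × (Fin d → ℤ)) :
    frameTerm B S (fun ξ => planeWave (-x) ξ * F ξ) (fun ξ => planeWave (-x) ξ * G ξ) p q y
      = frameTerm B S F G p q y * planeWave x (latticeShift B y) := by
  by_cases hy : latticeShift B y ∈ S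
  · simp only [frameTerm, Set.indicator_of_mem hy, ← integral_mul_const, crossTerm,
      planeWave_mul_mul_conj_planeWave_mul, mul_right_comm]
  · simp [frameTerm, hy]

/-- The equations characterizing when the systems generated by the inverse Fourier transforms of
`p` and `q` reproduce `c` times the inner product: `c = 1` for a pair of dual frames, `c = 0` for
orthogonal ones. -/
structure SatisfiesDualEquations (B : E d ≃L[ℝ] E d) (p q : E d → ℂ) (c : ℂ) : Prop where
  diagonal : ∀ᵐ ξ, HasSum (fun m : ℤ => conj (p ((B ^ m) ξ)) * q ((B ^ m) ξ)) c
  offDiagonal : ∀ k : Fin d → ℤ, (¬ ∃ l, latticePt k = B (latticePt l)) → ∀ᵐ ξ,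
    HasSum (fun n : ℕ => conj (p ((B ^ (n : ℤ)) ξ)) * q ((B ^ (n : ℤ)) (ξ + latticePt k))) 0

theorem injective_of_fst_eq_sub {e : ℕ → ℤ × (Fin d → ℤ)} {n : ℤ} (he : ∀ j, (e j).1 = j - n) :
    Function.Injective e := fun i j hij => by
  have hfst := congrArg Prod.fst hij
  rw [he, he] at hfst
  omega

/-- Modulating `F` and `G` multiplies the terms with shift `α` by a character evaluated at `α`, so
the contributions of the different shifts to a reproducing formula can be separated. -/
theorem tsum_frameTerm_fiber_eq (hB : IsExpanding B) (hp : IsSquareSummable B p)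
    (hq : IsSquareSummable B q)
    (h : ∀ F G : E d → ℂ, IsBandLimited F → IsBandLimited G →
      ∑' x, frameTerm B S F G p q x = c * ∫ ξ, F ξ * conj (G ξ))
    (hF : IsBandLimited F) (hG : IsBandLimited G) (β : E d) :
    ∑' x : latticeShift B ⁻¹' {β}, frameTerm B S F G p q x
      = c * (∫ ξ, F ξ * conj (G ξ)) * ({0} : Set (E d)).indicator 1 β := by
  refine tsum_fiber_eq_of_tsum_mul_planeWave_eq (summable_frameTerm hB S hF hG hp hq)
    (fun x => ?_) β
  simp_rw [← frameTerm_planeWave_mul]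
  rw [h _ _ (hF.planeWave_mul _) (hG.planeWave_mul _)]
  congr 1
  refine integral_congr_ae (.of_forall fun ξ => ?_)
  simpa [planeWave] using planeWave_mul_mul_conj_planeWave_mul x ξ 0 (F ξ) (G ξ)

theorem satisfiesDualEquations_of_tsum_frameTerm_eq [NeZero d] (hB : IsExpanding B)
    (hBint : IsIntegralMap B) (hp : IsSquareSummable B p) (hq : IsSquareSummable B q)
    (hS : Set.range latticePt ⊆ S)
    (h : ∀ F G : E d → ℂ, IsBandLimited F → IsBandLimited G →
      ∑' x, frameTerm B S F G p q x = c * ∫ ξ, F ξ * conj (G ξ)) :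
    SatisfiesDualEquations B p q c := by
  constructor
  · have hzero : (0 : E d) ∈ S := hS ⟨0, latticePt_zero⟩
    have he : Function.Injective fun m : ℤ => (m, (0 : Fin d → ℤ)) := Prod.mk_left_injective 0
    simpa only [add_zero] using ae_hasSum_fiber_of_forall_integral_eq (c := c) hB hp hq he
      (fun m => latticeShift_eq_zero_iff.mpr rfl) fun F G hF hG => by
        rw [← tsum_frameTerm_fiber hB hF hG hp hq he latticeShift_preimage_zero hzero,
          tsum_frameTerm_fiber_eq hB hp hq h hF hG]
        simp
  · intro k hk
    have hk0 : latticePt k ≠ 0 := fun h0 => hk ⟨0, by rw [h0, latticePt_zero, map_zero]⟩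
    obtain ⟨e, he, hrange⟩ := exists_latticeShift_preimage_eq_range hBint 0 hk
    change latticeShift B ⁻¹' {latticePt k} = _ at hrange
    simpa only [he, sub_zero] using ae_hasSum_fiber_of_forall_integral_eq (c := 0)
      (β := latticePt k) hB hp hq (injective_of_fst_eq_sub he)
      (fun j => hrange.ge (Set.mem_range_self j)) fun F G hF hG => by
        rw [← tsum_frameTerm_fiber hB hF hG hp hq (injective_of_fst_eq_sub he) hrange
          (hS ⟨k, rfl⟩), tsum_frameTerm_fiber_eq hB hp hq h hF hG]
        simp [hk0]

theorem SatisfiesDualEquations.tsum_frameTerm_fiber_eq_zero (hB : IsExpanding B)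
    (hBint : IsIntegralMap B) (hp : IsSquareSummable B p) (hq : IsSquareSummable B q)
    (h : SatisfiesDualEquations B p q c) (hF : IsBandLimited F) (hG : IsBandLimited G) {β : E d}
    (hβ : β ≠ 0) : ∑' x : latticeShift B ⁻¹' {β}, frameTerm B S F G p q x = 0 := by
  by_cases hβS : β ∈ S
  swap
  · exact (tsum_congr fun x => by
      rw [frameTerm, show latticeShift B x = β from x.2, Set.indicator_of_notMem hβS]).trans
      tsum_zero
  rcases (latticeShift B ⁻¹' {β}).eq_empty_or_nonempty with hempty | ⟨x, rfl⟩
  · rw [hempty]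
    exact tsum_empty
  obtain ⟨n, k, hk, hxk⟩ := hB.exists_latticeShift_eq hβ
  rw [hxk] at hβS ⊢
  obtain ⟨e, he, hrange⟩ := exists_latticeShift_preimage_eq_range hBint n hk
  rw [tsum_frameTerm_fiber hB hF hG hp hq (injective_of_fst_eq_sub he) hrange hβS]
  refine integral_eq_zero_of_ae ?_
  filter_upwards [(quasiMeasurePreserving_continuousLinearEquiv volume (B ^ (-n))).ae
    (h.offDiagonal k hk)] with ξ hξ
  simp only [he, sub_eq_add_neg, zpow_add_apply, map_add (B ^ (-n)), zpow_neg_zpow_apply,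
    hξ.tsum_eq, mul_zero, Pi.zero_apply]

theorem SatisfiesDualEquations.tsum_frameTerm_eq (hB : IsExpanding B) (hBint : IsIntegralMap B)
    (hp : IsSquareSummable B p) (hq : IsSquareSummable B q) (hS : (0 : E d) ∈ S)
    (h : SatisfiesDualEquations B p q c) (hF : IsBandLimited F) (hG : IsBandLimited G) :
    ∑' x, frameTerm B S F G p q x = c * ∫ ξ, F ξ * conj (G ξ) := by
  have hfiberwise := (summable_frameTerm hB S hF hG hp hq).hasSum.tsum_fiberwise (latticeShift B)
  rw [← hfiberwise.tsum_eq, tsum_eq_single (0 : E d) fun β hβ =>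
      h.tsum_frameTerm_fiber_eq_zero hB hBint hp hq hF hG hβ,
    tsum_frameTerm_fiber hB hF hG hp hq (Prod.mk_left_injective 0) latticeShift_preimage_zero hS,
    ← integral_const_mul]
  refine integral_congr_ae ?_
  filter_upwards [h.diagonal] with ξ hξ
  simp only [add_zero]
  rw [hξ.tsum_eq, mul_comm]

end DualEquations

section LevelExpansions

variable {d : ℕ} {B : E d ≃L[ℝ] E d} {F G p q : E d → ℂ} {S : Set (E d)}
  {U : L2 d → ℤ × (Fin d → ℤ) → L2 d}

/-- The frequency side expansion, level by level, of the pairings of two systems `U ψ` and `U φ`.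
Affine and quasi-affine systems both have one and differ only in the set `S` of lattice shifts that
occur; since `B` acts on the frequency side, level `n` corresponds to the terms of index `-n`. -/
def HasLevelExpansion (B : E d ≃L[ℝ] E d) (S : Set (E d))
    (U : L2 d → ℤ × (Fin d → ℤ) → L2 d) : Prop :=
  ∀ (ψ φ f g : L2 d) (F G : E d → ℂ), IsBandLimited F → IsBandLimited G →
    (𝓕 f : L2 d) =ᵐ[volume] F → (𝓕 g : L2 d) =ᵐ[volume] G → ∀ n : ℤ,
      HasSum (fun z => inner ℂ (U ψ (n, z)) f * conj (inner ℂ (U φ (n, z)) g))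
        (∑' l, frameTerm B S F G (𝓕 ψ : L2 d) (𝓕 φ : L2 d) (-n, l))

theorem hasLevelExpansion_affineSystem (A : GL (Fin d) ℝ) :
    HasLevelExpansion (euclideanEquiv (star A)) Set.univ (affineSystem A) := by
  intro ψ φ f g F G hF hG hf hg n
  simpa only [frameTerm, latticeShift, Set.indicator_univ, neg_neg] using
    hasSum_affineSystem_level hF hG hf hg n

theorem tsum_frameTerm_range_latticePt (hB : IsIntegralMap B) (j : ℕ) :
    ∑' l, frameTerm B (Set.range latticePt) F G p q (j, l)
      = ∑' l, ∫ ξ, crossTerm B F G p q j (latticePt l) ξ := by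
  choose κ hκ using hB.pow j
  have hshift (l : Fin d → ℤ) : latticeShift B (j, κ l) = latticePt l := by
    rw [latticeShift, ← hκ, ← zpow_natCast, zpow_neg_zpow_apply]
  have hκ_injective : Function.Injective κ := fun l l' h => latticePt_injective (by
    rw [← hshift l, ← hshift l', h])
  rw [← hκ_injective.tsum_eq]
  · exact tsum_congr fun l => by
      rw [frameTerm, hshift, Set.indicator_of_mem (Set.mem_range_self l)]
  · intro l hl
    obtain ⟨l', hl'⟩ : latticeShift B (j, l) ∈ Set.range latticePt :=
      Set.mem_of_indicator_ne_zero hl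
    exact ⟨l', latticePt_injective (by
      rw [← hκ, hl', latticeShift, ← zpow_natCast, zpow_zpow_neg_apply])⟩

theorem frameTerm_range_latticePt_neg (hB : IsIntegralMap B) (j : ℕ) (l : Fin d → ℤ) :
    frameTerm B (Set.range latticePt) F G p q (-j, l)
      = frameTerm B Set.univ F G p q (-j, l) := by
  obtain ⟨l', hl'⟩ := hB.pow j l
  have hmem : latticeShift B (-j, l) ∈ Set.range latticePt :=
    ⟨l', by rw [latticeShift, neg_neg, zpow_natCast, hl']⟩
  rw [frameTerm, frameTerm, Set.indicator_of_mem hmem, Set.indicator_univ]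

theorem hasLevelExpansion_quasiAffineSystem {A : GL (Fin d) ℝ}
    (hA : IsIntegralMap (euclideanEquiv (star A))) :
    HasLevelExpansion (euclideanEquiv (star A)) (Set.range latticePt) (quasiAffineSystem A) := by
  intro ψ φ f g F G hF hG hf hg n
  rcases lt_or_ge n 0 with hn | hn
  · have hlevel := hasSum_quasiAffineSystem_level_of_neg (A := A) (ψ := ψ) (φ := φ) hF hG hf hg hn
    obtain ⟨j, hj⟩ := Int.eq_ofNat_of_zero_le (Left.nonneg_neg_iff.mpr hn.le)
    rw [hj] at hlevel ⊢
    rwa [tsum_frameTerm_range_latticePt hA]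
  · have hlevel := hasLevelExpansion_affineSystem A ψ φ f g F G hF hG hf hg n
    obtain ⟨j, rfl⟩ := Int.eq_ofNat_of_zero_le hn
    simpa only [frameTerm_range_latticePt_neg hA, quasiAffineSystem, if_pos hn] using hlevel

theorem summable_norm_sq_of_hasSum_levels {N ι κ : Type*} {a : N × ι → ℂ} {t : N × κ → ℂ}
    (ht : Summable t)
    (ha : ∀ n, HasSum (fun z => a (n, z) * conj (a (n, z))) (∑' l, t (n, l))) :
    Summable fun x => ‖a x‖ ^ 2 := by
  simp only [Complex.mul_conj', ← Complex.ofReal_pow] at ha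
  have hlevel (n : N) : HasSum (fun z => ‖a (n, z)‖ ^ 2) (∑' l, t (n, l)).re := by
    simpa only [Complex.ofReal_re] using Complex.hasSum_re (ha n)
  rw [summable_prod_of_nonneg fun x => by positivity]
  refine ⟨fun n => (hlevel n).summable, ?_⟩
  simp_rw [(hlevel _).tsum_eq]
  exact (Complex.hasSum_re ht.prod.hasSum).summable

theorem hasSum_mul_conj_of_hasSum_levels {N ι κ : Type*} {a b : N × ι → ℂ} {t : N × κ → ℂ}
    (ha : Summable fun x => ‖a x‖ ^ 2) (hb : Summable fun x => ‖b x‖ ^ 2) (ht : Summable t)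
    (hab : ∀ n, HasSum (fun z => a (n, z) * conj (b (n, z))) (∑' l, t (n, l))) :
    HasSum (fun x => a x * conj (b x)) (∑' x, t x) := by
  have hsummable : Summable fun x => a x * conj (b x) := by
    refine .of_norm_bounded (ha.add hb) fun x => ?_
    rw [norm_mul, RCLike.norm_conj]
    nlinarith [sq_nonneg (‖a x‖ - ‖b x‖), sq_nonneg ‖a x‖, sq_nonneg ‖b x‖]
  convert hsummable.hasSum using 1
  rw [hsummable.tsum_prod, ht.tsum_prod]
  exact tsum_congr fun n => (hab n).tsum_eq.symm

theorem HasLevelExpansion.hasSum {ψ φ f g : L2 d} (hU : HasLevelExpansion B S U)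
    (hB : IsExpanding B) (hψ : IsSquareSummable B (𝓕 ψ : L2 d))
    (hφ : IsSquareSummable B (𝓕 φ : L2 d)) (hF : IsBandLimited F) (hG : IsBandLimited G)
    (hf : (𝓕 f : L2 d) =ᵐ[volume] F) (hg : (𝓕 g : L2 d) =ᵐ[volume] G) :
    HasSum (fun x => inner ℂ (U ψ x) f * conj (inner ℂ (U φ x) g))
      (∑' x, frameTerm B S F G (𝓕 ψ : L2 d) (𝓕 φ : L2 d) x) := by
  have hneg {t : ℤ × (Fin d → ℤ) → ℂ} (ht : Summable t) :
      Summable fun x : ℤ × (Fin d → ℤ) => t (-x.1, x.2) :=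
    ((Equiv.neg ℤ).prodCongr (Equiv.refl _)).summable_iff.mpr ht
  rw [← ((Equiv.neg ℤ).prodCongr (Equiv.refl _)).tsum_eq]
  exact hasSum_mul_conj_of_hasSum_levels
    (summable_norm_sq_of_hasSum_levels (hneg (summable_frameTerm hB S hF hF hψ hψ))
      (hU ψ ψ f f F F hF hF hf hf))
    (summable_norm_sq_of_hasSum_levels (hneg (summable_frameTerm hB S hG hG hφ hφ))
      (hU φ φ g g G G hG hG hg hg))
    (hneg (summable_frameTerm hB S hF hG hψ hφ)) (hU ψ φ f g F G hF hG hf hg)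

end LevelExpansions

section SquareSummability

variable {d : ℕ} {B : E d ≃L[ℝ] E d} {F G p : E d → ℂ} {S u : Set (E d)}
  {U : L2 d → ℤ × (Fin d → ℤ) → L2 d} {ψ f g : L2 d}

theorem inner_eq_integral_mul_conj (hf : (𝓕 f : L2 d) =ᵐ[volume] F)
    (hg : (𝓕 g : L2 d) =ᵐ[volume] G) : inner ℂ g f = ∫ ξ, F ξ * conj (G ξ) := by
  rw [inner_eq_integral_fourier]
  refine integral_congr_ae ?_
  filter_upwards [hf, hg] with ξ hfξ hgξ
  rw [hfξ, hgξ, mul_comm]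

theorem norm_sq_eq_volume_of_fourier_ae_eq_indicator (hu : MeasurableSet u)
    (hf : (𝓕 f : L2 d) =ᵐ[volume] u.indicator (1 : E d → ℂ)) : ‖f‖ ^ 2 = volume.real u := by
  have hinner := inner_eq_integral_mul_conj hf hf
  have hmul (ξ : E d) : u.indicator (1 : E d → ℂ) ξ * conj (u.indicator (1 : E d → ℂ) ξ)
      = u.indicator 1 ξ := by by_cases hξ : ξ ∈ u <;> simp [hξ]
  simp only [hmul, inner_self_eq_norm_sq_to_K] at hinner
  rw [integral_indicator hu] at hinner
  simp only [Pi.one_apply, setIntegral_const, Complex.real_smul, mul_one] at hinner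
  exact Complex.ofReal_injective (by simpa using hinner)

theorem tsum_frameTerm_indicator_one (hS : (0 : E d) ∈ S) (hu : MeasurableSet u) {m : ℤ}
    (hdisj : ∀ l ≠ 0, ∀ ξ ∈ u, ξ + latticeShift B (m, l) ∉ u) :
    ∑' l, frameTerm B S (u.indicator 1) (u.indicator 1) p p (m, l)
      = ((∫ ξ in u, ‖p ((B ^ m) ξ)‖ ^ 2 : ℝ) : ℂ) := by
  rw [tsum_eq_single 0]
  · rw [frameTerm, latticeShift_eq_zero_iff.mpr rfl, Set.indicator_of_mem hS,
      ← integral_complex_ofReal, ← integral_indicator hu]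
    refine integral_congr_ae (.of_forall fun ξ => ?_)
    by_cases hξ : ξ ∈ u <;> simp [crossTerm, hξ, Complex.conj_mul']
  · intro l hl
    have hzero (ξ : E d) :
        crossTerm B (u.indicator 1) (u.indicator 1) p p m (latticeShift B (m, l)) ξ = 0 := by
      by_cases hξ : ξ ∈ u
      · simp [crossTerm, hdisj l hl ξ hξ]
      · simp [crossTerm, hξ]
    by_cases hmem : latticeShift B (m, l) ∈ S <;> simp [frameTerm, hmem, hzero]

theorem HasLevelExpansion.sum_setIntegral_le (hU : HasLevelExpansion B S U)
    (hS : (0 : E d) ∈ S) {C : ℝ} (hC : ∀ v : L2 d, Summable (fun x => ‖inner ℂ (U ψ x) v‖ ^ 2) ∧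
      ∑' x, ‖inner ℂ (U ψ x) v‖ ^ 2 ≤ C * ‖v‖ ^ 2)
    (s : Finset ℤ) (hu : MeasurableSet u) (hlim : IsBandLimited (u.indicator (1 : E d → ℂ)))
    (hdisj : ∀ m ∈ s, ∀ l ≠ 0, ∀ ξ ∈ u, ξ + latticeShift B (m, l) ∉ u) :
    ∑ m ∈ s, ∫ ξ in u, ‖(𝓕 ψ : L2 d) ((B ^ m) ξ)‖ ^ 2 ≤ C * volume.real u := by
  obtain ⟨f, hf⟩ := exists_fourier_ae_eq (hlim.memLp volume)
  have hlevel (m : ℤ) (hm : m ∈ s) : HasSum (fun z => ‖inner ℂ (U ψ (-m, z)) f‖ ^ 2)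
      (∫ ξ in u, ‖(𝓕 ψ : L2 d) ((B ^ m) ξ)‖ ^ 2) := by
    have hexpansion := hU ψ ψ f f _ _ hlim hlim hf hf (-m)
    rw [neg_neg, tsum_frameTerm_indicator_one hS hu (hdisj m hm)] at hexpansion
    simpa only [Complex.mul_conj', ← Complex.ofReal_pow, Complex.hasSum_ofReal] using hexpansion
  obtain ⟨hsummable, hle⟩ := hC f
  rw [← norm_sq_eq_volume_of_fourier_ae_eq_indicator hu hf]
  refine le_trans ?_ hle
  rw [hsummable.tsum_prod, ← (Equiv.neg ℤ).tsum_eq,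
    Finset.sum_congr rfl fun m hm => (hlevel m hm).tsum_eq.symm]
  exact Summable.sum_le_tsum (f := fun m : ℤ => ∑' z, ‖inner ℂ (U ψ (-m, z)) f‖ ^ 2) s
    (fun m _ => tsum_nonneg fun z => by positivity)
    ((Equiv.neg ℤ).summable_iff.mpr hsummable.prod)

theorem measurable_enorm_sq_comp_zpow (hp : Measurable p) (B : E d ≃L[ℝ] E d) (m : ℤ) :
    Measurable fun ξ => ‖p ((B ^ m) ξ)‖ₑ ^ 2 :=
  (hp.comp (measurable_zpow B m)).enorm.pow_const 2

theorem measurable_coeFn (f : L2 d) : Measurable (f : E d → ℂ) :=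
  (Lp.stronglyMeasurable f).measurable

theorem HasLevelExpansion.setLIntegral_sum_le (hU : HasLevelExpansion B S U)
    (hS : (0 : E d) ∈ S) {C : ℝ} (hC : ∀ v : L2 d, Summable (fun x => ‖inner ℂ (U ψ x) v‖ ^ 2) ∧
      ∑' x, ‖inner ℂ (U ψ x) v‖ ^ 2 ≤ C * ‖v‖ ^ 2)
    (s : Finset ℤ) (hu : MeasurableSet u) (hu_fin : volume u ≠ ∞)
    (hlim : IsBandLimited (u.indicator (1 : E d → ℂ)))
    (hdisj : ∀ m ∈ s, ∀ l ≠ 0, ∀ ξ ∈ u, ξ + latticeShift B (m, l) ∉ u) :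
    ∫⁻ ξ in u, ∑ m ∈ s, ‖(𝓕 ψ : L2 d) ((B ^ m) ξ)‖ₑ ^ 2 ≤ ENNReal.ofReal C * volume u := by
  have hofReal (m : ℤ) : ∫⁻ ξ in u, ‖(𝓕 ψ : L2 d) ((B ^ m) ξ)‖ₑ ^ 2
      = ENNReal.ofReal (∫ ξ in u, ‖(𝓕 ψ : L2 d) ((B ^ m) ξ)‖ ^ 2) := by
    rw [ofReal_integral_eq_lintegral_ofReal (memLp_comp_continuousLinearEquiv (B ^ m)
      (Lp.memLp (𝓕 ψ))).norm.integrable_sq.integrableOn (.of_forall fun ξ => by positivity)]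
    simp only [ENNReal.ofReal_pow (norm_nonneg _), ofReal_norm]
  rw [lintegral_finsetSum _ fun m _ => measurable_enorm_sq_comp_zpow (measurable_coeFn _) B m]
  simp_rw [hofReal]
  rw [← ENNReal.ofReal_sum_of_nonneg fun m _ => integral_nonneg fun ξ => by positivity,
    ← ofReal_measureReal hu_fin, ← ENNReal.ofReal_mul' measureReal_nonneg]
  exact ENNReal.ofReal_le_ofReal (hU.sum_setIntegral_le hS hC s hu hlim hdisj)

theorem exists_pos_forall_le_norm_latticeShift (B : E d ≃L[ℝ] E d) (s : Finset ℤ) :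
    ∃ ρ : ℝ, 0 < ρ ∧ ∀ m ∈ s, ∀ l : Fin d → ℤ, l ≠ 0 → ρ ≤ ‖latticeShift B (m, l)‖ := by
  set N : ℤ → ℝ := fun m => ‖((B ^ m : E d ≃L[ℝ] E d) : E d →L[ℝ] E d)‖
  have hpos : 0 < ∑ m ∈ s, N m + 1 :=
    add_pos_of_nonneg_of_pos (Finset.sum_nonneg fun m _ => norm_nonneg _) one_pos
  refine ⟨(∑ m ∈ s, N m + 1)⁻¹, inv_pos.mpr hpos, fun m hm l hl => ?_⟩
  rw [inv_le_iff_one_le_mul₀' hpos]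
  calc 1 ≤ ‖(B ^ m) (latticeShift B (m, l))‖ := by
        rw [latticeShift, zpow_zpow_neg_apply]
        exact one_le_norm_latticePt hl
    _ ≤ N m * ‖latticeShift B (m, l)‖ :=
        ContinuousLinearMap.le_opNorm ((B ^ m : E d ≃L[ℝ] E d) : E d →L[ℝ] E d) _
    _ ≤ (∑ m ∈ s, N m + 1) * ‖latticeShift B (m, l)‖ := by
        gcongr
        exact (Finset.single_le_sum (f := N) (fun m _ => norm_nonneg _) hm).trans (by simp)

open Topology in
theorem ae_le_const_of_forall_exists_nhds_setLIntegral_le {X : Type*} [TopologicalSpace X]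
    [SecondCountableTopology X] [MeasurableSpace X] [OpensMeasurableSpace X] {μ : Measure X}
    [SigmaFinite μ] {h : X → ℝ≥0∞} (hh : Measurable h) {c : ℝ≥0∞} {W : Set X}
    (hW : MeasurableSet W) (hle : ∀ x, ∃ v ∈ 𝓝 x, ∀ t ⊆ W ∩ v, MeasurableSet t →
      ∫⁻ y in t, h y ∂μ ≤ c * μ t) : ∀ᵐ x ∂μ, x ∈ W → h x ≤ c := by
  refine measure_null_of_locally_null _ fun x _ => ?_
  obtain ⟨v, hv, hvle⟩ := hle x
  obtain ⟨o, hov, ho, hxo⟩ := mem_nhds_iff.mp hv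
  refine ⟨o ∩ {y | ¬ (y ∈ W → h y ≤ c)}, Filter.inter_mem (mem_nhdsWithin_of_mem_nhds
    (ho.mem_nhds hxo)) self_mem_nhdsWithin, ?_⟩
  have hWo : MeasurableSet (W ∩ o) := hW.inter ho.measurableSet
  have hae := ae_le_of_forall_setLIntegral_le_of_sigmaFinite (μ := μ.restrict (W ∩ o))
    (f := h) (g := fun _ => c) hh fun t ht _ => by
      rw [Measure.restrict_restrict ht, setLIntegral_const]
      exact hvle _ (Set.inter_subset_right.trans (Set.inter_subset_inter_right W hov))
        (ht.inter hWo)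
  refine measure_mono_null ?_ ((ae_restrict_iff' hWo).mp hae)
  rintro y ⟨hyo, hy⟩ himp
  exact hy fun hyW => himp ⟨hyW, hyo⟩

theorem isSquareSummable_of_ae_tsum_le (f : L2 d) {C : ℝ≥0∞} (hC : C ≠ ∞)
    (h : ∀ a b : ℝ, 0 < a → ∀ᵐ ξ, ξ ∈ annulus a b → ∑' m : ℤ, ‖f ((B ^ m) ξ)‖ₑ ^ 2 ≤ C) :
    IsSquareSummable B f where
  measurable := measurable_coeFn f
  lintegral_ne_top := by
    have hlt := (Lp.memLp f).2
    rw [eLpNorm_lt_top_iff_lintegral_rpow_enorm_lt_top (by simp) (by simp)] at hlt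
    simpa using hlt.ne
  annulus_ne_top a b ha := by
    refine ne_top_of_le_ne_top (ENNReal.mul_ne_top
      (lintegral_annulusInd_lt_top (a := a) (b := b) (volume : Measure (E d))).ne hC) ?_
    rw [← lintegral_mul_const _ measurable_annulusInd]
    refine lintegral_mono_ae ?_
    filter_upwards [h a b ha] with ξ hξ
    by_cases hmem : ξ ∈ annulus a b
    · gcongr
      exact hξ hmem
    · simp [annulusInd_of_notMem hmem]

/-- On a set of small diameter all lattice shifts but zero drop out of finitely many levels, so the
Bessel bound controls a finite part of the Calderón sum there. -/
theorem HasLevelExpansion.isSquareSummable (hU : HasLevelExpansion B S U) (hS : (0 : E d) ∈ S)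
    (hψ : IsBessel (U ψ)) : IsSquareSummable B (𝓕 ψ : L2 d) := by
  obtain ⟨C, hC⟩ := hψ
  refine isSquareSummable_of_ae_tsum_le _ ENNReal.ofReal_ne_top (C := ENNReal.ofReal C)
    fun a b ha => ?_
  have hfinite (s : Finset ℤ) : ∀ᵐ ξ, ξ ∈ annulus a b →
      ∑ m ∈ s, ‖(𝓕 ψ : L2 d) ((B ^ m) ξ)‖ₑ ^ 2 ≤ ENNReal.ofReal C := by
    obtain ⟨ρ, hρ, hshift⟩ := exists_pos_forall_le_norm_latticeShift B s
    refine ae_le_const_of_forall_exists_nhds_setLIntegral_le (Finset.measurable_sum s fun m _ =>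
      measurable_enorm_sq_comp_zpow (measurable_coeFn _) B m) measurableSet_annulus fun x =>
      ⟨Metric.ball x (ρ / 2), Metric.ball_mem_nhds x (half_pos hρ), fun t ht ht_meas => ?_⟩
    have hlim : IsBandLimited (t.indicator (1 : E d → ℂ)) := by
      simpa only [Set.indicator_indicator, Set.inter_eq_left.mpr fun _ hξ => (ht hξ).1] using
        (isBandLimited_indicator_annulus (V := E d) ha b).indicator ht_meas
    refine hU.setLIntegral_sum_le hS hC s ht_meas (Metric.isBounded_ball.subset fun ξ hξ =>
      (ht hξ).2).measure_lt_top.ne hlim fun m hm l hl ξ hξ hξ' => ?_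
    have hdist := dist_triangle_right (ξ + latticeShift B (m, l)) ξ x
    rw [dist_eq_norm (ξ + _) ξ, add_sub_cancel_left] at hdist
    linarith [hshift m hm l hl, Metric.mem_ball.mp (ht hξ).2, Metric.mem_ball.mp (ht hξ').2]
  filter_upwards [ae_all_iff.mpr hfinite] with ξ hξ hmem
  rw [ENNReal.tsum_eq_iSup_sum]
  exact iSup_le fun s => hξ s hmem

theorem SatisfiesDualEquations.isSquareSummable {c : ℂ}
    (h : SatisfiesDualEquations B (𝓕 ψ : L2 d) (𝓕 ψ : L2 d) c) :
    IsSquareSummable B (𝓕 ψ : L2 d) := by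
  refine isSquareSummable_of_ae_tsum_le _ (ENNReal.ofReal_ne_top (r := c.re)) fun a b _ => ?_
  filter_upwards [h.diagonal] with ξ hξ _
  have hreal : HasSum (fun m : ℤ => ‖(𝓕 ψ : L2 d) ((B ^ m) ξ)‖ ^ 2) c.re := by
    simpa only [Complex.conj_mul', ← Complex.ofReal_pow, Complex.ofReal_re] using
      Complex.hasSum_re hξ
  rw [← hreal.tsum_eq, ENNReal.ofReal_tsum_of_nonneg (fun m => by positivity) hreal.summable]
  simp only [ENNReal.ofReal_pow (norm_nonneg _), ofReal_norm, le_refl]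

end SquareSummability

section ParsevalFrames

variable {H J : Type*} [NormedAddCommGroup H] [InnerProductSpace ℂ H] {x : J → H} {D : Set H}

/-- The analysis operator `v ↦ (⟪x_j, v⟫)_j` into `ℓ²` of a family with square summable
coefficients. -/
def analysisOperator (x : J → H) (hx : ∀ v, Summable fun j => ‖inner ℂ (x j) v‖ ^ 2) :
    H →ₗ[ℂ] lp (fun _ : J => ℂ) 2 where
  toFun v := ⟨fun j => inner ℂ (x j) v, (memℓp_gen_iff (by simp)).mpr (by simpa using hx v)⟩
  map_add' v w := by ext j; exact inner_add_right _ _ _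
  map_smul' c v := by ext j; exact inner_smul_right _ _ _

theorem hasSum_norm_sq_analysisOperator (hx : ∀ v, Summable fun j => ‖inner ℂ (x j) v‖ ^ 2)
    (v : H) : HasSum (fun j => ‖inner ℂ (x j) v‖ ^ 2) (‖analysisOperator x hx v‖ ^ 2) := by
  have hsum := lp.hasSum_norm (p := 2) (by simp) (analysisOperator x hx v)
  simp only [ENNReal.toReal_ofNat, Real.rpow_ofNat] at hsum
  exact hsum

theorem sum_norm_sq_inner_le_of_dense (hD : Dense D)
    (h : ∀ v ∈ D, HasSum (fun j => ‖inner ℂ (x j) v‖ ^ 2) (‖v‖ ^ 2)) (s : Finset J) (v : H) :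
    ∑ j ∈ s, ‖inner ℂ (x j) v‖ ^ 2 ≤ ‖v‖ ^ 2 := by
  have hclosed : IsClosed {v : H | ∑ j ∈ s, ‖inner ℂ (x j) v‖ ^ 2 ≤ ‖v‖ ^ 2} :=
    isClosed_le (by fun_prop) (by fun_prop)
  exact hclosed.closure_subset_iff.mpr
    (fun w hw => sum_le_hasSum s (fun _ _ => by positivity) (h w hw)) (hD v)

theorem isParsevalFrame_of_dense (hD : Dense D)
    (h : ∀ v ∈ D, HasSum (fun j => ‖inner ℂ (x j) v‖ ^ 2) (‖v‖ ^ 2)) : IsParsevalFrame x := by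
  have hle := sum_norm_sq_inner_le_of_dense hD h
  have hx (v : H) : Summable fun j => ‖inner ℂ (x j) v‖ ^ 2 :=
    summable_of_sum_le (fun _ => by positivity) (hle · v)
  have hnorm_le (v : H) : ‖analysisOperator x hx v‖ ≤ 1 * ‖v‖ := by
    rw [one_mul, ← sq_le_sq₀ (norm_nonneg _) (norm_nonneg v)]
    exact hasSum_le_of_sum_le (hasSum_norm_sq_analysisOperator hx v) (hle · v)
  have hcontinuous : Continuous (analysisOperator x hx) :=
    ((analysisOperator x hx).mkContinuous 1 hnorm_le).continuous
  have hclosed : IsClosed {v : H | ‖analysisOperator x hx v‖ ^ 2 = ‖v‖ ^ 2} :=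
    isClosed_eq (hcontinuous.norm.pow 2) (continuous_norm.pow 2)
  intro v
  have hv : ‖analysisOperator x hx v‖ ^ 2 = ‖v‖ ^ 2 := hclosed.closure_subset_iff.mpr
    (fun w hw => (hasSum_norm_sq_analysisOperator hx w).unique (h w hw)) (hD v)
  exact hv ▸ hasSum_norm_sq_analysisOperator hx v

theorem IsParsevalFrame.isBessel (h : IsParsevalFrame x) : IsBessel x :=
  ⟨1, fun v => ⟨(h v).summable, by rw [(h v).tsum_eq, one_mul]⟩⟩

theorem IsParsevalFrame.hasSum_mul_conj (h : IsParsevalFrame x) (v w : H) :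
    HasSum (fun j => inner ℂ (x j) v * conj (inner ℂ (x j) w)) (inner ℂ w v) := by
  have hofReal (u : H) : HasSum (fun j => (‖inner ℂ (x j) u‖ : ℂ) ^ 2) ((‖u‖ : ℂ) ^ 2) := by
    exact_mod_cast Complex.hasSum_ofReal.mpr (h u)
  have hpolarized := (((hofReal (w + v)).sub (hofReal (w - v))).add
    (((hofReal (w - Complex.I • v)).sub (hofReal (w + Complex.I • v))).mul_right
      Complex.I)).div_const 4
  rw [inner_eq_sum_norm_sq_div_four]
  refine (congrArg (HasSum · _ _) (funext fun j => ?_)).mpr hpolarized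
  have hscalar := inner_eq_sum_norm_sq_div_four (𝕜 := ℂ) (inner ℂ (x j) w) (inner ℂ (x j) v)
  rw [RCLike.inner_apply'] at hscalar
  rw [mul_comm, hscalar]
  simp

end ParsevalFrames

section DirectSums

variable {H ι J : Type*} [NormedAddCommGroup H]

theorem dense_setOf_forall_mem [Finite ι] {D : Set H} (hD : Dense D) :
    Dense {v : PiLp 2 fun _ : ι => H | ∀ i, v i ∈ D} := by
  have hpi := (dense_pi (Set.univ : Set ι) (s := fun _ => D) fun _ _ => hD).preimage
    (PiLp.homeomorph 2 fun _ : ι => H).isOpenMap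
  convert hpi using 1
  ext v
  simp [PiLp.homeomorph]

variable [InnerProductSpace ℂ H] [Fintype ι] {x : ι → J → H}

theorem inner_single_right [DecidableEq ι] (u : PiLp 2 fun _ : ι => H) (i : ι) (f : H) :
    inner ℂ u (PiLp.single 2 i f) = inner ℂ (u i) f := by
  rw [PiLp.inner_apply, Finset.sum_eq_single i]
  · simp
  · intro j _ hj
    simp [hj]
  · simp

theorem IsParsevalFrame.of_toLp
    (h : IsParsevalFrame fun j => (WithLp.toLp 2 fun i => x i j : PiLp 2 fun _ : ι => H)) (i : ι) :
    IsParsevalFrame (x i) := fun v => by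
  classical
  simpa only [inner_single_right, PiLp.norm_single] using h (PiLp.single 2 i v)

theorem isParsevalFrame_toLp_iff [DecidableEq ι] {D : Set H} (hD : Dense D) :
    IsParsevalFrame (fun j => (WithLp.toLp 2 fun i => x i j : PiLp 2 fun _ : ι => H)) ↔
      ∀ i i', ∀ f ∈ D, ∀ g ∈ D, HasSum
        (fun j => inner ℂ (x i j) f * conj (inner ℂ (x i' j) g))
        ((if i = i' then 1 else 0) * inner ℂ g f) := by
  constructor
  · intro h i i' f _ g _
    have hsum := h.hasSum_mul_conj (PiLp.single 2 i f) (PiLp.single 2 i' g)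
    simp only [inner_single_right, PiLp.single_apply] at hsum
    convert hsum using 1
    rcases eq_or_ne i i' with rfl | hi
    · simp
    · simp [hi]
  · refine fun h => isParsevalFrame_of_dense (dense_setOf_forall_mem hD) fun v hv => ?_
    rw [← Complex.hasSum_ofReal]
    have hsum := hasSum_sum (s := Finset.univ) fun i _ => hasSum_sum (s := Finset.univ)
      fun i' _ => h i i' (v i) (hv i) (v i') (hv i')
    convert hsum using 1
    · funext j
      rw [Complex.ofReal_pow, ← Complex.mul_conj', PiLp.inner_apply, map_sum, Finset.sum_mul_sum]
    · rw [PiLp.norm_sq_eq_of_L2]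
      simp [inner_self_eq_norm_sq_to_K]

end DirectSums

section Density

section BandLimitedAlgebra

variable {V : Type*} [NormedAddCommGroup V] [MeasurableSpace V] {F G : V → ℂ}

theorem IsBandLimited.add (hF : IsBandLimited F) (hG : IsBandLimited G) :
    IsBandLimited (F + G) where
  measurable := hF.measurable.add hG.measurable
  exists_le := by
    obtain ⟨a, b, ha, M, hFM, hGM⟩ := hF.exists_common hG
    refine ⟨a, b, ha, M + M, fun ξ => (enorm_add_le _ _).trans ?_⟩
    rw [ENNReal.coe_add, add_mul]
    exact add_le_add (hFM ξ) (hGM ξ)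

theorem IsBandLimited.const_smul (hF : IsBandLimited F) (c : ℂ) : IsBandLimited (c • F) where
  measurable := hF.measurable.const_smul c
  exists_le := by
    obtain ⟨a, b, ha, M, hFM⟩ := hF.exists_le
    refine ⟨a, b, ha, ‖c‖₊ * M, fun ξ => ?_⟩
    rw [Pi.smul_apply, enorm_smul, ENNReal.coe_mul, mul_assoc]
    exact mul_le_mul_right (hFM ξ) _

theorem isBandLimited_zero : IsBandLimited (0 : V → ℂ) where
  measurable := measurable_zero
  exists_le := ⟨1, 1, one_pos, 0, fun ξ => by simp⟩

end BandLimitedAlgebra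

variable {d : ℕ}

/-- The subspace of the functions with a band-limited Fourier transform, on which frame operators
are computed. -/
def bandLimited (d : ℕ) : Submodule ℂ (L2 d) where
  carrier := {f | ∃ F, IsBandLimited F ∧ (𝓕 f : L2 d) =ᵐ[volume] F}
  add_mem' := by
    rintro f g ⟨F, hF, hf⟩ ⟨G, hG, hg⟩
    refine ⟨F + G, hF.add hG, ?_⟩
    rw [show (𝓕 (f + g) : L2 d) = 𝓕 f + 𝓕 g from (Lp.fourierTransformₗᵢ (E d) ℂ).map_add f g]
    exact (Lp.coeFn_add _ _).trans (hf.add hg)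
  zero_mem' := by
    refine ⟨0, isBandLimited_zero, ?_⟩
    rw [show (𝓕 (0 : L2 d) : L2 d) = 0 from (Lp.fourierTransformₗᵢ (E d) ℂ).map_zero]
    exact Lp.coeFn_zero _ _ _
  smul_mem' := by
    rintro c f ⟨F, hF, hf⟩
    refine ⟨c • F, hF.const_smul c, ?_⟩
    rw [show (𝓕 (c • f) : L2 d) = c • 𝓕 f from (Lp.fourierTransformₗᵢ (E d) ℂ).map_smul c f]
    exact (Lp.coeFn_smul _ _).trans (hf.const_smul c)

theorem ae_fourier_eq_zero_of_mem_orthogonal {g : L2 d} (hg : g ∈ (bandLimited d)ᗮ) {s : Set (E d)}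
    (hs : MeasurableSet s) (hlim : IsBandLimited (s.indicator (𝓕 g : L2 d))) :
    ∀ᵐ ξ, ξ ∈ s → (𝓕 g : L2 d) ξ = 0 := by
  obtain ⟨f, hf⟩ := exists_fourier_ae_eq (hlim.memLp volume)
  have hinner : inner ℂ f g = 0 := hg f ⟨_, hlim, hf⟩
  rw [inner_eq_integral_mul_conj (F := (𝓕 g : L2 d)) .rfl hf] at hinner
  have hintegral : ∫ ξ in s, ‖(𝓕 g : L2 d) ξ‖ ^ 2 = 0 := by
    rw [← integral_indicator hs, ← Complex.ofReal_inj, ← integral_complex_ofReal,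
      Complex.ofReal_zero, ← hinner]
    refine integral_congr_ae (.of_forall fun ξ => ?_)
    by_cases hξ : ξ ∈ s <;> simp [hξ, Complex.mul_conj']
  rw [setIntegral_eq_zero_iff_of_nonneg_ae (.of_forall fun ξ => by positivity)
    (Lp.memLp (𝓕 g)).norm.integrable_sq.integrableOn] at hintegral
  filter_upwards [(ae_restrict_iff' hs).mp hintegral] with ξ hξ hmem
  simpa using hξ hmem

theorem dense_bandLimited [NeZero d] : Dense (bandLimited d : Set (L2 d)) := by
  rw [Submodule.dense_iff_topologicalClosure_eq_top, Submodule.topologicalClosure_eq_top_iff,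
    Submodule.eq_bot_iff]
  intro g hg
  have hmeas := measurable_coeFn (𝓕 g : L2 d)
  have hbounded (a b : ℝ) (ha : 0 < a) (n : ℕ) : ∀ᵐ ξ,
      ξ ∈ annulus a b ∩ {ξ | ‖(𝓕 g : L2 d) ξ‖ ≤ n} → (𝓕 g : L2 d) ξ = 0 := by
    have hs : MeasurableSet (annulus a b ∩ {ξ | ‖(𝓕 g : L2 d) ξ‖ ≤ n}) :=
      measurableSet_annulus.inter (measurableSet_le hmeas.norm measurable_const)
    refine ae_fourier_eq_zero_of_mem_orthogonal hg hs
      ⟨hmeas.indicator hs, a, b, ha, n, fun ξ => ?_⟩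
    by_cases hξ : ξ ∈ annulus a b ∩ {ξ | ‖(𝓕 g : L2 d) ξ‖ ≤ n}
    · rw [Set.indicator_of_mem hξ, annulusInd_of_mem hξ.1, mul_one, enorm_le_coe]
      exact_mod_cast hξ.2
    · simp [Set.indicator_of_notMem hξ]
  have hzero : (𝓕 g : L2 d) = 0 := by
    refine Lp.eq_zero_iff_ae_eq_zero.mpr (ae_of_forall_ae_of_mem_annulus 0 fun a b ha => ?_)
    filter_upwards [ae_all_iff.mpr (hbounded a b ha)] with ξ hξ hmem _
    obtain ⟨n, hn⟩ := exists_nat_ge ‖(𝓕 g : L2 d) ξ‖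
    exact hξ n ⟨hmem, hn⟩
  exact (Lp.fourierTransformₗᵢ (E d) ℂ).injective (hzero.trans (map_zero _).symm)

end Density

section Coordinates

variable {d r : ℕ}

theorem piLpCongrRight_zpow_apply (e : L2 d ≃ₗᵢ[ℂ] L2 d) (n : ℤ) (v : L2Sum d r) (i : Fin r) :
    ((LinearIsometryEquiv.piLpCongrRight 2 fun _ => e : L2Sum d r ≃ₗᵢ[ℂ] L2Sum d r) ^ n) v i
      = (e ^ n) (v i) := by
  let diagonal : (L2 d ≃ₗᵢ[ℂ] L2 d) →* (L2Sum d r ≃ₗᵢ[ℂ] L2Sum d r) :=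
    { toFun := fun e => LinearIsometryEquiv.piLpCongrRight 2 fun _ => e
      map_one' := rfl
      map_mul' := fun _ _ => rfl }
  exact congrArg (· i) (DFunLike.congr_fun (map_zpow diagonal e n).symm v)

theorem smul_toContinuousLinearEquiv_zpow_apply {V : Type*} [NormedAddCommGroup V]
    [NormedSpace ℂ V] (c : ℂˣ) (e : V ≃ₗᵢ[ℂ] V) (n : ℤ) (v : V) :
    ((c • e.toContinuousLinearEquiv) ^ n) v = ((c ^ n : ℂˣ) : ℂ) • (e ^ n) v := by
  let scaled : ℂˣ × (V ≃ₗᵢ[ℂ] V) →* (V ≃L[ℂ] V) :=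
    { toFun := fun x => x.1 • x.2.toContinuousLinearEquiv
      map_one' := by ext v; exact one_smul _ v
      map_mul' := fun x y => by
        ext v
        change ((x.1 * y.1 : ℂˣ) : ℂ) • x.2 (y.2 v) = (x.1 : ℂ) • x.2 ((y.1 : ℂ) • y.2 v)
        rw [map_smul, smul_smul, Units.val_mul] }
  exact DFunLike.congr_fun (map_zpow scaled (c, e) n).symm v

theorem renormDilationSum_zpow_apply (A : GL (Fin d) ℝ) (n : ℤ) (v : L2Sum d r) (i : Fin r) :
    (renormDilationSum r A ^ n) v i = (renormDilation A ^ n) (v i) := by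
  rw [renormDilationSum, renormDilation, smul_toContinuousLinearEquiv_zpow_apply,
    smul_toContinuousLinearEquiv_zpow_apply, PiLp.smul_apply, dilationSum,
    piLpCongrRight_zpow_apply]

variable (A : GL (Fin d) ℝ) (ψ : Fin r → L2 d)

theorem superAffineSystem_toLp : superAffineSystem A (WithLp.toLp 2 ψ)
    = fun x => WithLp.toLp 2 fun i => affineSystem A (ψ i) x := by
  funext x
  ext1 i
  exact piLpCongrRight_zpow_apply _ _ _ i

theorem superQuasiAffineSystem_toLp : superQuasiAffineSystem A (WithLp.toLp 2 ψ)
    = fun x => WithLp.toLp 2 fun i => quasiAffineSystem A (ψ i) x := by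
  funext x
  ext1 i
  simp only [superQuasiAffineSystem, quasiAffineSystem]
  split_ifs
  · exact piLpCongrRight_zpow_apply _ _ _ i
  · exact congrArg (translation _) (renormDilationSum_zpow_apply A _ _ i)

end Coordinates

section Characterization

variable {d r : ℕ} {B : E d ≃L[ℝ] E d} {S : Set (E d)} {U : L2 d → ℤ × (Fin d → ℤ) → L2 d}

theorem HasLevelExpansion.forall_hasSum_iff [NeZero d] (hU : HasLevelExpansion B S U)
    (hB : IsExpanding B) (hBint : IsIntegralMap B) (hS : Set.range latticePt ⊆ S) {ψ φ : L2 d}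
    (hψ : IsSquareSummable B (𝓕 ψ : L2 d)) (hφ : IsSquareSummable B (𝓕 φ : L2 d)) (c : ℂ) :
    (∀ f ∈ bandLimited d, ∀ g ∈ bandLimited d,
      HasSum (fun x => inner ℂ (U ψ x) f * conj (inner ℂ (U φ x) g)) (c * inner ℂ g f)) ↔
      SatisfiesDualEquations B (𝓕 ψ : L2 d) (𝓕 φ : L2 d) c := by
  constructor
  · intro h
    refine satisfiesDualEquations_of_tsum_frameTerm_eq hB hBint hψ hφ hS fun F G hF hG => ?_
    obtain ⟨f, hf⟩ := exists_fourier_ae_eq (hF.memLp volume)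
    obtain ⟨g, hg⟩ := exists_fourier_ae_eq (hG.memLp volume)
    rw [← inner_eq_integral_mul_conj hf hg]
    exact (hU.hasSum hB hψ hφ hF hG hf hg).unique (h f ⟨F, hF, hf⟩ g ⟨G, hG, hg⟩)
  · rintro h f ⟨F, hF, hf⟩ g ⟨G, hG, hg⟩
    rw [inner_eq_integral_mul_conj hf hg,
      ← h.tsum_frameTerm_eq hB hBint hψ hφ (hS ⟨0, latticePt_zero⟩) hF hG]
    exact hU.hasSum hB hψ hφ hF hG hf hg

theorem HasLevelExpansion.isParsevalFrame_toLp_iff [NeZero d] (hU : HasLevelExpansion B S U)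
    (hB : IsExpanding B) (hBint : IsIntegralMap B) (hS : Set.range latticePt ⊆ S)
    {ι : Type*} [Fintype ι] [DecidableEq ι] (ψ : ι → L2 d) :
    IsParsevalFrame (fun x => (WithLp.toLp 2 fun i => U (ψ i) x : PiLp 2 fun _ : ι => L2 d)) ↔
      ∀ i j, SatisfiesDualEquations B (𝓕 (ψ i) : L2 d) (𝓕 (ψ j) : L2 d)
        (if i = j then 1 else 0) := by
  have iff_of_isSquareSummable (hψ : ∀ i, IsSquareSummable B (𝓕 (ψ i) : L2 d)) :=
    (SuperWavelet.isParsevalFrame_toLp_iff (x := fun i => U (ψ i)) dense_bandLimited).trans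
      (forall₂_congr fun i j => hU.forall_hasSum_iff hB hBint hS (hψ i) (hψ j)
        (if i = j then 1 else 0))
  constructor
  · exact fun h => (iff_of_isSquareSummable fun i =>
      hU.isSquareSummable (hS ⟨0, latticePt_zero⟩) (h.of_toLp i).isBessel).mp h
  · exact fun h => (iff_of_isSquareSummable fun i => (h i i).isSquareSummable).mpr h

theorem forall_satisfiesDualEquations_iff {A : GL (Fin d) ℝ} {ψ : Fin r → L2 d} :
    (∀ i j, SatisfiesDualEquations (euclideanEquiv (star A)) (𝓕 (ψ i) : L2 d) (𝓕 (ψ j) : L2 d)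
      (if i = j then 1 else 0)) ↔ DiagonalEquation A ψ ∧ OffDiagonalEquation A ψ := by
  have hasSum_conj_iff {ι : Type} (u v : ι → ℂ) (s : ℂ) :
      HasSum (fun n => conj (u n) * v n) s ↔ HasSum (fun n => u n * conj (v n)) (conj s) := by
    rw [← Complex.hasSum_conj]
    simp only [map_mul, RCLike.conj_conj]
  have conj_ite (i j : Fin r) : conj (if i = j then (1 : ℂ) else 0) = if i = j then 1 else 0 := by
    split_ifs <;> simp
  simp only [DiagonalEquation, OffDiagonalEquation, adjPow_eq_euclideanEquiv, zpow_one]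
  constructor
  · refine fun h => ⟨fun i j => ?_, fun i j k hk => ?_⟩
    · simpa only [hasSum_conj_iff, conj_ite] using (h i j).diagonal
    · simpa only [hasSum_conj_iff, map_zero] using (h i j).offDiagonal k hk
  · rintro ⟨hdiagonal, hoffDiagonal⟩ i j
    refine ⟨?_, fun k hk => ?_⟩
    · simpa only [hasSum_conj_iff, conj_ite] using hdiagonal i j
    · simpa only [hasSum_conj_iff, map_zero] using hoffDiagonal i j k hk

end Characterization

section DimensionZero

theorem translation_of_dimension_zero (α : E 0) (ψ : L2 0) : translation α ψ = ψ := by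
  ext1
  filter_upwards [coeFn_translation α ψ] with ξ hξ
  rw [hξ, Subsingleton.elim (ξ - α) ξ]

theorem affineSystem_of_dimension_zero (A : GL (Fin 0) ℝ) (ψ : L2 0) (x : ℤ × (Fin 0 → ℤ)) :
    affineSystem A ψ x = ψ := by
  rw [affineSystem, translation_of_dimension_zero, ← dilation_zpow,
    Subsingleton.elim (A ^ x.1) (A ^ (0 : ℤ)), dilation_zpow]
  rfl

theorem quasiAffineSystem_of_dimension_zero (A : GL (Fin 0) ℝ) (ψ : L2 0)
    (x : ℤ × (Fin 0 → ℤ)) : quasiAffineSystem A ψ x = ψ := by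
  rw [quasiAffineSystem, affineSystem_of_dimension_zero, translation_of_dimension_zero,
    ← renormDilation_zpow, Subsingleton.elim (A ^ x.1) (A ^ (0 : ℤ)), renormDilation_zpow]
  exact ite_self ψ

theorem isParsevalFrame_const_iff {H J : Type*} [NormedAddCommGroup H] [InnerProductSpace ℂ H]
    [Infinite J] {u : H} : IsParsevalFrame (fun _ : J => u) ↔ Subsingleton H := by
  refine ⟨fun h => subsingleton_of_forall_eq 0 fun v => ?_, fun h v => ?_⟩
  · have hinner := (summable_const_iff _).mp (h v).summable
    have hsum := h v
    simp only [hinner] at hsum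
    simpa using hsum.unique hasSum_zero
  · simp [Subsingleton.elim v 0]

theorem nontrivial_Lp {X : Type*} [MeasurableSpace X] {μ : Measure X} [IsFiniteMeasure μ]
    [NeZero μ] {p : ℝ≥0∞} : Nontrivial (Lp ℂ p μ) := by
  have hone : MemLp (fun _ : X => (1 : ℂ)) p μ := memLp_const 1
  refine ⟨hone.toLp, 0, fun h => ?_⟩
  obtain ⟨x, hx, hx0⟩ := (hone.coeFn_toLp.and (Lp.coeFn_zero ℂ p μ)).exists
  rw [h, hx0] at hx
  exact zero_ne_one hx

theorem subsingleton_L2Sum_zero_iff {r : ℕ} : Subsingleton (L2Sum 0 r) ↔ IsEmpty (Fin r) := by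
  have : Nontrivial (L2 0) := nontrivial_Lp
  refine ⟨fun h => not_nonempty_iff.mp fun hr => ?_, fun h => ⟨fun v w => by ext i; exact h.elim i⟩⟩
  exact not_subsingleton (Fin r → L2 0) (WithLp.toLp_injective 2).subsingleton

theorem diagonalEquation_and_offDiagonalEquation_iff_of_dimension_zero {r : ℕ} {A : GL (Fin 0) ℝ}
    {ψ : Fin r → L2 0} : DiagonalEquation A ψ ∧ OffDiagonalEquation A ψ ↔ IsEmpty (Fin r) := by
  refine ⟨fun h => ⟨fun i => ?_⟩, fun h => ⟨fun i => h.elim i, fun i => h.elim i⟩⟩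
  obtain ⟨ξ, hξ⟩ := (h.1 i i).exists
  simp only [Subsingleton.elim (adjPow A _ ξ) ξ, if_true] at hξ
  rw [(summable_const_iff _).mp hξ.summable] at hξ
  exact zero_ne_one (hasSum_zero.unique hξ)

theorem tfae_of_dimension_zero {r : ℕ} (A : GL (Fin 0) ℝ) (ψ : Fin r → L2 0) :
    List.TFAE [IsParsevalFrame (superAffineSystem A (WithLp.toLp 2 ψ)),
      IsParsevalFrame (superQuasiAffineSystem A (WithLp.toLp 2 ψ)),
      DiagonalEquation A ψ ∧ OffDiagonalEquation A ψ] := by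
  simp only [superAffineSystem_toLp, superQuasiAffineSystem_toLp, affineSystem_of_dimension_zero,
    quasiAffineSystem_of_dimension_zero, isParsevalFrame_const_iff, subsingleton_L2Sum_zero_iff,
    diagonalEquation_and_offDiagonalEquation_iff_of_dimension_zero]
  tfae_finish

end DimensionZero

end SuperWavelet

end

theorem mainTheorem5_general {d r : ℕ} (A : GL (Fin d) ℝ)
    (hexp : SuperWavelet.IsExpansive (A : Matrix (Fin d) (Fin d) ℝ))
    (hint : SuperWavelet.IsIntegralMatrix (A : Matrix (Fin d) (Fin d) ℝ))
    (ψ : Fin r → SuperWavelet.L2 d) :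
    List.TFAE [
      SuperWavelet.IsParsevalFrame (SuperWavelet.superAffineSystem A (WithLp.toLp 2 ψ)),
      SuperWavelet.IsParsevalFrame (SuperWavelet.superQuasiAffineSystem A (WithLp.toLp 2 ψ)),
      SuperWavelet.DiagonalEquation A ψ ∧ SuperWavelet.OffDiagonalEquation A ψ] := by
  rcases eq_zero_or_neZero d with rfl | _
  · exact SuperWavelet.tfae_of_dimension_zero A ψ
  have hB := hexp.isExpanding_euclideanEquiv_star
  have hBint := hint.isIntegralMap_euclideanEquiv_star
  rw [SuperWavelet.superAffineSystem_toLp, SuperWavelet.superQuasiAffineSystem_toLp,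
    (SuperWavelet.hasLevelExpansion_affineSystem A).isParsevalFrame_toLp_iff hB hBint
      (Set.subset_univ _),
    (SuperWavelet.hasLevelExpansion_quasiAffineSystem hBint).isParsevalFrame_toLp_iff hB hBint
      subset_rfl,
    SuperWavelet.forall_satisfiesDualEquations_iff]
  tfae_finish

theorem mainTheorem5 {d r : ℕ} (A : GL (Fin d) ℝ)
    (hexp : SuperWavelet.IsExpansive (A : Matrix (Fin d) (Fin d) ℝ))
    (hint : SuperWavelet.IsIntegralMatrix (A : Matrix (Fin d) (Fin d) ℝ))
    (ψ : Fin r → SuperWavelet.L2 d)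
    (hψ : ∀ i, SuperWavelet.IsBessel (SuperWavelet.affineSystem A (ψ i))) :
    List.TFAE [
      SuperWavelet.IsParsevalFrame (SuperWavelet.superAffineSystem A (WithLp.toLp 2 ψ)),
      SuperWavelet.IsParsevalFrame (SuperWavelet.superQuasiAffineSystem A (WithLp.toLp 2 ψ)),
      SuperWavelet.DiagonalEquation A ψ ∧ SuperWavelet.OffDiagonalEquation A ψ] :=
  mainTheorem5_general A hexp hint ψ
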